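/- **Setting.** Let $D\subset\mathbb R^2$ be a disk (a compact convex region with non-empty interior) whose boundary contains a straight segment. A PBDTP network $\mathcal N$ in $D$ is a finite directed graph, drawn in the plane with straight edges and without crossings, with positive edge weights $w_e$, such that: it has $n$ univalent boundary vertices $b_1,\dots,b_n$, lying on this segment and labelled clockwise along it; its internal vertices lie in the interior of $D$ and are bivalent or trivalent, and each has exactly one incoming edge or exactly one outgoing edge; no component is isolated from the boundary; internal vertices are colored black or white, a trivalent one being white if it has one incoming edge and black otherwise; each internal face has trivalent vertices of both colors on its boundary; each boundary vertex is joined by its edge to a bivalent white internal vertex. Let $I=\{i_1<\dots<i_k\}\subset[n]$ be the labels of the boundary sources (boundary vertices whose edge is outgoing); the other boundary vertices are sinks. A gauge ray direction $\mathfrak l$ is a direction such that the rays in direction $\mathfrak l$ from the boundary vertices point inside $D$ and contain no internal vertex, and no edge between internal vertices is parallel to $\mathfrak l$. Let $\mathfrak l_{i}$ be the ray of direction $\mathfrak l$ starting at $b_{i}$ (its initial point excluded). For plane vectors let $s(c,d)\in\{1,0,-1\}$ be the sign of $\det(c,d)$. For consecutive directed edges $e,f$ put $\mathrm{wind}(e,f)=\pm1$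 if $s(e,f)=s(e,\mathfrak l)=s(\mathfrak l,f)=\pm1$, and $\mathrm{wind}(e,f)=0$ otherwise. Let $\mathrm{int}(e)$ be the number of rays $\mathfrak l_i$, $i\in I$, that meet $e$. For a directed path $P=(e_1,\dots,e_m)$ let $\mathrm{wind}(P)=\sum_{t<m}\mathrm{wind}(e_t,e_{t+1})$, $\mathrm{int}(P)=\sum_t\mathrm{int}(e_t)$ and $w(P)=\prod_t w_{e_t}$. The $j$-th component of the edge vector at $e$ is $$(E_e)_j=\sum_{P:e\to b_j}(-1)^{\mathrm{wind}(P)+\mathrm{int}(P)}w(P),$$ over all directed paths with first edge $e$ and end point $b_j$; this and the next sum are formal power series in the weights, and their values are the values of the rational expressions with subtraction-free denominator to which they sum up. The boundary measurement matrix $A$ (in reduced row echelon form with respect to $I$) is the $k\times n$ matrix whose columns in $I$ form the identity matrix, and for $j\notin I$ $$A^r_j=(-1)^{N_{rj}}\sum_{P:b_{i_r}\to b_j}(-1)^{\mathrm{topwind}(P)}w(P),\qquad N_{rj}=\#\{i_s\in I:\ \min(i_r,j)<i_s<\max(i_r,j)\},$$ where $\mathrm{topwind}(P)$ is the signed number of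 full turns of the tangent of $P$, when $P$ is bent at its ends so as to leave $b_{i_r}$ and to arrive at $b_j$ in the direction of the vector $b_j-b_{i_r}$. A conservative flow is a set $C$ of edges, none incident to the boundary, such that at each internal vertex as many edges of $C$ arrive as leave. An edge flow from $e$ to the sink $b_j$ is a set $F\ni e$ of edges such that at each internal vertex other than the initial vertex $V$ of $e$ as many edges of $F$ arrive as leave, at $V$ one more leaves than arrives, and $F$ contains the edge at $b_j$ and no edge at any boundary vertex other than $b_j$ and, possibly, $V$. Let $\mathcal F_{e,b_j}$ and $\mathcal C$ be the sets of these edge flows and of the conservative flows, and let $w(F)=\prod_{f\in F}w_f$. **Statement.** Let $e$ be the edge at the boundary source $b_{i_r}$, and let $b_j$ be a boundary sink. Each $F\in\mathcal F_{e,b_j}$ is the union of a unique edge loop-erased walk $P$ from $e$ to $b_j$ (a directed path passing no edge twice) and a conservative flow that has no edge in common with $P$; put $\mathrm{wind}(F)=\mathrm{wind}(P)$ and $\mathrm{int}(F)=\mathrm{int}(P)$. Then $$\mathrm{wind}(F)+\mathrm{int}(F)\equiv N_{rj}\pmod 2\qquad\text{for all }F\in\mathcal F_{e,b_j},$$ both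 formal sums above (for $(E_e)_j$ and for $A^r_j$) sum up to rational expressions in the weights with subtraction-free denominators, and $$(E_e)_j=(-1)^{N_{rj}}\,\frac{\sum_{F\in\mathcal F_{e,b_j}}w(F)}{\sum_{C\in\mathcal C}w(C)}=A^r_j .$$ -/

import Mathlib

/-! The plane is `ℂ`. Edges are straight segments, so that every edge has a direction. -/

noncomputable section

open scoped Classical

/-! ### Plane geometry -/

/-- The determinant of the ordered pair of plane vectors `(c, d)`. -/
def crossProd (c d : ℂ) : ℝ := c.re * d.im - c.im * d.re

/-- `s(c, d)`: `+1`, `0`, `-1` for positively oriented, parallel, negatively oriented pairs. -/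
def orientSign (c d : ℂ) : SignType := SignType.sign (crossProd c d)

/-- The local winding number of the ordered pair `(c, d)` with respect to the direction `l`. -/
def localWind (l c d : ℂ) : ℤ :=
  if orientSign c d = 1 ∧ orientSign c l = 1 ∧ orientSign l d = 1 then 1
  else if orientSign c d = -1 ∧ orientSign c l = -1 ∧ orientSign l d = -1 then -1
  else 0

/-- The sum of the signed angles, each in `(-π, π]`, between consecutive vectors of a list. -/
def turning : List ℂ → ℝ
  | c :: d :: L => Complex.arg (d / c) + turning (d :: L)
  | _ => 0

/-- The signed number of full turns of a direction that starts as `τ`, runs through `L`, and ends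
as `τ`. The quotient is an integer when no vector is zero (`rotationNumber_eq`), so that the
rounding only changes its type. -/
def rotationNumber (τ : ℂ) (L : List ℂ) : ℤ :=
  round (turning (τ :: (L ++ [τ])) / (2 * Real.pi))

theorem exp_turning (c : ℂ) (L : List ℂ) (h : ∀ d ∈ c :: L, d ≠ 0) :
    ∃ a : ℝ, 0 < a ∧ (c :: L).getLast (by simp) =
      a * c * Complex.exp (turning (c :: L) * Complex.I) := by
  induction L generalizing c with
  | nil => exact ⟨1, one_pos, by simp [turning]⟩
  | cons d L ih =>
    obtain ⟨a, ha, hE⟩ := ih d (fun x hx => h x (List.mem_cons_of_mem _ hx))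
    have hc : c ≠ 0 := h c (by simp)
    have hd : d ≠ 0 := h d (by simp)
    have hq : d / c ≠ 0 := div_ne_zero hd hc
    refine ⟨a * ‖d / c‖, mul_pos ha (norm_pos_iff.mpr hq), ?_⟩
    rw [List.getLast_cons (by simp), hE]
    have h1 : d = c * (‖d / c‖ * Complex.exp (Complex.arg (d / c) * Complex.I)) := by
      rw [Complex.norm_mul_exp_arg_mul_I]; field_simp
    have h2 : turning (c :: d :: L) = Complex.arg (d / c) + turning (d :: L) := rfl
    rw [h2]
    push_cast
    rw [add_mul, Complex.exp_add]
    calc (a : ℂ) * d * Complex.exp (turning (d :: L) * Complex.I)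
        = a * (c * (‖d / c‖ * Complex.exp (Complex.arg (d / c) * Complex.I))) *
            Complex.exp (turning (d :: L) * Complex.I) := by rw [← h1]
      _ = _ := by ring

theorem rotationNumber_eq (τ : ℂ) (L : List ℂ) (hτ : τ ≠ 0) (hL : ∀ d ∈ L, d ≠ 0) :
    (rotationNumber τ L : ℝ) = turning (τ :: (L ++ [τ])) / (2 * Real.pi) := by
  obtain ⟨a, ha, h⟩ := exp_turning τ (L ++ [τ]) (by
    intro d hd
    simp only [List.mem_cons, List.mem_append, List.not_mem_nil, or_false] at hd
    rcases hd with rfl | hd | rfl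
    · exact hτ
    · exact hL d hd
    · exact hτ)
  set T := turning (τ :: (L ++ [τ])) with hT
  have hlast : (τ :: (L ++ [τ])).getLast (by simp) = τ := by simp
  rw [hlast] at h
  have h1 : (a : ℂ) * Complex.exp (T * Complex.I) = 1 := by
    apply mul_left_cancel₀ hτ
    rw [mul_one]
    conv_rhs => rw [h]
    ring
  have ha1 : a = 1 := by
    have := congrArg norm h1
    rw [norm_mul, Complex.norm_exp_ofReal_mul_I] at this
    simpa [abs_of_pos ha] using this
  rw [ha1] at h1
  simp only [Complex.ofReal_one, one_mul] at h1
  obtain ⟨m, hm⟩ := Complex.exp_eq_one_iff.mp h1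
  have hm2 : T = m * (2 * Real.pi) := by
    have := congrArg Complex.im hm
    simpa using this
  have hpi : (2 * Real.pi) ≠ 0 := by positivity
  have h3 : T / (2 * Real.pi) = (m : ℝ) := by rw [hm2]; field_simp
  rw [rotationNumber, ← hT, h3, round_intCast]

/-! ### Formal sums over walks as rational expressions -/

section Rational

variable {E : Type*}

/-- The power series `M` sums up to the rational expression `p / q`, whose denominator `q` is
subtraction-free. -/
def SumsToRational (M : MvPowerSeries E ℝ) (p q : MvPolynomial E ℝ) : Prop :=
  (∀ m, 0 ≤ q.coeff m) ∧ q ≠ 0 ∧ (q : MvPowerSeries E ℝ) * M = (p : MvPowerSeries E ℝ)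

/-- The power series `M` sums up to a rational expression with subtraction-free denominator. -/
def IsRationalSeries (M : MvPowerSeries E ℝ) : Prop := ∃ p q, SumsToRational M p q

/-- The value at `w` of the rational expression to which `M` sums up (`0` if there is none). For
positive `w` it does not depend on the representation (`rationalValue_eq`). -/
def rationalValue (M : MvPowerSeries E ℝ) (w : E → ℝ) : ℝ :=
  if h : IsRationalSeries M then
    MvPolynomial.eval w h.choose / MvPolynomial.eval w h.choose_spec.choose
  else 0

theorem SumsToRational.eval_pos {M : MvPowerSeries E ℝ} {p q : MvPolynomial E ℝ}
    (h : SumsToRational M p q) {w : E → ℝ} (hw : ∀ e, 0 < w e) :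
    0 < MvPolynomial.eval w q := by
  rw [MvPolynomial.eval_eq]
  refine Finset.sum_pos (fun m hm => ?_) ?_
  · refine mul_pos (lt_of_le_of_ne (h.1 m) ?_) (Finset.prod_pos fun i _ => pow_pos (hw i) _)
    exact (MvPolynomial.mem_support_iff.mp hm).symm
  · exact MvPolynomial.support_nonempty.mpr h.2.1

theorem rationalValue_eq {M : MvPowerSeries E ℝ} {p q : MvPolynomial E ℝ}
    (h : SumsToRational M p q) {w : E → ℝ} (hw : ∀ e, 0 < w e) :
    rationalValue M w = MvPolynomial.eval w p / MvPolynomial.eval w q := by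
  have hR : IsRationalSeries M := ⟨p, q, h⟩
  rw [rationalValue, dif_pos hR]
  have h2 : SumsToRational M hR.choose hR.choose_spec.choose := hR.choose_spec.choose_spec
  rw [div_eq_div_iff (h2.eval_pos hw).ne' (h.eval_pos hw).ne', ← map_mul, ← map_mul]
  congr 1
  have h3 : ((hR.choose * q : MvPolynomial E ℝ) : MvPowerSeries E ℝ) =
      ((p * hR.choose_spec.choose : MvPolynomial E ℝ) : MvPowerSeries E ℝ) := by
    rw [MvPolynomial.coe_mul, MvPolynomial.coe_mul, ← h2.2.2, ← h.2.2]
    ring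
  exact MvPolynomial.coe_injective E ℝ h3

/-- The formal sum `∑ sgn(P) x^P` over the lists `P` of edges with property `W`, where `x^P` is the
product of the variables of the edges of `P`, with multiplicity. -/
def walkSeries (W : List E → Prop) (sgn : List E → ℝ) : MvPowerSeries E ℝ :=
  fun m => ∑ᶠ P ∈ {P : List E | W P ∧ Multiset.toFinsupp (P : Multiset E) = m}, sgn P

/-- Each coefficient of `walkSeries` is a finite sum. -/
theorem walkSeries_finite (W : List E → Prop) (m : E →₀ ℕ) :
    {P : List E | W P ∧ Multiset.toFinsupp (P : Multiset E) = m}.Finite := by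
  obtain ⟨L, hL⟩ := Quot.exists_rep (Finsupp.toMultiset m)
  refine (List.finite_toSet L.permutations).subset ?_
  rintro P ⟨-, rfl⟩
  rw [Multiset.toFinsupp_toMultiset] at hL
  exact List.mem_permutations.mpr (Multiset.coe_eq_coe.mp hL.symm)

end Rational

/-! ### Networks in the disk -/

/-- The data of a weighted directed network drawn in a disk, with boundary vertices
`b i = Sum.inl i`, internal vertices `Sum.inr v`, and straight edges. The boundary vertices lie on
the side of the disk from `sideStart` to `sideEnd`. -/
structure DiskNetwork (n : ℕ) (V E : Type*) where
  /-- initial vertex of an edge -/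
  src : E → Fin n ⊕ V
  /-- final vertex of an edge -/
  tgt : E → Fin n ⊕ V
  /-- position of a vertex in the plane -/
  pos : Fin n ⊕ V → ℂ
  /-- the white internal vertices; the others are black -/
  IsWhite : V → Prop
  /-- edge weights -/
  weight : E → ℝ
  /-- the disk -/
  disk : Set ℂ
  /-- first end of the straight side -/
  sideStart : ℂ
  /-- second end of the straight side -/
  sideEnd : ℂ

namespace DiskNetwork

variable {n : ℕ} {V E : Type*} [Fintype E] (N : DiskNetwork n V E)

/-- The direction vector of an edge. -/
def dir (e : E) : ℂ := N.pos (N.tgt e) - N.pos (N.src e)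

/-- Number of incoming edges at a vertex. -/
def inDeg (x : Fin n ⊕ V) : ℕ := (Finset.univ.filter fun e => N.tgt e = x).card

/-- Number of outgoing edges at a vertex. -/
def outDeg (x : Fin n ⊕ V) : ℕ := (Finset.univ.filter fun e => N.src e = x).card

/-- Valency of a vertex. -/
def degree (x : Fin n ⊕ V) : ℕ := N.inDeg x + N.outDeg x

/-- Two vertices joined by an edge, in either direction. -/
def Adj (x y : Fin n ⊕ V) : Prop :=
  ∃ e, (N.src e = x ∧ N.tgt e = y) ∨ (N.src e = y ∧ N.tgt e = x)

/-- The union of all edges. -/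
def drawing : Set ℂ := ⋃ e, segment ℝ (N.pos (N.src e)) (N.pos (N.tgt e))

/-- The face that contains the point `z`. -/
def face (z : ℂ) : Set ℂ := connectedComponentIn (interior N.disk \ N.drawing) z

/-- Planar bicolored directed trivalent perfect networks in the disk. -/
structure IsPBDTP : Prop where
  /-- The disk is a compact convex region of the plane. -/
  isCompact_disk : IsCompact N.disk
  convex_disk : Convex ℝ N.disk
  nonempty_interior : (interior N.disk).Nonempty
  /-- Its boundary contains a straight side, traversed clockwise (the disk lies to the right). -/
  side_subset : segment ℝ N.sideStart N.sideEnd ⊆ frontier N.disk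
  side_clockwise : ∀ z ∈ interior N.disk,
    crossProd (N.sideEnd - N.sideStart) (z - N.sideStart) < 0
  /-- The boundary vertices lie on this side, labelled clockwise. -/
  boundary_pos : ∃ t : Fin n → ℝ, StrictMono t ∧ ∀ i, t i ∈ Set.Icc (0 : ℝ) 1 ∧
    N.pos (Sum.inl i) = N.sideStart + (t i : ℂ) * (N.sideEnd - N.sideStart)
  /-- The internal vertices lie strictly inside. -/
  internal_pos : ∀ v, N.pos (Sum.inr v) ∈ interior N.disk
  /-- The drawing is plane: different vertices have different positions, no vertex lies in the
  relative interior of an edge (in particular there are no loops), different edges do not cross. -/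
  pos_injective : Function.Injective N.pos
  vertex_off_edge : ∀ x e, N.pos x ∉ openSegment ℝ (N.pos (N.src e)) (N.pos (N.tgt e))
  edges_disjoint : ∀ e f, e ≠ f →
    Disjoint (openSegment ℝ (N.pos (N.src e)) (N.pos (N.tgt e)))
      (openSegment ℝ (N.pos (N.src f)) (N.pos (N.tgt f)))
  /-- No component is isolated from the boundary. -/
  connected : ∀ v, ∃ i, Relation.ReflTransGen N.Adj (Sum.inr v) (Sum.inl i)
  /-- Boundary vertices are univalent. -/
  boundary_degree : ∀ i, N.degree (Sum.inl i) = 1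
  /-- Internal vertices are bivalent or trivalent. -/
  internal_degree : ∀ v, N.degree (Sum.inr v) = 2 ∨ N.degree (Sum.inr v) = 3
  /-- Perfect orientation. -/
  perfect : ∀ v, N.inDeg (Sum.inr v) = 1 ∨ N.outDeg (Sum.inr v) = 1
  /-- A trivalent vertex is white if it has only one incoming edge, and black otherwise. -/
  trivalent_color : ∀ v, N.degree (Sum.inr v) = 3 → (N.IsWhite v ↔ N.inDeg (Sum.inr v) = 1)
  /-- Each internal face has trivalent vertices of both colors on its boundary. -/
  internal_face : ∀ z ∈ interior N.disk \ N.drawing,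
    Disjoint (closure (N.face z)) (frontier N.disk) →
      (∃ v, N.degree (Sum.inr v) = 3 ∧ N.IsWhite v ∧ N.pos (Sum.inr v) ∈ closure (N.face z)) ∧
      (∃ v, N.degree (Sum.inr v) = 3 ∧ ¬ N.IsWhite v ∧ N.pos (Sum.inr v) ∈ closure (N.face z))
  /-- The edge at a boundary vertex joins it to a bivalent white internal vertex. -/
  boundary_edge : ∀ i e, (N.src e = Sum.inl i ∨ N.tgt e = Sum.inl i) →
    ∃ v, N.degree (Sum.inr v) = 2 ∧ N.IsWhite v ∧
      ((N.src e = Sum.inl i ∧ N.tgt e = Sum.inr v) ∨ (N.src e = Sum.inr v ∧ N.tgt e = Sum.inl i))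
  /-- The weights are positive. -/
  weight_pos : ∀ e, 0 < N.weight e

/-- Consecutive edges never have opposite directions, so that the signs in `localWind` need no
convention for antiparallel pairs. -/
theorem IsPBDTP.not_antiparallel {N : DiskNetwork n V E} (hN : N.IsPBDTP) {e f : E}
    (h : N.tgt e = N.src f) (c : ℝ) (hc : 0 < c) : N.dir f ≠ -((c : ℂ) * N.dir e) := by
  intro hd
  have hef : e ≠ f := by
    rintro rfl
    have := hN.vertex_off_edge (N.src e) e
    rw [h, openSegment_same] at this
    exact this rfl
  have hm : 0 < min 1 c := lt_min one_pos hc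
  have hm1 : min 1 c ≤ 1 := min_le_left _ _
  have hmc : min 1 c ≤ c := min_le_right _ _
  set s := min 1 c / 2 with hs
  have hs0 : 0 < s := by positivity
  have hs1 : s < 1 := by linarith
  have hsc : s < c := by linarith
  have hdisj := Set.disjoint_left.mp (hN.edges_disjoint e f hef)
  refine hdisj (a := N.pos (N.tgt e) - (s : ℂ) * N.dir e) ?_ ?_
  · refine ⟨s, 1 - s, hs0, by linarith, by ring, ?_⟩
    simp only [Complex.real_smul, dir]
    push_cast
    ring
  · have hcc : (c : ℂ) ≠ 0 := by exact_mod_cast hc.ne'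
    refine ⟨1 - s / c, s / c, by rw [sub_pos, div_lt_one hc]; exact hsc, by positivity,
      by ring, ?_⟩
    have h1 : N.pos (N.tgt f) = N.pos (N.tgt e) - (c : ℂ) * N.dir e := by
      have : N.dir f = N.pos (N.tgt f) - N.pos (N.tgt e) := by rw [dir, h]
      rw [this] at hd
      linear_combination hd
    rw [h1, ← h]
    simp only [Complex.real_smul]
    push_cast
    field_simp
    ring

/-- Gauge ray directions: the rays from the boundary vertices point inside the disk and contain no
internal vertex, and no internal edge is parallel to the direction. -/
structure IsGaugeDirection (l : ℂ) : Prop where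
  points_inside : ∀ i, ∃ t : ℝ, 0 < t ∧ N.pos (Sum.inl i) + (t : ℂ) * l ∈ interior N.disk
  not_parallel : ∀ e u v, N.src e = Sum.inr u → N.tgt e = Sum.inr v → crossProd (N.dir e) l ≠ 0
  off_vertices : ∀ i v, ∀ t : ℝ, 0 ≤ t → N.pos (Sum.inl i) + (t : ℂ) * l ≠ N.pos (Sum.inr v)

/-- The base `I` of the orientation: the labels of the boundary sources. -/
def sources : Finset (Fin n) := Finset.univ.filter fun i => ∃ e, N.src e = Sum.inl i

/-- The elements `i_1 < ... < i_k` of the base. -/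
def sourceIdx {k : ℕ} (hk : N.sources.card = k) (r : Fin k) : Fin n :=
  N.sources.orderEmbOfFin hk r

/-- The number of boundary sources strictly between `i` and `j`. -/
def sourcesBetween (i j : Fin n) : ℕ :=
  (N.sources.filter fun s => min i j < s ∧ s < max i j).card

/-! ### Walks -/

/-- Directed paths, as lists of edges, with first edge `e` and end point `b j`. -/
def IsWalk (e : E) (j : Fin n) (P : List E) : Prop :=
  P.head? = some e ∧ P.IsChain (fun f g => N.tgt f = N.src g) ∧
    ∃ f, P.getLast? = some f ∧ N.tgt f = Sum.inl j

/-- The generalized winding number of a directed path. -/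
def wind (l : ℂ) : List E → ℤ
  | e :: f :: P => localWind l (N.dir e) (N.dir f) + wind l (f :: P)
  | _ => 0

/-- The number of gauge rays from the boundary sources that intersect the edge `e`. The initial
point of a ray does not count as an intersection with the edge at that boundary vertex. -/
def intEdge (l : ℂ) (e : E) : ℕ :=
  (N.sources.filter fun i => ∃ t : ℝ, 0 < t ∧
    N.pos (Sum.inl i) + (t : ℂ) * l ∈ segment ℝ (N.pos (N.src e)) (N.pos (N.tgt e))).card

/-- The number of intersections of a directed path with the gauge rays from boundary sources. -/
def intWalk (l : ℂ) (P : List E) : ℕ := (P.map (N.intEdge l)).sum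

/-- The formal sum over all directed paths from `e` to `b j` that defines the `j`-th component of
the edge vector at `e`. -/
def edgeSeries (l : ℂ) (e : E) (j : Fin n) : MvPowerSeries E ℝ :=
  walkSeries (N.IsWalk e j) fun P => (-1 : ℝ) ^ (N.wind l P + (N.intWalk l P : ℤ))

/-- The edge vector `E_e`. -/
def edgeVector (l : ℂ) (e : E) (j : Fin n) : ℝ := rationalValue (N.edgeSeries l e j) N.weight

/-! ### The boundary measurement matrix -/

/-- The topological winding index of a path from `b i` to `b j`: the signed number of full turns of
its tangent vector, when the path is bent at its ends so as to leave `b i` and to reach `b j` in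
the direction from `b i` to `b j` along the boundary. -/
def topWind (i j : Fin n) (P : List E) : ℤ :=
  rotationNumber (N.pos (Sum.inl j) - N.pos (Sum.inl i)) (P.map N.dir)

/-- The formal boundary measurement `M_ij`, a sum over all directed paths from `b i` to `b j`. -/
def measurementSeries (i j : Fin n) : MvPowerSeries E ℝ :=
  walkSeries (fun P => ∃ e, N.src e = Sum.inl i ∧ N.IsWalk e j P)
    fun P => (-1 : ℝ) ^ N.topWind i j P

/-- The boundary measurement matrix, in reduced row echelon form with respect to the base `I`. -/
def measurementMatrix {k : ℕ} (hk : N.sources.card = k) : Matrix (Fin k) (Fin n) ℝ :=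
  Matrix.of fun r j =>
    if j ∈ N.sources then (if j = N.sourceIdx hk r then 1 else 0)
    else (-1 : ℝ) ^ N.sourcesBetween (N.sourceIdx hk r) j *
      rationalValue (N.measurementSeries (N.sourceIdx hk r) j) N.weight

/-! ### Flows -/

/-- Number of edges of `F` that arrive at `x`. -/
def arrive (F : Finset E) (x : Fin n ⊕ V) : ℕ := (F.filter fun e => N.tgt e = x).card

/-- Number of edges of `F` that leave from `x`. -/
def leave (F : Finset E) (x : Fin n ⊕ V) : ℕ := (F.filter fun e => N.src e = x).card

/-- Conservative flows. -/
def IsConservativeFlow (C : Finset E) : Prop :=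
  (∀ v, N.arrive C (Sum.inr v) = N.leave C (Sum.inr v)) ∧
    ∀ e ∈ C, ∀ i, N.src e ≠ Sum.inl i ∧ N.tgt e ≠ Sum.inl i

/-- Edge flows that start at the edge `e` and end at `b j`: at the boundary, such a flow has its
final edge at `b j` and no edges elsewhere, except possibly at the initial vertex of `e`. -/
def IsEdgeFlow (e : E) (j : Fin n) (F : Finset E) : Prop :=
  e ∈ F ∧
  (∀ v, Sum.inr v ≠ N.src e → N.arrive F (Sum.inr v) = N.leave F (Sum.inr v)) ∧
  N.arrive F (N.src e) + 1 = N.leave F (N.src e) ∧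
  (∃ f ∈ F, N.tgt f = Sum.inl j) ∧
  ∀ f ∈ F, ∀ i, (N.src f = Sum.inl i → N.src e = Sum.inl i) ∧ (N.tgt f = Sum.inl i → i = j)

/-- All conservative flows. -/
def conservativeFlows : Finset (Finset E) := Finset.univ.filter N.IsConservativeFlow

/-- All edge flows from `e` to `b j`. -/
def edgeFlows (e : E) (j : Fin n) : Finset (Finset E) := Finset.univ.filter (N.IsEdgeFlow e j)

/-- The weight of a collection of distinct edges. -/
def flowWeight (F : Finset E) : ℝ := ∏ e ∈ F, N.weight e

/-- `F` is the union of the edge loop-erased walk `P` from `e` to `b j` (a directed path that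
passes no edge twice) and a conservative flow without common edges with `P`. -/
def IsFlowWalk (e : E) (j : Fin n) (F : Finset E) (P : List E) : Prop :=
  N.IsWalk e j P ∧ P.Nodup ∧
    ∃ C, N.IsConservativeFlow C ∧ Disjoint P.toFinset C ∧ F = P.toFinset ∪ C

/-- The edge loop-erased walk contained in an edge flow. -/
def flowWalk (e : E) (j : Fin n) (F : Finset E) : List E :=
  if h : ∃ P, N.IsFlowWalk e j F P then h.choose else []

/-- The winding number of an edge flow. -/
def windFlow (l : ℂ) (e : E) (j : Fin n) (F : Finset E) : ℤ := N.wind l (N.flowWalk e j F)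

/-- The intersection number of an edge flow. -/
def intFlow (l : ℂ) (e : E) (j : Fin n) (F : Finset E) : ℕ := N.intWalk l (N.flowWalk e j F)

end DiskNetwork

end

/-! Splitting off the first edge of a walk gives a linear system (1 - T) E = R for the edge series:
row `f` of T has an entry ± x_f for each edge that can follow `f`, and R lives on the single edge
`e'` that ends at `b j`. By Cramer's rule E_e is R's entry times a cofactor, divided by det (1 - T).
In the Leibniz expansion only those permutations survive that send every moved edge to a following
edge. Since each internal vertex has one incoming or one outgoing edge, such a permutation is
determined by its support, and the supports are exactly the conservative flows
(`det_relationMatrix`). The cofactor replaces row `e'` by the unit vector at `e`, which adds an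
artificial step from `e'` back to `e`; its permutations correspond to the edge flows, and their
cycle through `e` is the walk contained in the flow (`det_updateRow_mul`).

What remains is that no cancellation of signs occurs. A cycle of m edges receives (-1)^(m-1) from
the sign of the permutation, (-1)^m from the minus sign of T, and (-1)^(wind+int). Hence wind + int
has to be odd on simple cycles (`wind_add_int_perm_cycle`) and congruent to N_rj on simple walks
from source to sink (`wind_parity_simple`).

The number wind counts passages of the tangent through the direction `l`, so that it is the total
turning up to terms at the two ends (`localWind_eq`). The total turning is found by a discrete form
of Hopf's Umlaufsatz: the rotation of the edges is traded for the rotation of the chords at the two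
end points (`sum_signedAngle_chords`). A simple closed polygon then has rotation number 1 or -1, and
a simple arc between two points of the side, bent at its ends, has rotation number 0.

The number int is computed modulo two from changes of side with respect to each gauge ray, a
telescoping sum. It is even on cycles. On a walk from `b i` to `b j` each source strictly between
them contributes 1, and the ray from `b i` itself contributes exactly what the two bends at the ends
contribute to topwind. Thus topwind ≡ wind + int + N_rj for every walk, simple or not
(`topWind_parity`), and the measurement series is the edge series times (-1)^N_rj. -/

set_option linter.unusedSectionVars false

/-! ### Signed angles and the rotation number of simple polygons -/

section Angles

open Complex

/-- The signed angle from `c` to `d`, in `(-π, π]`. -/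
noncomputable def signedAngle (c d : ℂ) : ℝ := Complex.arg (d / c)

/-- The function arg (u * ·) is a branch of the argument whose cut is rotated by the choice of `u`.
Both sides agree modulo 2π, and the bounds place the difference in the range of the principal
argument. -/
theorem signedAngle_eq_sub {u c d : ℂ} (hu : u ≠ 0) (hc : c ≠ 0) (hd : d ≠ 0)
    (h1 : arg (u * d) - arg (u * c) < Real.pi) (h2 : arg (u * c) - arg (u * d) < Real.pi) :
    signedAngle c d = arg (u * d) - arg (u * c) := by
  have hdiv : d / c = (u * d) / (u * c) := by field_simp
  have h := arg_div_coe_angle (mul_ne_zero hu hd) (mul_ne_zero hu hc)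
  rw [← hdiv, ← Real.Angle.coe_sub] at h
  have h3 := congrArg Real.Angle.toReal h
  rw [arg_coe_angle_toReal_eq_arg, Real.Angle.toReal_coe_eq_self_iff_mem_Ioc.mpr] at h3
  · exact h3
  · exact ⟨by linarith, h1.le⟩

theorem signedAngle_eq_sub_add_int {u c d : ℂ} (hu : u ≠ 0) (hc : c ≠ 0) (hd : d ≠ 0) :
    ∃ m : ℤ, signedAngle c d = arg (u * d) - arg (u * c) + 2 * Real.pi * m := by
  have hdiv : d / c = (u * d) / (u * c) := by field_simp
  have h := arg_div_coe_angle (mul_ne_zero hu hd) (mul_ne_zero hu hc)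
  rw [← hdiv, ← Real.Angle.coe_sub, Real.Angle.angle_eq_iff_two_pi_dvd_sub] at h
  obtain ⟨m, hm⟩ := h
  exact ⟨m, by rw [signedAngle]; linarith⟩

theorem signedAngle_eq_sub_of_re_pos {u c d : ℂ} (hc : 0 < (u * c).re) (hd : 0 < (u * d).re) :
    signedAngle c d = arg (u * d) - arg (u * c) := by
  have h1 := abs_lt.mp (abs_arg_lt_pi_div_two_iff.mpr (Or.inl hc))
  have h2 := abs_lt.mp (abs_arg_lt_pi_div_two_iff.mpr (Or.inl hd))
  refine signedAngle_eq_sub ?_ ?_ ?_ (by linarith) (by linarith)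
  · rintro rfl; simp at hc
  · rintro rfl; simp at hc
  · rintro rfl; simp at hd

theorem signedAngle_add {u a b c : ℂ} (ha : 0 < (u * a).re) (hb : 0 < (u * b).re)
    (hc : 0 < (u * c).re) : signedAngle a b + signedAngle b c = signedAngle a c := by
  rw [signedAngle_eq_sub_of_re_pos ha hb, signedAngle_eq_sub_of_re_pos hb hc,
    signedAngle_eq_sub_of_re_pos ha hc]
  ring

theorem signedAngle_neg_neg (c d : ℂ) : signedAngle (-c) (-d) = signedAngle c d := by
  rw [signedAngle, signedAngle, neg_div_neg_eq]

/-- Two vectors that are not antiparallel lie in an open half-plane. -/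
theorem exists_re_pos {c d : ℂ} (hc : c ≠ 0) (hd : d ≠ 0) (h : signedAngle c d ≠ Real.pi) :
    ∃ u : ℂ, 0 < (u * c).re ∧ 0 < (u * d).re := by
  have hlt : signedAngle c d < Real.pi := lt_of_le_of_ne (arg_le_pi _) h
  have hgt : -Real.pi < signedAngle c d := neg_pi_lt_arg _
  set θ := signedAngle c d with hθ
  have hcos : 0 < Real.cos (θ / 2) := Real.cos_pos_of_mem_Ioo ⟨by linarith, by linarith⟩
  -- Multiplication by this number moves the bisector of `c` and `d` to the positive real axis.
  refine ⟨exp (-(θ / 2 : ℝ) * I) / c, ?_, ?_⟩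
  · rw [div_mul_cancel₀ _ hc, ← ofReal_neg, exp_ofReal_mul_I_re, Real.cos_neg]
    exact hcos
  · have h1 : exp (-(θ / 2 : ℝ) * I) / c * d = (‖d / c‖ : ℝ) * exp ((θ / 2 : ℝ) * I) := by
      have h2 : d / c = ‖d / c‖ * exp (θ * I) := (norm_mul_exp_arg_mul_I _).symm
      calc exp (-(θ / 2 : ℝ) * I) / c * d = exp (-(θ / 2 : ℝ) * I) * (d / c) := by ring
        _ = exp (-(θ / 2 : ℝ) * I) * (‖d / c‖ * exp (θ * I)) := by rw [← h2]
        _ = ‖d / c‖ * (exp (-(θ / 2 : ℝ) * I) * exp (θ * I)) := by ring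
        _ = _ := by
          rw [← exp_add]
          congr 2
          push_cast
          ring
    rw [h1, re_ofReal_mul, exp_ofReal_mul_I_re]
    exact mul_pos (norm_pos_iff.mpr (div_ne_zero hd hc)) hcos

theorem signedAngle_comm {c d : ℂ} (hc : c ≠ 0) (hd : d ≠ 0) (h : signedAngle c d ≠ Real.pi) :
    signedAngle d c = -signedAngle c d := by
  obtain ⟨u, h1, h2⟩ := exists_re_pos hc hd h
  rw [signedAngle_eq_sub_of_re_pos h1 h2, signedAngle_eq_sub_of_re_pos h2 h1]
  ring

theorem signedAngle_add_add_self {c d : ℂ} (hc : c ≠ 0) (hd : d ≠ 0)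
    (h : signedAngle c d ≠ Real.pi) :
    signedAngle c (c + d) + signedAngle (c + d) d = signedAngle c d := by
  obtain ⟨u, h1, h2⟩ := exists_re_pos hc hd h
  refine signedAngle_add h1 ?_ h2
  rw [mul_add, add_re]
  exact add_pos h1 h2

theorem signedAngle_ne_pi {c d : ℂ} (hc : c ≠ 0)
    (h : ∀ a : ℝ, 0 < a → d ≠ -((a : ℂ) * c)) : signedAngle c d ≠ Real.pi := by
  intro hpi
  rw [signedAngle, arg_eq_pi_iff] at hpi
  refine h (-(d / c).re) (by linarith [hpi.1]) ?_
  have : ((d / c).re : ℂ) = d / c := Complex.ext (by simp) (by simp [hpi.2])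
  rw [ofReal_neg, this]
  field_simp

/-- The four differences between the end points of disjoint segments lie in an open half-plane. -/
theorem exists_re_pos_of_disjoint_segment {a b c d : ℂ}
    (h : Disjoint (segment ℝ a b) (segment ℝ c d)) :
    ∃ u : ℂ, ∀ x ∈ segment ℝ a b, ∀ y ∈ segment ℝ c d, 0 < (u * (y - x)).re := by
  have hcp : ∀ x y : ℂ, IsCompact (segment ℝ x y) := fun x y => by
    rw [← convexHull_pair (𝕜 := ℝ)]
    exact (Set.toFinite _).isCompact_convexHull ℝ
  obtain ⟨f, s, t, h1, h2, h3⟩ := geometric_hahn_banach_compact_closed (convex_segment a b)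
    (hcp a b) (convex_segment c d) (hcp c d).isClosed h
  -- For this `u` the real part of u * z is the value at z of the separating functional.
  refine ⟨(f 1 : ℂ) - f I * I, fun x hx y hy => ?_⟩
  have hf : ∀ z : ℂ, f z = z.re * f 1 + z.im * f I := by
    intro z
    have : z = z.re • (1 : ℂ) + z.im • I := by simp [re_add_im]
    conv_lhs => rw [this]
    simp only [map_add, map_smul, smul_eq_mul]
  have h4 := h1 x hx
  have h5 := h3 y hy
  rw [hf] at h4 h5
  simp
  linarith

/-! #### Sums of angles along chords -/

/-- A sequence of directions that stays within a half-plane. -/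
theorem sum_signedAngle_of_arg {z : ℕ → ℂ} {u : ℂ} (hu : u ≠ 0) (m : ℕ)
    (hz : ∀ t ≤ m, z t ≠ 0) (h : ∀ s ≤ m, ∀ t ≤ m, arg (u * z s) - arg (u * z t) < Real.pi) :
    ∑ t ∈ Finset.range m, signedAngle (z t) (z (t + 1)) = signedAngle (z 0) (z m) := by
  have key : ∀ s ≤ m, ∀ t ≤ m, signedAngle (z s) (z t) = arg (u * z t) - arg (u * z s) :=
    fun s hs t ht => signedAngle_eq_sub hu (hz s hs) (hz t ht) (h t ht s hs) (h s hs t ht)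
  rw [key 0 (by omega) m le_rfl, ← Finset.sum_range_sub (fun t => arg (u * z t))]
  refine Finset.sum_congr rfl fun t ht => key t ?_ (t + 1) ?_ <;>
  · have := Finset.mem_range.mp ht
    omega

/-- Inductive step of the chord formula: the end point moves from p (k + 1) to p (k + 2). For an
earlier edge disjoint from the new one, the four chords between the two edges lie in a half-plane,
so the angle is the same along both ways round the square of chords. The differences telescope, and
the triangle of the last three vertices supplies the remaining term. -/
theorem sum_signedAngle_step (p : ℕ → ℂ) (k : ℕ)
    (hd : ∀ t ≤ k + 1, p t ≠ p (t + 1))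
    (hturn : signedAngle (p (k + 1) - p k) (p (k + 2) - p (k + 1)) ≠ Real.pi)
    (hdisj : ∀ s < k, Disjoint (segment ℝ (p s) (p (s + 1))) (segment ℝ (p (k + 1)) (p (k + 2)))) :
    ∑ s ∈ Finset.range k, signedAngle (p (k + 1) - p s) (p (k + 1) - p (s + 1)) +
      signedAngle (p (k + 1) - p k) (p (k + 2) - p (k + 1)) =
    signedAngle (p (k + 1) - p 0) (p (k + 2) - p 0) +
      ∑ s ∈ Finset.range (k + 1), signedAngle (p (k + 2) - p s) (p (k + 2) - p (s + 1)) := by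
  have h1 : ∀ s ∈ Finset.range k, signedAngle (p (k + 1) - p s) (p (k + 1) - p (s + 1)) =
      signedAngle (p (k + 2) - p s) (p (k + 2) - p (s + 1)) +
      (signedAngle (p (k + 1) - p s) (p (k + 2) - p s) -
        signedAngle (p (k + 1) - p (s + 1)) (p (k + 2) - p (s + 1))) := by
    intro s hs
    obtain ⟨u, hu⟩ := exists_re_pos_of_disjoint_segment (hdisj s (Finset.mem_range.mp hs))
    have a1 := hu _ (left_mem_segment ℝ _ _) _ (left_mem_segment ℝ _ _)
    have a2 := hu _ (left_mem_segment ℝ _ _) _ (right_mem_segment ℝ _ _)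
    have a3 := hu _ (right_mem_segment ℝ _ _) _ (left_mem_segment ℝ _ _)
    have a4 := hu _ (right_mem_segment ℝ _ _) _ (right_mem_segment ℝ _ _)
    have e1 := signedAngle_add a1 a2 a4
    have e2 := signedAngle_add a1 a3 a4
    linarith
  rw [Finset.sum_congr rfl h1, Finset.sum_add_distrib, Finset.sum_range_succ,
    Finset.sum_range_sub' (fun s => signedAngle (p (k + 1) - p s) (p (k + 2) - p s))]
  have h2 := signedAngle_add_add_self (sub_ne_zero.mpr (hd k (by omega)).symm)
    (sub_ne_zero.mpr (hd (k + 1) le_rfl).symm) hturn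
  have h3 : p (k + 1) - p k + (p (k + 2) - p (k + 1)) = p (k + 2) - p k := by ring
  rw [h3] at h2
  simp only [add_assoc, Nat.reduceAdd] at *
  linarith

/-- The turning of a simple open polygon, computed along the chords. -/
theorem sum_signedAngle_chords (p : ℕ → ℂ) (m : ℕ)
    (hd : ∀ t ≤ m, p t ≠ p (t + 1))
    (hturn : ∀ t < m, signedAngle (p (t + 1) - p t) (p (t + 2) - p (t + 1)) ≠ Real.pi)
    (hdisj : ∀ s k, s + 1 < k → k ≤ m →
      Disjoint (segment ℝ (p s) (p (s + 1))) (segment ℝ (p k) (p (k + 1)))) :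
    ∑ t ∈ Finset.range m, signedAngle (p (t + 1) - p t) (p (t + 2) - p (t + 1)) =
    ∑ t ∈ Finset.range m, signedAngle (p (t + 1) - p 0) (p (t + 2) - p 0) +
      ∑ s ∈ Finset.range m, signedAngle (p (m + 1) - p s) (p (m + 1) - p (s + 1)) := by
  induction m with
  | zero => simp
  | succ m ih =>
    rw [Finset.sum_range_succ, ih (fun t ht => hd t (by omega)) (fun t ht => hturn t (by omega))
      (fun s k h1 h2 => hdisj s k h1 (by omega)),
      Finset.sum_range_succ (fun t => signedAngle (p (t + 1) - p 0) (p (t + 2) - p 0))]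
    have := sum_signedAngle_step p m hd (hturn m (by omega))
      (fun s hs => hdisj s (m + 1) (by omega) le_rfl)
    rw [add_assoc, this]
    exact (add_assoc _ _ _).symm

/-- A simple polygon that joins two points of a line and stays on one side of it: its tangent
does not make a full turn. -/
theorem sum_signedAngle_path (p : ℕ → ℂ) (m : ℕ) (τ : ℂ) (hτ : p (m + 1) - p 0 = τ) (hτ0 : τ ≠ 0)
    (hd : ∀ t ≤ m, p t ≠ p (t + 1))
    (hturn : ∀ t < m, signedAngle (p (t + 1) - p t) (p (t + 2) - p (t + 1)) ≠ Real.pi)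
    (hdisj : ∀ s k, s + 1 < k → k ≤ m →
      Disjoint (segment ℝ (p s) (p (s + 1))) (segment ℝ (p k) (p (k + 1))))
    (hside : (∀ t, 0 < t → t ≤ m → 0 < ((p t - p 0) / τ).im) ∨
      (∀ t, 0 < t → t ≤ m → ((p t - p 0) / τ).im < 0)) :
    ∑ t ∈ Finset.range m, signedAngle (p (t + 1) - p t) (p (t + 2) - p (t + 1)) =
      signedAngle (p 1 - p 0) τ + signedAngle τ (p (m + 1) - p m) := by
  have hu : τ⁻¹ ≠ 0 := inv_ne_zero hτ0
  have h0 : ∀ t, 0 < t → t ≤ m + 1 → p t - p 0 ≠ 0 := by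
    intro t ht ht' h
    rcases Nat.lt_or_ge t (m + 1) with h1 | h1
    · rcases hside with hs | hs
      · have := hs t ht (by omega)
        simp [h] at this
      · have := hs t ht (by omega)
        simp [h] at this
    · obtain rfl : t = m + 1 := by omega
      exact hτ0 (hτ ▸ h)
  have h1 : ∀ t ≤ m, p (m + 1) - p t ≠ 0 := by
    intro t ht h
    rcases Nat.eq_zero_or_pos t with rfl | ht0
    · exact hτ0 (hτ ▸ h)
    · have h2 : p t - p 0 = τ := by rw [← hτ]; linear_combination -h
      rcases hside with hs | hs <;>
      · have := hs t ht0 ht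
        simp [h2, hτ0] at this
  have e1 : ∀ t, 0 < t → t ≤ m → (τ⁻¹ * (p (m + 1) - p t)).im = -((p t - p 0) / τ).im := by
    intro t _ _
    have : τ⁻¹ * (p (m + 1) - p t) = 1 - (p t - p 0) / τ := by
      field_simp
      rw [← hτ]
      ring
    rw [this]
    simp
  have e2 : ∀ t, (τ⁻¹ * (p t - p 0)) = (p t - p 0) / τ := fun t => by rw [div_eq_inv_mul]
  have e3 : (τ⁻¹ * (p (m + 1) - p 0)) = 1 := by rw [hτ, inv_mul_cancel₀ hτ0]
  rw [sum_signedAngle_chords p m hd hturn hdisj]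
  congr 1
  -- Divided by `τ`, the chords from the first point lie on one side of the real axis, except for
  -- the last one, which becomes 1. Their arguments thus lie in [0, π) or in (-π, 0] and differ by
  -- less than π.
  · have key := sum_signedAngle_of_arg (z := fun t => p (t + 1) - p 0) hu m
      (fun t ht => h0 (t + 1) (by omega) (by omega)) ?_
    · simpa [hτ] using key
    · have hb : (∀ t ≤ m, 0 ≤ arg (τ⁻¹ * (p (t + 1) - p 0)) ∧
          arg (τ⁻¹ * (p (t + 1) - p 0)) < Real.pi) ∨ (∀ t ≤ m,
          arg (τ⁻¹ * (p (t + 1) - p 0)) ≤ 0) := by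
        rcases hside with hs | hs
        · left
          intro t ht
          rcases Nat.lt_or_ge t m with h2 | h2
          · have := hs (t + 1) (by omega) (by omega)
            rw [e2, arg_nonneg_iff, arg_lt_pi_iff]
            exact ⟨this.le, Or.inr this.ne'⟩
          · obtain rfl : t = m := by omega
            rw [e3, arg_one]
            exact ⟨le_rfl, Real.pi_pos⟩
        · right
          intro t ht
          rcases Nat.lt_or_ge t m with h2 | h2
          · have := hs (t + 1) (by omega) (by omega)
            rw [e2]
            exact (arg_neg_iff.mpr this).le
          · obtain rfl : t = m := by omega
            rw [e3, arg_one]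
      intro s hs t ht
      rcases hb with hb | hb
      · linarith [(hb s hs).2, (hb t ht).1]
      · linarith [hb s hs, neg_pi_lt_arg (τ⁻¹ * (p (t + 1) - p 0))]
  -- The chords to the last point are the mirror case: divided by `τ` they are 1 minus the previous
  -- numbers and lie on the other side.
  · have key := sum_signedAngle_of_arg (z := fun t => p (m + 1) - p t) hu m h1 ?_
    · simpa [hτ] using key
    · have hb : (∀ t ≤ m, 0 ≤ arg (τ⁻¹ * (p (m + 1) - p t)) ∧
          arg (τ⁻¹ * (p (m + 1) - p t)) < Real.pi) ∨ (∀ t ≤ m,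
          arg (τ⁻¹ * (p (m + 1) - p t)) ≤ 0) := by
        rcases hside with hs | hs
        · right
          intro t ht
          rcases Nat.eq_zero_or_pos t with rfl | h2
          · rw [e3, arg_one]
          · have := hs t h2 ht
            refine (arg_neg_iff.mpr ?_).le
            rw [e1 t h2 ht]
            linarith
        · left
          intro t ht
          rcases Nat.eq_zero_or_pos t with rfl | h2
          · rw [e3, arg_one]
            exact ⟨le_rfl, Real.pi_pos⟩
          · have := hs t h2 ht
            rw [arg_nonneg_iff, arg_lt_pi_iff, e1 t h2 ht]
            exact ⟨by linarith, Or.inr (by linarith)⟩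
      intro s hs t ht
      rcases hb with hb | hb
      · linarith [(hb s hs).2, (hb t ht).1]
      · linarith [hb s hs, neg_pi_lt_arg (τ⁻¹ * (p (m + 1) - p t))]

/-- The rotation number of a simple closed polygon is `1` or `-1`. The polygon starts at a vertex
that is extreme in the sense of `harg`. -/
theorem sum_signedAngle_cycle (p : ℕ → ℂ) (k : ℕ) (hper : p (k + 3) = p 0)
    (hd : ∀ t ≤ k + 2, p t ≠ p (t + 1)) (hinj : ∀ t, 0 < t → t ≤ k + 2 → p t ≠ p 0)
    (hturn : ∀ t ≤ k + 1, signedAngle (p (t + 1) - p t) (p (t + 2) - p (t + 1)) ≠ Real.pi)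
    (hturn0 : signedAngle (p (k + 3) - p (k + 2)) (p 1 - p 0) ≠ Real.pi)
    (hdisj : ∀ s t, s + 1 < t → t ≤ k + 2 → (s = 0 → t ≠ k + 2) →
      Disjoint (segment ℝ (p s) (p (s + 1))) (segment ℝ (p t) (p (t + 1))))
    (harg : ∀ t, 0 < t → t ≤ k + 2 →
      -(Real.pi / 2) < arg (p t - p 0) ∧ arg (p t - p 0) ≤ Real.pi / 2) :
    ∃ a : ℝ, (a = 1 ∨ a = -1) ∧
    ∑ t ∈ Finset.range (k + 2), signedAngle (p (t + 1) - p t) (p (t + 2) - p (t + 1)) +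
      signedAngle (p (k + 3) - p (k + 2)) (p 1 - p 0) = a * (2 * Real.pi) := by
  have hne : ∀ t, 0 < t → t ≤ k + 2 → p t - p 0 ≠ 0 := fun t h1 h2 =>
    sub_ne_zero.mpr (hinj t h1 h2)
  have hα := sum_signedAngle_of_arg (z := fun t => p (t + 1) - p 0) one_ne_zero (k + 1)
    (fun t ht => hne (t + 1) (by omega) (by omega))
    (fun s hs t ht => by
      have h1 := harg (s + 1) (by omega) (by omega)
      have h2 := harg (t + 1) (by omega) (by omega)
      simp only [one_mul]
      linarith)
  -- The chord formula does not apply to the whole polygon, because the last edge meets the first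
  -- one at p 0. It is used without the last edge; `hstep` adds the last edge to the polygon that
  -- starts at p 1.
  have hchord := sum_signedAngle_chords p (k + 1) (fun t ht => hd t (by omega))
    (fun t ht => hturn t (by omega)) (fun s t h1 h2 => hdisj s t h1 (by omega) (by omega))
  have hstep := sum_signedAngle_step (fun t => p (t + 1)) k (fun t ht => hd (t + 1) (by omega))
    (hturn (k + 1) le_rfl) (fun s hs => hdisj (s + 1) (k + 2) (by omega) le_rfl (by omega))
  have hβ : signedAngle (p (k + 2) - p 0) (p (k + 2) - p 1) +
      signedAngle (p (k + 2) - p 1) (p 0 - p 1) =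
      signedAngle (p (k + 3) - p (k + 2)) (p 1 - p 0) := by
    have h1 := signedAngle_add_add_self (c := p (k + 2) - p 0) (d := p 0 - p 1)
      (hne _ (by omega) le_rfl) (sub_ne_zero.mpr (hd 0 (by omega))) (by
        rw [← signedAngle_neg_neg, neg_sub, neg_sub, ← hper]
        rw [hper] at hturn0 ⊢
        exact hturn0)
    rw [sub_add_sub_cancel] at h1
    rw [h1, ← signedAngle_neg_neg, neg_sub, neg_sub, hper]
  have hα2 : ∑ s ∈ Finset.range (k + 1), signedAngle (p (k + 3) - p (s + 1))
      (p (k + 3) - p (s + 2)) = ∑ t ∈ Finset.range (k + 1),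
        signedAngle (p (t + 1) - p 0) (p (t + 2) - p 0) :=
    Finset.sum_congr rfl fun s _ => by rw [← signedAngle_neg_neg, neg_sub, neg_sub, hper]
  set α := signedAngle (p 1 - p 0) (p (k + 2) - p 0) with hαdef
  set β := signedAngle (p (k + 3) - p (k + 2)) (p 1 - p 0) with hβdef
  -- The chords at p 0 are swept twice, once as chords from the first point and once as chords to
  -- the last point; each sweep has angle α. The triangle p (k + 2), p 0, p 1 gives β.
  have htot : ∑ t ∈ Finset.range (k + 2), signedAngle (p (t + 1) - p t) (p (t + 2) - p (t + 1)) +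
      β = 2 * (α + β) := by
    rw [Finset.sum_range_succ, hchord, Finset.sum_range_succ' (fun s => signedAngle
      (p (k + 1 + 1) - p s) (p (k + 1 + 1) - p (s + 1)))]
    simp only [add_assoc, Nat.reduceAdd, zero_add] at hα hstep hα2 ⊢
    have h3 : signedAngle (p (k + 2) - p 1) (p (k + 3) - p 1) =
        signedAngle (p (k + 2) - p 1) (p 0 - p 1) := by rw [hper]
    linarith
  have hα_lt : α < Real.pi ∧ -Real.pi < α := by
    refine ⟨?_, neg_pi_lt_arg _⟩
    have h1 := harg 1 (by omega) (by omega)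
    have h2 := harg (k + 2) (by omega) (by omega)
    rw [hαdef, signedAngle_eq_sub one_ne_zero (hne 1 (by omega) (by omega))
      (hne (k + 2) (by omega) (by omega))] <;> simp only [one_mul] <;> linarith
  have hβ_lt : β < Real.pi ∧ -Real.pi < β := ⟨lt_of_le_of_ne (arg_le_pi _) hturn0, neg_pi_lt_arg _⟩
  -- Rotation by β leads from the last edge to the first, and rotation by α from there to the
  -- reversed last edge. Since both angles lie strictly between -π and π, their sum is π or -π.
  have hsum : ((α + β : ℝ) : Real.Angle) = (Real.pi : ℝ) := by
    have n1 : p 1 - p 0 ≠ 0 := hne 1 (by omega) (by omega)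
    have n2 : p (k + 2) - p 0 ≠ 0 := hne (k + 2) (by omega) (by omega)
    have n3 : p (k + 3) - p (k + 2) ≠ 0 := sub_ne_zero.mpr (hd (k + 2) le_rfl).symm
    rw [Real.Angle.coe_add, hαdef, hβdef, signedAngle, signedAngle,
      ← arg_mul_coe_angle (div_ne_zero n2 n1) (div_ne_zero n1 n3), div_mul_div_cancel₀ n1, hper,
      ← neg_sub, neg_div, div_self (fun h => n2 (by linear_combination -h)), arg_neg_one]
  obtain ⟨m, hm⟩ := Real.Angle.angle_eq_iff_two_pi_dvd_sub.mp hsum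
  have hpi := Real.pi_pos
  have hm1 : (m : ℝ) < 1 := by
    by_contra! h
    nlinarith
  have hm2 : (-2 : ℝ) < m := by
    by_contra! h
    nlinarith
  have hm1' : m < 1 := by exact_mod_cast hm1
  have hm2' : -2 < m := by exact_mod_cast hm2
  rw [htot]
  obtain rfl | rfl : m = 0 ∨ m = -1 := by omega
  · exact ⟨1, Or.inl rfl, by push_cast at hm; linarith⟩
  · exact ⟨-1, Or.inr rfl, by push_cast at hm; linarith⟩

end Angles

/-! ### Local winding numbers and signed angles -/

section LocalWind

open Complex

theorem crossProd_add_right (a b c : ℂ) : crossProd a (b + c) = crossProd a b + crossProd a c := by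
  simp only [crossProd, add_re, add_im]; ring

theorem crossProd_sub_left (a b c : ℂ) : crossProd (a - b) c = crossProd a c - crossProd b c := by
  simp only [crossProd, sub_re, sub_im]; ring

theorem crossProd_sub_right (a b c : ℂ) : crossProd a (b - c) = crossProd a b - crossProd a c := by
  simp only [crossProd, sub_re, sub_im]; ring

theorem crossProd_mul_left (t : ℝ) (a b : ℂ) : crossProd (t * a) b = t * crossProd a b := by
  simp [crossProd]; ring

theorem crossProd_mul_right (t : ℝ) (a b : ℂ) : crossProd a (t * b) = t * crossProd a b := by
  simp [crossProd]; ring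

theorem crossProd_comm (a b : ℂ) : crossProd b a = -crossProd a b := by
  simp only [crossProd]; ring

theorem div_im_eq_crossProd (c d : ℂ) : (d / c).im = crossProd c d / normSq c := by
  simp only [crossProd, div_im]; ring

theorem exists_real_mul_of_crossProd_eq_zero {c l : ℂ} (hl : l ≠ 0) (h : crossProd c l = 0) :
    ∃ t : ℝ, c = t * l := by
  have him : (c / l).im = 0 := by rw [div_im_eq_crossProd, crossProd_comm, h]; simp
  refine ⟨(c / l).re, ?_⟩
  have : ((c / l).re : ℂ) = c / l := Complex.ext (by simp) (by simp [him])
  rw [this, div_mul_cancel₀ _ hl]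

theorem arg_pos_iff_of_im_ne_zero {z : ℂ} (h : z.im ≠ 0) : 0 < arg z ↔ 0 < z.im := by
  have h1 : arg z ≠ 0 := fun h0 => h (arg_eq_zero_iff.mp h0).2
  rw [lt_iff_le_and_ne, lt_iff_le_and_ne, arg_nonneg_iff]
  simp [h1.symm, h.symm]

/-- The branch arg (-l⁻¹ * ·) has its cut along the ray in direction `l`. The right-hand side is 2π
times the number of signed passages through that cut when `c` is rotated to `d` by the smaller
angle. The bounds on the three angles leave only -1, 0 and 1, and the signs of the angles tell these
apart. -/
theorem localWind_eq {l c d : ℂ} (hc : crossProd c l ≠ 0) (hd : crossProd d l ≠ 0)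
    (hπ : signedAngle c d ≠ Real.pi) :
    2 * Real.pi * localWind l c d =
      signedAngle c d + arg (-l⁻¹ * c) - arg (-l⁻¹ * d) := by
  have hl0 : l ≠ 0 := by rintro rfl; simp [crossProd] at hc
  have hc0 : c ≠ 0 := by rintro rfl; simp [crossProd] at hc
  have hd0 : d ≠ 0 := by rintro rfl; simp [crossProd] at hd
  have hlq : 0 < normSq l := normSq_pos.mpr hl0
  have hcq : 0 < normSq c := normSq_pos.mpr hc0
  have him : ∀ z, (-l⁻¹ * z).im = crossProd z l / normSq l := fun z => by
    have : -l⁻¹ * z = -(z / l) := by field_simp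
    rw [this, neg_im, div_im_eq_crossProd, crossProd_comm]
    ring
  have hne : ∀ z, crossProd z l ≠ 0 → (-l⁻¹ * z).im ≠ 0 := fun z hz => by
    rw [him]; exact div_ne_zero hz hlq.ne'
  have hpos : ∀ z, crossProd z l ≠ 0 → (0 < crossProd z l ↔ 0 < arg (-l⁻¹ * z)) := fun z hz => by
    rw [arg_pos_iff_of_im_ne_zero (hne z hz), him, div_pos_iff_of_pos_right hlq]
  have hneg : ∀ z, crossProd z l < 0 ↔ arg (-l⁻¹ * z) < 0 := fun z => by
    rw [arg_neg_iff, him, div_lt_iff₀ hlq, zero_mul]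
  have hlt : ∀ z, crossProd z l ≠ 0 → arg (-l⁻¹ * z) < Real.pi := fun z hz =>
    arg_lt_pi_iff.mpr (Or.inr (hne z hz))
  have hcd_pos : 0 < crossProd c d ↔ 0 < signedAngle c d := by
    rw [← div_pos_iff_of_pos_right hcq, ← div_im_eq_crossProd, signedAngle]
    constructor
    · intro h
      exact (arg_pos_iff_of_im_ne_zero h.ne').mpr h
    · intro h
      refine lt_of_le_of_ne (arg_nonneg_iff.mp h.le) fun h0 => ?_
      rcases eq_or_ne (arg (d / c)) Real.pi with h1 | h1
      · exact hπ h1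
      · have h2 := lt_of_le_of_ne (arg_le_pi (d / c)) h1
        rcases arg_lt_pi_iff.mp h2 with h3 | h3
        · exact h.ne' (arg_eq_zero_iff.mpr ⟨h3, h0.symm⟩)
        · exact h3 h0.symm
  have hcd_neg : crossProd c d < 0 ↔ signedAngle c d < 0 := by
    rw [signedAngle, arg_neg_iff, div_im_eq_crossProd, div_lt_iff₀ hcq, zero_mul]
  obtain ⟨m, hm⟩ := signedAngle_eq_sub_add_int (neg_ne_zero.mpr (inv_ne_zero hl0)) hc0 hd0
  have hpi := Real.pi_pos
  have a1 : signedAngle c d < Real.pi := lt_of_le_of_ne (arg_le_pi _) hπ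
  have a2 : -Real.pi < signedAngle c d := neg_pi_lt_arg _
  have c1 := hlt c hc
  have c2 := neg_pi_lt_arg (-l⁻¹ * c)
  have d1 := hlt d hd
  have d2 := neg_pi_lt_arg (-l⁻¹ * d)
  have hm1 : (m : ℝ) < 2 := by
    by_contra! h
    nlinarith
  have hm2 : (-2 : ℝ) < m := by
    by_contra! h
    nlinarith
  have hm1' : m < 2 := by exact_mod_cast hm1
  have hm2' : -2 < m := by exact_mod_cast hm2
  have hld : ∀ x, crossProd l x = -crossProd x l := fun x => crossProd_comm x l
  have key : localWind l c d = m := by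
    simp only [localWind, orientSign, sign_eq_one_iff, sign_eq_neg_one_iff, hld, neg_pos,
      neg_neg_iff_pos]
    simp only [hcd_pos, hcd_neg, hpos c hc, hneg c, hneg d, hpos d hd]
    obtain rfl | rfl | rfl : m = 1 ∨ m = 0 ∨ m = -1 := by omega
    · push_cast at hm
      rw [if_pos ⟨by linarith, by linarith, by linarith⟩]
    · push_cast at hm
      rw [if_neg, if_neg]
      · rintro ⟨h1, h2, h3⟩; linarith
      · rintro ⟨h1, h2, h3⟩; linarith
    · push_cast at hm
      rw [if_neg (by rintro ⟨h1, h2, h3⟩; linarith), if_pos ⟨by linarith, by linarith, by linarith⟩]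
  rw [key]
  linarith

theorem turning_append_singleton (L : List ℂ) (c d : ℂ) :
    turning (c :: L ++ [d]) =
      turning (c :: L) + signedAngle ((c :: L).getLast (by simp)) d := by
  induction L generalizing c with
  | nil => simp [turning, signedAngle]
  | cons b L ih =>
    have h := ih b
    simp only [List.cons_append, turning] at h ⊢
    rw [h, List.getLast_cons (List.cons_ne_nil b L), signedAngle]
    ring

/-! ### Combinatorics and geometry of PBDTP networks -/

namespace DiskNetwork

section Basic

open scoped Classical

variable {n : ℕ} {V E : Type*} [Fintype E] {N : DiskNetwork n V E}

theorem IsPBDTP.eq_of_src_eq_inl (hN : N.IsPBDTP) {f g : E} {i : Fin n}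
    (hf : N.src f = Sum.inl i) (hg : N.src g = Sum.inl i) : f = g := by
  have h := hN.boundary_degree i
  rw [degree] at h
  have h1 : N.outDeg (Sum.inl i) ≤ 1 := by omega
  exact Finset.card_le_one.mp h1 f (by simp [hf]) g (by simp [hg])

theorem IsPBDTP.eq_of_tgt_eq_inl (hN : N.IsPBDTP) {f g : E} {i : Fin n}
    (hf : N.tgt f = Sum.inl i) (hg : N.tgt g = Sum.inl i) : f = g := by
  have h := hN.boundary_degree i
  rw [degree] at h
  have h1 : N.inDeg (Sum.inl i) ≤ 1 := by omega
  exact Finset.card_le_one.mp h1 f (by simp [hf]) g (by simp [hg])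

theorem IsPBDTP.tgt_ne_of_src_eq_inl (hN : N.IsPBDTP) {f g : E} {i : Fin n}
    (hf : N.src f = Sum.inl i) : N.tgt g ≠ Sum.inl i := by
  intro hg
  have h := hN.boundary_degree i
  have h1 : 0 < N.outDeg (Sum.inl i) := Finset.card_pos.mpr ⟨f, by simp [hf]⟩
  have h2 : 0 < N.inDeg (Sum.inl i) := Finset.card_pos.mpr ⟨g, by simp [hg]⟩
  rw [degree] at h
  omega

theorem IsPBDTP.exists_inr_of_tgt_eq_src (hN : N.IsPBDTP) {f g : E} (h : N.tgt f = N.src g) :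
    ∃ v, N.src g = Sum.inr v := by
  rcases hs : N.src g with i | v
  · exact absurd (h.trans hs) (hN.tgt_ne_of_src_eq_inl hs)
  · exact ⟨v, rfl⟩

theorem IsPBDTP.tgt_eq_inr_of_src (hN : N.IsPBDTP) {f : E} {i : Fin n}
    (hf : N.src f = Sum.inl i) : ∃ v, N.tgt f = Sum.inr v := by
  obtain ⟨v, -, -, h | h⟩ := hN.boundary_edge i f (Or.inl hf)
  · exact ⟨v, h.2⟩
  · rw [hf] at h
    simp at h

theorem IsPBDTP.src_eq_inr_of_tgt (hN : N.IsPBDTP) {f : E} {i : Fin n}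
    (hf : N.tgt f = Sum.inl i) : ∃ v, N.src f = Sum.inr v := by
  obtain ⟨v, -, -, h | h⟩ := hN.boundary_edge i f (Or.inr hf)
  · rw [hf] at h
    simp at h
  · exact ⟨v, h.1⟩

/-- At each vertex, either all the incoming edges or all the outgoing edges coincide. -/
theorem IsPBDTP.eq_or_eq_of_consecutive (hN : N.IsPBDTP) {f f' g g' : E}
    (h : N.tgt f = N.src g) (h' : N.tgt f' = N.src g') (hs : N.src g = N.src g') :
    f = f' ∨ g = g' := by
  obtain ⟨v, hv⟩ := hN.exists_inr_of_tgt_eq_src h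
  rcases hN.perfect v with h1 | h1
  · left
    exact Finset.card_le_one.mp h1.le f (by simp [h, hv]) f' (by simp [h', ← hs, hv])
  · right
    exact Finset.card_le_one.mp h1.le g (by simp [hv]) g' (by simp [← hs, hv])

theorem IsPBDTP.src_ne_tgt (hN : N.IsPBDTP) (e : E) : N.src e ≠ N.tgt e := by
  intro h
  refine hN.vertex_off_edge (N.src e) e ?_
  rw [← h, openSegment_same]
  rfl

theorem IsPBDTP.dir_ne_zero (hN : N.IsPBDTP) (e : E) : N.dir e ≠ 0 := by
  intro h
  exact hN.src_ne_tgt e (hN.pos_injective (sub_eq_zero.mp h).symm)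

theorem IsPBDTP.signedAngle_ne_pi (hN : N.IsPBDTP) {e f : E} (h : N.tgt e = N.src f) :
    signedAngle (N.dir e) (N.dir f) ≠ Real.pi :=
  _root_.signedAngle_ne_pi (hN.dir_ne_zero e) fun a ha => hN.not_antiparallel h a ha

/-- Edges without common end points are disjoint. -/
theorem IsPBDTP.disjoint_segment (hN : N.IsPBDTP) {e f : E} (hss : N.src e ≠ N.src f)
    (hst : N.src e ≠ N.tgt f) (hts : N.tgt e ≠ N.src f) (htt : N.tgt e ≠ N.tgt f) :
    Disjoint (segment ℝ (N.pos (N.src e)) (N.pos (N.tgt e)))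
      (segment ℝ (N.pos (N.src f)) (N.pos (N.tgt f))) := by
  have hef : e ≠ f := by rintro rfl; exact hss rfl
  rw [← insert_endpoints_openSegment, ← insert_endpoints_openSegment, Set.disjoint_left]
  have hpos : ∀ {x y}, N.pos x = N.pos y → x = y := fun h => hN.pos_injective h
  rintro z (rfl | rfl | hz) (h | h | h)
  · exact hss (hpos h)
  · exact hst (hpos h)
  · exact hN.vertex_off_edge _ _ h
  · exact hts (hpos h)
  · exact htt (hpos h)
  · exact hN.vertex_off_edge _ _ h
  · exact hN.vertex_off_edge _ _ (h ▸ hz)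
  · exact hN.vertex_off_edge _ _ (h ▸ hz)
  · exact Set.disjoint_left.mp (hN.edges_disjoint e f hef) hz h

/-! #### The side of the disk and the gauge rays -/

theorem IsPBDTP.crossProd_inl (hN : N.IsPBDTP) (i : Fin n) :
    crossProd (N.sideEnd - N.sideStart) (N.pos (Sum.inl i) - N.sideStart) = 0 := by
  obtain ⟨t, -, ht⟩ := hN.boundary_pos
  rw [(ht i).2, add_sub_cancel_left, crossProd_mul_right]
  simp [crossProd, mul_comm]

theorem IsPBDTP.crossProd_inr (hN : N.IsPBDTP) (v : V) :
    crossProd (N.sideEnd - N.sideStart) (N.pos (Sum.inr v) - N.sideStart) < 0 :=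
  hN.side_clockwise _ (hN.internal_pos v)

theorem IsPBDTP.crossProd_inr_inl (hN : N.IsPBDTP) (v : V) (i : Fin n) :
    crossProd (N.sideEnd - N.sideStart) (N.pos (Sum.inr v) - N.pos (Sum.inl i)) < 0 := by
  have h : N.pos (Sum.inr v) - N.pos (Sum.inl i) =
      (N.pos (Sum.inr v) - N.sideStart) - (N.pos (Sum.inl i) - N.sideStart) := by ring
  rw [h, crossProd_sub_right, hN.crossProd_inl, sub_zero]
  exact hN.crossProd_inr v

theorem crossProd_side_gauge (hN : N.IsPBDTP) {l : ℂ} (hl : N.IsGaugeDirection l) (i : Fin n) :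
    crossProd (N.sideEnd - N.sideStart) l < 0 := by
  obtain ⟨t, ht, h⟩ := hl.points_inside i
  have h1 := hN.side_clockwise _ h
  have h2 : N.pos (Sum.inl i) + (t : ℂ) * l - N.sideStart =
    (N.pos (Sum.inl i) - N.sideStart) + t * l := by ring
  rw [h2, crossProd_add_right, hN.crossProd_inl, zero_add, crossProd_mul_right] at h1
  by_contra! h3
  exact absurd h1 (not_lt.mpr (mul_nonneg ht.le h3))

/-- The position of a point with respect to the line of the gauge ray that starts at `b i`. -/
noncomputable def rayHeight (N : DiskNetwork n V E) (l : ℂ) (i : Fin n) (x : Fin n ⊕ V) : ℝ :=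
  crossProd (N.pos x - N.pos (Sum.inl i)) l

/-- The direction `l` points to the side of the boundary line on which the disk lies. For points of
the disk off that line, the full line through `b i` and the ray therefore make no difference. -/
theorem exists_ray_of_rayHeight_eq_zero (hN : N.IsPBDTP) {l : ℂ} (hl : N.IsGaugeDirection l)
    (i : Fin n) {z : ℂ} (h : crossProd (z - N.pos (Sum.inl i)) l = 0)
    (hz : crossProd (N.sideEnd - N.sideStart) (z - N.sideStart) < 0) :
    ∃ t : ℝ, 0 < t ∧ N.pos (Sum.inl i) + (t : ℂ) * l = z := by
  have hside := crossProd_side_gauge hN hl i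
  have hl0 : l ≠ 0 := by rintro rfl; simp [crossProd] at hside
  obtain ⟨t, ht⟩ := exists_real_mul_of_crossProd_eq_zero hl0 h
  refine ⟨t, ?_, by rw [← ht]; ring⟩
  have h1 : z - N.sideStart = t * l + (N.pos (Sum.inl i) - N.sideStart) := by
    rw [← ht]; ring
  rw [h1, crossProd_add_right, hN.crossProd_inl, add_zero, crossProd_mul_right] at hz
  by_contra! h2
  exact absurd hz (not_lt.mpr (mul_nonneg_of_nonpos_of_nonpos h2 hside.le))

theorem rayHeight_inr_ne_zero (hN : N.IsPBDTP) {l : ℂ} (hl : N.IsGaugeDirection l)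
    (i : Fin n) (v : V) : N.rayHeight l i (Sum.inr v) ≠ 0 := by
  intro h
  obtain ⟨t, ht, h1⟩ := exists_ray_of_rayHeight_eq_zero hN hl i h (hN.crossProd_inr v)
  exact hl.off_vertices i v t ht.le h1

theorem exists_boundary_sub (hN : N.IsPBDTP) : ∃ t : Fin n → ℝ, StrictMono t ∧ ∀ i j,
    N.pos (Sum.inl j) - N.pos (Sum.inl i) = ((t j - t i : ℝ) : ℂ) * (N.sideEnd - N.sideStart) := by
  obtain ⟨t, h1, h2⟩ := hN.boundary_pos
  refine ⟨t, h1, fun i j => ?_⟩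
  rw [(h2 i).2, (h2 j).2]
  push_cast
  ring

theorem rayHeight_inl_pos_iff (hN : N.IsPBDTP) {l : ℂ} (hl : N.IsGaugeDirection l)
    (i j : Fin n) : 0 < N.rayHeight l i (Sum.inl j) ↔ j < i := by
  obtain ⟨t, h1, h2⟩ := exists_boundary_sub hN
  have hside := crossProd_side_gauge hN hl i
  rw [rayHeight, h2, crossProd_mul_left, ← h1.lt_iff_lt]
  constructor
  · intro h
    by_contra! h3
    nlinarith
  · intro h
    nlinarith

theorem rayHeight_inl_neg_iff (hN : N.IsPBDTP) {l : ℂ} (hl : N.IsGaugeDirection l)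
    (i j : Fin n) : N.rayHeight l i (Sum.inl j) < 0 ↔ i < j := by
  obtain ⟨t, h1, h2⟩ := exists_boundary_sub hN
  have hside := crossProd_side_gauge hN hl i
  rw [rayHeight, h2, crossProd_mul_left, ← h1.lt_iff_lt]
  constructor
  · intro h
    by_contra! h3
    nlinarith
  · intro h
    nlinarith

theorem rayHeight_ne_zero (hN : N.IsPBDTP) {l : ℂ} (hl : N.IsGaugeDirection l)
    (i : Fin n) {x : Fin n ⊕ V} (hx : x ≠ Sum.inl i) : N.rayHeight l i x ≠ 0 := by
  rcases x with j | v
  · have hij : j ≠ i := fun h => hx (by rw [h])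
    rcases lt_or_gt_of_ne hij with h | h
    · exact ((rayHeight_inl_pos_iff hN hl i j).mpr h).ne'
    · exact ((rayHeight_inl_neg_iff hN hl i j).mpr h).ne
  · exact rayHeight_inr_ne_zero hN hl i v

theorem rayHeight_self (l : ℂ) (i : Fin n) : N.rayHeight l i (Sum.inl i) = 0 := by
  simp [rayHeight, crossProd]

theorem crossProd_dir (l : ℂ) (i : Fin n) (e : E) :
    crossProd (N.dir e) l = N.rayHeight l i (N.tgt e) - N.rayHeight l i (N.src e) := by
  rw [rayHeight, rayHeight, ← crossProd_sub_left, dir]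
  congr 1
  ring

/-- The gauge condition speaks only of edges between internal vertices. An edge at a boundary vertex
parallel to `l` would put its other end on the line of the ray from that vertex. -/
theorem crossProd_dir_ne_zero (hN : N.IsPBDTP) {l : ℂ} (hl : N.IsGaugeDirection l) (e : E) :
    crossProd (N.dir e) l ≠ 0 := by
  rcases hs : N.src e with i | u
  · rw [crossProd_dir l i, hs, rayHeight_self, sub_zero]
    exact rayHeight_ne_zero hN hl i (hN.tgt_ne_of_src_eq_inl hs)
  · rcases ht : N.tgt e with i | v
    · rw [crossProd_dir l i, ht, rayHeight_self, zero_sub, neg_ne_zero, hs]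
      exact rayHeight_inr_ne_zero hN hl i u
    · exact hl.not_parallel e u v hs ht

/-- The edge `e` meets the gauge ray that starts at `b i`. -/
def MeetsRay (N : DiskNetwork n V E) (l : ℂ) (i : Fin n) (e : E) : Prop :=
  ∃ t : ℝ, 0 < t ∧
    N.pos (Sum.inl i) + (t : ℂ) * l ∈ segment ℝ (N.pos (N.src e)) (N.pos (N.tgt e))

theorem rayHeight_of_mem_segment {l : ℂ} {i : Fin n} {e : E} {z : ℂ} {a b : ℝ} (hab : a + b = 1)
    (hz : a • N.pos (N.src e) + b • N.pos (N.tgt e) = z) :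
    crossProd (z - N.pos (Sum.inl i)) l =
      a * N.rayHeight l i (N.src e) + b * N.rayHeight l i (N.tgt e) := by
  obtain rfl : a = 1 - b := by linarith
  rw [← hz, rayHeight, rayHeight]
  simp [crossProd]
  ring

theorem crossProd_ray (l : ℂ) (i : Fin n) (t : ℝ) :
    crossProd (N.pos (Sum.inl i) + (t : ℂ) * l - N.pos (Sum.inl i)) l = 0 := by
  rw [add_sub_cancel_left, crossProd_mul_left]
  simp [crossProd, mul_comm]

theorem not_meetsRay_of_src (hN : N.IsPBDTP) {l : ℂ} (hl : N.IsGaugeDirection l) {i : Fin n}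
    {e : E} (he : N.src e = Sum.inl i) : ¬ N.MeetsRay l i e := by
  rintro ⟨t, ht, a, b, ha, hb, hab, h⟩
  have h1 := rayHeight_of_mem_segment (l := l) (i := i) hab h
  rw [crossProd_ray, he, rayHeight_self, mul_zero, zero_add] at h1
  have hne := rayHeight_ne_zero hN hl i (hN.tgt_ne_of_src_eq_inl (g := e) he)
  have hb0 : b = 0 := by
    rcases mul_eq_zero.mp h1.symm with h2 | h2
    · exact h2
    · exact absurd h2 hne
  subst hb0
  obtain rfl : a = 1 := by linarith
  rw [he] at h
  have hside := crossProd_side_gauge hN hl i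
  have hl0 : l ≠ 0 := by rintro rfl; simp [crossProd] at hside
  have h3 : (t : ℂ) * l = 0 := by
    simp only [one_smul, zero_smul, add_zero] at h
    linear_combination -h
  rcases mul_eq_zero.mp h3 with h4 | h4
  · exact ht.ne' (by exact_mod_cast h4)
  · exact hl0 h4

/-- The height over the line of the ray is affine along the edge, so the edge crosses this line
exactly when the signs at the ends differ. The crossing point lies strictly inside the side line and
hence on the ray. -/
theorem meetsRay_iff (hN : N.IsPBDTP) {l : ℂ} (hl : N.IsGaugeDirection l) {i : Fin n}
    {e : E} (hs : N.src e ≠ Sum.inl i) (ht : N.tgt e ≠ Sum.inl i) :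
    N.MeetsRay l i e ↔ ¬ (0 < N.rayHeight l i (N.src e) ↔ 0 < N.rayHeight l i (N.tgt e)) := by
  have h1 := rayHeight_ne_zero hN hl i hs
  have h2 := rayHeight_ne_zero hN hl i ht
  set x := N.rayHeight l i (N.src e) with hx
  set y := N.rayHeight l i (N.tgt e) with hy
  constructor
  · rintro ⟨t, -, a, b, ha, hb, hab, h⟩
    have h3 := rayHeight_of_mem_segment (l := l) (i := i) hab h
    rw [crossProd_ray, ← hx, ← hy] at h3
    rintro ⟨h4, h5⟩
    rcases lt_or_gt_of_ne h1 with hx0 | hx0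
    · have hy0 : y < 0 := lt_of_le_of_ne (not_lt.mp fun h6 => absurd (h5 h6) (not_lt.mpr hx0.le)) h2
      rcases ha.eq_or_lt with rfl | ha
      · obtain rfl : b = 1 := by linarith
        linarith
      · nlinarith [mul_pos ha (neg_pos.mpr hx0), mul_nonneg hb (neg_nonneg.mpr hy0.le)]
    · have hy0 : 0 < y := h4 hx0
      rcases ha.eq_or_lt with rfl | ha
      · obtain rfl : b = 1 := by linarith
        linarith
      · nlinarith [mul_pos ha hx0, mul_nonneg hb hy0.le]
  · intro h
    have hxy : x * y < 0 := by
      rcases lt_or_gt_of_ne h1 with hx0 | hx0 <;> rcases lt_or_gt_of_ne h2 with hy0 | hy0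
      · exact absurd ⟨fun h => by linarith, fun h => by linarith⟩ h
      · exact mul_neg_of_neg_of_pos hx0 hy0
      · exact mul_neg_of_pos_of_neg hx0 hy0
      · exact absurd ⟨fun _ => hy0, fun _ => hx0⟩ h
    have hne : y - x ≠ 0 := by
      intro h3
      have : y = x := by linarith
      rw [this] at hxy
      nlinarith
    -- The weights y / (y - x) and -x / (y - x) are those of the zero of the affine function with
    -- end values x and y.
    have ha : 0 < y / (y - x) := by
      have : y / (y - x) = (y * y - x * y) / (y - x) ^ 2 := by field_simp
      rw [this]
      exact div_pos (by nlinarith) (by positivity)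
    have hb : 0 < -x / (y - x) := by
      have : -x / (y - x) = (x * x - x * y) / (y - x) ^ 2 := by field_simp; ring
      rw [this]
      exact div_pos (by nlinarith) (by positivity)
    have hab : y / (y - x) + -x / (y - x) = 1 := by field_simp; ring
    have hz := rayHeight_of_mem_segment (N := N) (l := l) (i := i) (e := e) hab rfl
    have h0 : crossProd (((y / (y - x)) • N.pos (N.src e) + (-x / (y - x)) • N.pos (N.tgt e)) -
        N.pos (Sum.inl i)) l = 0 := by
      rw [hz, ← hx, ← hy]
      field_simp
      ring
    have hside : crossProd (N.sideEnd - N.sideStart) (((y / (y - x)) • N.pos (N.src e) +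
        (-x / (y - x)) • N.pos (N.tgt e)) - N.sideStart) < 0 := by
      have e1 : (((y / (y - x)) • N.pos (N.src e) + (-x / (y - x)) • N.pos (N.tgt e)) -
          N.sideStart) = ((y / (y - x) : ℝ) : ℂ) * (N.pos (N.src e) - N.sideStart) +
          ((-x / (y - x) : ℝ) : ℂ) * (N.pos (N.tgt e) - N.sideStart) := by
        have h5 : ((y / (y - x) : ℝ) : ℂ) + ((-x / (y - x) : ℝ) : ℂ) = 1 := by
          exact_mod_cast hab
        simp only [Complex.real_smul]
        linear_combination N.sideStart * h5
      rw [e1, crossProd_add_right, crossProd_mul_right, crossProd_mul_right]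
      -- At least one end of the edge is internal and so strictly inside; both weights are positive.
      rcases hsrc : N.src e with i' | u
      · obtain ⟨v, hv⟩ := hN.tgt_eq_inr_of_src hsrc
        rw [hN.crossProd_inl, hv]
        nlinarith [mul_pos hb (neg_pos.mpr (hN.crossProd_inr v))]
      · rcases htgt : N.tgt e with i' | v
        · rw [hN.crossProd_inl]
          nlinarith [mul_pos ha (neg_pos.mpr (hN.crossProd_inr u))]
        · nlinarith [mul_pos ha (neg_pos.mpr (hN.crossProd_inr u)),
            mul_pos hb (neg_pos.mpr (hN.crossProd_inr v))]
    obtain ⟨t, ht, h3⟩ := exists_ray_of_rayHeight_eq_zero hN hl i h0 hside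
    exact ⟨t, ht, _, _, ha.le, hb.le, hab, h3.symm⟩

/-! #### Parity of intersection numbers -/

/-- The side of a gauge ray on which a vertex lies, modulo two. -/
noncomputable def raySide (N : DiskNetwork n V E) (l : ℂ) (i : Fin n) (x : Fin n ⊕ V) : ZMod 2 :=
  if 0 < N.rayHeight l i x then 1 else 0

theorem intEdge_cast (l : ℂ) (e : E) : ((N.intEdge l e : ℕ) : ZMod 2) =
    ∑ i ∈ N.sources, if N.MeetsRay l i e then 1 else 0 := by
  rw [intEdge, Finset.card_filter]
  push_cast
  rfl

theorem meetsRay_cast (hN : N.IsPBDTP) {l : ℂ} (hl : N.IsGaugeDirection l) {i : Fin n}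
    {e : E} (hs : N.src e ≠ Sum.inl i) (ht : N.tgt e ≠ Sum.inl i) :
    (if N.MeetsRay l i e then 1 else 0 : ZMod 2) =
      N.raySide l i (N.src e) + N.raySide l i (N.tgt e) := by
  have h2 : (1 + 1 : ZMod 2) = 0 := by decide
  simp only [meetsRay_iff hN hl hs ht, raySide]
  by_cases h3 : 0 < N.rayHeight l i (N.src e) <;> by_cases h4 : 0 < N.rayHeight l i (N.tgt e) <;>
    simp [h3, h4, h2]

theorem IsPBDTP.tgt_ne_of_mem_sources (hN : N.IsPBDTP) {i : Fin n} (hi : i ∈ N.sources) (e : E) :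
    N.tgt e ≠ Sum.inl i := by
  obtain ⟨f, hf⟩ := (Finset.mem_filter.mp hi).2
  exact hN.tgt_ne_of_src_eq_inl hf

end Basic

end DiskNetwork

end LocalWind

/-! ### Winding numbers of walks between boundary vertices -/

theorem signedAngle_ne_pi_of_crossProd {c d : ℂ} (h : crossProd c d ≠ 0) :
    signedAngle c d ≠ Real.pi := by
  intro hpi
  have h1 := (Complex.arg_eq_pi_iff.mp hpi).2
  rw [div_im_eq_crossProd, div_eq_zero_iff] at h1
  rcases h1 with h1 | h1
  · exact h h1
  · rw [Complex.normSq_eq_zero] at h1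
    exact h (by simp [crossProd, h1])

theorem localWind_of_neg {l c d : ℂ} (h1 : crossProd c d < 0) (h2 : crossProd c l < 0) :
    localWind l c d = if crossProd l d < 0 then -1 else 0 := by
  simp [localWind, orientSign, sign_eq_one_iff, sign_eq_neg_one_iff, h1, h2]

theorem localWind_of_pos {l c d : ℂ} (h1 : 0 < crossProd c d) (h2 : 0 < crossProd c l) :
    localWind l c d = if 0 < crossProd l d then 1 else 0 := by
  simp [localWind, orientSign, sign_eq_one_iff, sign_eq_neg_one_iff, h1, h2]

theorem localWind_eq_zero_of_neg {l c d : ℂ} (h1 : crossProd c d < 0) (h2 : 0 < crossProd l d) :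
    localWind l c d = 0 := by
  simp [localWind, orientSign, sign_eq_one_iff, sign_eq_neg_one_iff, h1, not_lt.mpr h2.le]

theorem localWind_eq_zero_of_pos {l c d : ℂ} (h1 : 0 < crossProd c d) (h2 : crossProd l d < 0) :
    localWind l c d = 0 := by
  simp [localWind, orientSign, sign_eq_one_iff, sign_eq_neg_one_iff, h1, not_lt.mpr h2.le]

namespace DiskNetwork

section Walks

open scoped Classical

variable {n : ℕ} {V E : Type*} [Fintype E] {N : DiskNetwork n V E}

/-- The arguments in `localWind_eq` cancel at every inner edge, so only those of the first and the
last edge survive. -/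
theorem two_pi_mul_wind (hN : N.IsPBDTP) {l : ℂ} (hl : N.IsGaugeDirection l) (P : List E) :
    ∀ e, (e :: P).IsChain (fun f g => N.tgt f = N.src g) →
    2 * Real.pi * N.wind l (e :: P) = turning ((e :: P).map N.dir) +
      Complex.arg (-l⁻¹ * N.dir e) -
      Complex.arg (-l⁻¹ * N.dir ((e :: P).getLast (List.cons_ne_nil e P))) := by
  induction P with
  | nil => intro e _; simp [wind, turning]
  | cons f P ih =>
    intro e h
    rw [List.isChain_cons_cons] at h
    have h1 := ih f h.2
    have h2 := localWind_eq (crossProd_dir_ne_zero hN hl e) (crossProd_dir_ne_zero hN hl f)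
      (hN.signedAngle_ne_pi h.1)
    rw [List.getLast_cons (List.cons_ne_nil f P)]
    have h3 : N.wind l (e :: f :: P) =
      localWind l (N.dir e) (N.dir f) + N.wind l (f :: P) := rfl
    have h4 : turning ((e :: f :: P).map N.dir) =
      signedAngle (N.dir e) (N.dir f) + turning ((f :: P).map N.dir) := rfl
    rw [h3, h4]
    push_cast
    linarith

theorem intWalk_cast (l : ℂ) (P : List E) : ((N.intWalk l P : ℕ) : ZMod 2) =
    ∑ i ∈ N.sources, (P.map fun f => if N.MeetsRay l i f then (1 : ZMod 2) else 0).sum := by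
  induction P with
  | nil => simp [intWalk]
  | cons e P ih =>
    have h1 : N.intWalk l (e :: P) = N.intEdge l e + N.intWalk l P := by simp [intWalk]
    rw [h1, Nat.cast_add, ih, intEdge_cast, ← Finset.sum_add_distrib]
    simp

theorem add_self_zmod_two (a : ZMod 2) : a + a = 0 := by
  rw [← two_mul]
  exact (by decide : ∀ a : ZMod 2, 2 * a = 0) a

/-- Modulo two each edge contributes the sides of its two ends, and inner vertices occur twice. No
vertex of the walk is the start of the ray, so every side is well defined. -/
theorem sum_meetsRay (hN : N.IsPBDTP) {l : ℂ} (hl : N.IsGaugeDirection l) {i : Fin n}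
    (hi : i ∈ N.sources) (P : List E) :
    ∀ e, (e :: P).IsChain (fun f g => N.tgt f = N.src g) → N.src e ≠ Sum.inl i →
    ((e :: P).map fun f => if N.MeetsRay l i f then (1 : ZMod 2) else 0).sum =
      N.raySide l i (N.src e) +
        N.raySide l i (N.tgt ((e :: P).getLast (List.cons_ne_nil e P))) := by
  induction P with
  | nil =>
    intro e _ he
    simpa using meetsRay_cast hN hl he (hN.tgt_ne_of_mem_sources hi e)
  | cons f P ih =>
    intro e h he
    rw [List.isChain_cons_cons] at h
    have ht := hN.tgt_ne_of_mem_sources hi e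
    have h1 := ih f h.2 (h.1 ▸ ht)
    rw [List.getLast_cons (List.cons_ne_nil f P), List.map_cons, List.sum_cons, h1,
      meetsRay_cast hN hl he ht, ← h.1]
    linear_combination add_self_zmod_two (N.raySide l i (N.tgt e))

theorem raySide_inl_add (hN : N.IsPBDTP) {l : ℂ} (hl : N.IsGaugeDirection l) {s i j : Fin n}
    (hi : s ≠ i) (hj : s ≠ j) : N.raySide l s (Sum.inl i) + N.raySide l s (Sum.inl j) =
      if min i j < s ∧ s < max i j then 1 else 0 := by
  have h2 : (1 + 1 : ZMod 2) = 0 := by decide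
  simp only [raySide, rayHeight_inl_pos_iff hN hl]
  rcases lt_or_gt_of_ne hi with h3 | h3 <;> rcases lt_or_gt_of_ne hj with h4 | h4 <;>
    simp [h3, h4, h2, not_lt.mpr h3.le, not_lt.mpr h4.le]

theorem mem_sources_of_src {e : E} {i : Fin n} (he : N.src e = Sum.inl i) : i ∈ N.sources :=
  Finset.mem_filter.mpr ⟨Finset.mem_univ _, e, he⟩

theorem IsWalk.getLast_eq {e : E} {j : Fin n} {P : List E} (h : N.IsWalk e j P) (hP : P ≠ []) :
    N.tgt (P.getLast hP) = Sum.inl j := by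
  obtain ⟨-, -, f, hf, hj⟩ := h
  rw [List.getLast?_eq_some_getLast hP, Option.some.injEq] at hf
  rw [hf, hj]

theorem isWalk_cons_cons {e f : E} {j : Fin n} {P : List E} :
    N.IsWalk e j (e :: f :: P) ↔ N.tgt e = N.src f ∧ N.IsWalk f j (f :: P) := by
  simp [IsWalk, List.isChain_cons_cons, and_assoc]

theorem IsWalk.exists_eq_cons {e : E} {j : Fin n} {P : List E} (h : N.IsWalk e j P) :
    ∃ Q, P = e :: Q := by
  rcases P with _ | ⟨f, Q⟩
  · simp [IsWalk] at h
  · have h1 := h.1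
    simp only [List.head?_cons, Option.some.injEq] at h1
    exact ⟨Q, by rw [h1]⟩

theorem IsWalk.exists_eq_cons_cons (hN : N.IsPBDTP) {e : E} {i j : Fin n} {P : List E}
    (he : N.src e = Sum.inl i) (h : N.IsWalk e j P) : ∃ f Q, P = e :: f :: Q := by
  obtain ⟨Q, rfl⟩ := h.exists_eq_cons
  rcases Q with _ | ⟨f, Q⟩
  · obtain ⟨v, hv⟩ := hN.tgt_eq_inr_of_src he
    have := h.getLast_eq (by simp)
    simp [hv] at this
  · exact ⟨f, Q, rfl⟩

/-- The ray from a source other than `b i` is crossed an odd number of times exactly when it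
separates `b i` from `b j`. The ray from `b i` starts on the walk: its count begins only at the end
of the first edge, which produces the correction in brackets. -/
theorem intWalk_parity (hN : N.IsPBDTP) {l : ℂ} (hl : N.IsGaugeDirection l) {e : E} {i j : Fin n}
    (he : N.src e = Sum.inl i) (hj : j ∉ N.sources) {P : List E} (hP : N.IsWalk e j P) :
    ((N.intWalk l P : ℕ) : ZMod 2) = N.sourcesBetween i j +
      (N.raySide l i (N.tgt e) + N.raySide l i (Sum.inl j)) := by
  obtain ⟨f, Q, rfl⟩ := hP.exists_eq_cons_cons hN he
  have hi := mem_sources_of_src he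
  have hlast := hP.getLast_eq (by simp)
  have hch := hP.2.1
  have hch2 := List.isChain_cons_cons.mp hch
  have hij : i ≠ j := fun h => hj (h ▸ hi)
  rw [intWalk_cast, ← Finset.add_sum_erase _ _ hi, sourcesBetween, Finset.card_filter,
    ← Finset.add_sum_erase N.sources (fun s => if min i j < s ∧ s < max i j then 1 else 0) hi]
  have h0 : ¬ (min i j < i ∧ i < max i j) := by
    rintro ⟨h1, h2⟩
    simp only [min_lt_iff, lt_max_iff, lt_irrefl, false_or] at h1 h2
    exact lt_asymm h1 h2
  rw [if_neg h0, List.map_cons, List.sum_cons, if_neg (not_meetsRay_of_src hN hl he),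
    sum_meetsRay hN hl hi Q f hch2.2 (hch2.1 ▸ hN.tgt_ne_of_mem_sources hi e)]
  rw [List.getLast_cons (List.cons_ne_nil f Q)] at hlast
  rw [hlast, ← hch2.1]
  push_cast
  have hsum : ∀ s ∈ N.sources.erase i,
      ((e :: f :: Q).map fun f => if N.MeetsRay l s f then (1 : ZMod 2) else 0).sum =
      if min i j < s ∧ s < max i j then 1 else 0 := by
    intro s hs
    obtain ⟨hsi, hs⟩ := Finset.mem_erase.mp hs
    rw [sum_meetsRay hN hl hs (f :: Q) e hch (by rw [he]; simpa using hsi.symm),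
      List.getLast_cons (List.cons_ne_nil f Q), hlast, he, raySide_inl_add hN hl hsi]
    rintro rfl
    exact hj hs
  rw [Finset.sum_congr rfl hsum]
  ring

theorem crossProd_side_dir_src (hN : N.IsPBDTP) {e : E} {i : Fin n} (he : N.src e = Sum.inl i) :
    crossProd (N.sideEnd - N.sideStart) (N.dir e) < 0 := by
  obtain ⟨v, hv⟩ := hN.tgt_eq_inr_of_src he
  rw [dir, he, hv]
  exact hN.crossProd_inr_inl v i

theorem crossProd_side_dir_tgt (hN : N.IsPBDTP) {e : E} {i : Fin n} (he : N.tgt e = Sum.inl i) :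
    0 < crossProd (N.sideEnd - N.sideStart) (N.dir e) := by
  obtain ⟨v, hv⟩ := hN.src_eq_inr_of_tgt he
  have h := hN.crossProd_inr_inl v i
  rw [dir, he, hv, crossProd_sub_right]
  rw [crossProd_sub_right] at h
  linarith

/-- The winding contributed by the bends at the two ends of a walk. -/
theorem localWind_ends_parity (hN : N.IsPBDTP) {l : ℂ} (hl : N.IsGaugeDirection l) {e f : E}
    {i j : Fin n} (hij : i ≠ j) (he : N.src e = Sum.inl i) (hf : N.tgt f = Sum.inl j) :
    ((localWind l (N.pos (Sum.inl j) - N.pos (Sum.inl i)) (N.dir e) +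
      localWind l (N.dir f) (N.pos (Sum.inl j) - N.pos (Sum.inl i)) : ℤ) : ZMod 2) =
    N.raySide l i (N.tgt e) + N.raySide l i (Sum.inl j) := by
  obtain ⟨t, ht, hpos⟩ := exists_boundary_sub hN
  have h1 := crossProd_side_dir_src hN he
  have h2 := crossProd_side_dir_tgt hN hf
  have h3 := crossProd_side_gauge hN hl i
  have h4 : N.rayHeight l i (N.tgt e) = -crossProd l (N.dir e) := by
    rw [← crossProd_comm, crossProd_dir l i, he, rayHeight_self, sub_zero]
  have h5 := rayHeight_inl_pos_iff hN hl i j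
  have hne := crossProd_dir_ne_zero hN hl e
  rw [crossProd_comm l, neg_ne_zero] at hne
  have hm : (-1 : ZMod 2) = 1 := by decide
  rw [hpos]
  set D := N.sideEnd - N.sideStart
  -- The vector from `b i` to `b j` is parallel to the side, `l` points into the disk and the last
  -- edge points out of it. The final bend therefore never passes `l`; the first bend passes it
  -- exactly when `l` lies between that vector and the first edge.
  rcases lt_or_gt_of_ne hij with h | h
  · have htt : 0 < t j - t i := sub_pos.mpr (ht h)
    have e1 : crossProd ((t j - t i : ℝ) * D) (N.dir e) < 0 := by
      rw [crossProd_mul_left]; nlinarith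
    have e2 : crossProd ((t j - t i : ℝ) * D) l < 0 := by
      rw [crossProd_mul_left]; nlinarith
    have e3 : crossProd (N.dir f) ((t j - t i : ℝ) * D) < 0 := by
      rw [crossProd_mul_right, crossProd_comm D]; nlinarith
    rw [localWind_of_neg e1 e2, localWind_eq_zero_of_neg e3 (by rw [crossProd_comm]; linarith)]
    simp only [raySide, h4, h5, neg_pos, not_lt.mpr h.le, if_false]
    split_ifs <;> simp
  · have htt : t j - t i < 0 := sub_neg.mpr (ht h)
    have e1 : 0 < crossProd ((t j - t i : ℝ) * D) (N.dir e) := by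
      rw [crossProd_mul_left]; nlinarith
    have e2 : 0 < crossProd ((t j - t i : ℝ) * D) l := by
      rw [crossProd_mul_left]; nlinarith
    have e3 : 0 < crossProd (N.dir f) ((t j - t i : ℝ) * D) := by
      rw [crossProd_mul_right, crossProd_comm D]; nlinarith
    rw [localWind_of_pos e1 e2, localWind_eq_zero_of_pos e3 (by rw [crossProd_comm]; linarith)]
    simp only [raySide, h4, h5, neg_pos, h, if_true]
    rcases lt_or_gt_of_ne hne with h6 | h6
    · simp [h6, not_lt.mpr h6.le, add_self_zmod_two]
    · simp [h6, not_lt.mpr h6.le]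

theorem crossProd_boundary_ne_zero (hN : N.IsPBDTP) {i j : Fin n} (hij : i ≠ j) {d : ℂ}
    (h : crossProd (N.sideEnd - N.sideStart) d ≠ 0) :
    crossProd (N.pos (Sum.inl j) - N.pos (Sum.inl i)) d ≠ 0 := by
  obtain ⟨t, ht, hpos⟩ := exists_boundary_sub hN
  rw [hpos, crossProd_mul_left]
  exact mul_ne_zero (sub_ne_zero.mpr (ht.injective.ne hij.symm)) h

theorem two_pi_mul_topWind (hN : N.IsPBDTP) {e : E} {i j : Fin n} (hij : i ≠ j) (Q : List E) :
    2 * Real.pi * N.topWind i j (e :: Q) =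
      signedAngle (N.pos (Sum.inl j) - N.pos (Sum.inl i)) (N.dir e) +
      turning ((e :: Q).map N.dir) +
      signedAngle (N.dir ((e :: Q).getLast (List.cons_ne_nil e Q)))
        (N.pos (Sum.inl j) - N.pos (Sum.inl i)) := by
  set f := (e :: Q).getLast (List.cons_ne_nil e Q) with hf
  set τ := N.pos (Sum.inl j) - N.pos (Sum.inl i) with hτ
  have hτ0 : τ ≠ 0 := sub_ne_zero.mpr fun h => hij (by simpa using (hN.pos_injective h).symm)
  have b4 := rotationNumber_eq τ ((e :: Q).map N.dir) hτ0 (by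
    intro d hd
    obtain ⟨g, -, rfl⟩ := List.mem_map.mp hd
    exact hN.dir_ne_zero g)
  have b5 : turning (τ :: ((e :: Q).map N.dir ++ [τ])) =
      signedAngle τ (N.dir e) + (turning ((e :: Q).map N.dir) + signedAngle (N.dir f) τ) := by
    have := turning_append_singleton (Q.map N.dir) (N.dir e) τ
    have h6 : (N.dir e :: Q.map N.dir).getLast (List.cons_ne_nil _ _) = N.dir f := by
      rw [hf, ← List.getLast_map (f := N.dir) (by simp)]
      rfl
    rw [h6] at this
    rw [List.map_cons, ← this]
    rfl
  rw [b5, eq_div_iff (by positivity)] at b4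
  have b6 : N.topWind i j (e :: Q) = rotationNumber τ ((e :: Q).map N.dir) := rfl
  rw [b6]
  linarith

/-- The topological winding index of a walk between boundary vertices. -/
theorem topWind_eq (hN : N.IsPBDTP) {l : ℂ} (hl : N.IsGaugeDirection l) {e : E} {i j : Fin n}
    (he : N.src e = Sum.inl i) (hij : i ≠ j) {P : List E} (hP : N.IsWalk e j P) (hne : P ≠ []) :
    N.topWind i j P = localWind l (N.pos (Sum.inl j) - N.pos (Sum.inl i)) (N.dir e) +
      N.wind l P + localWind l (N.dir (P.getLast hne)) (N.pos (Sum.inl j) - N.pos (Sum.inl i)) := by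
  have hlast := hP.getLast_eq hne
  have hch := hP.2.1
  obtain ⟨Q, rfl⟩ := hP.exists_eq_cons
  have b0 := two_pi_mul_topWind hN (e := e) hij Q
  set f := (e :: Q).getLast hne with hf
  set τ := N.pos (Sum.inl j) - N.pos (Sum.inl i) with hτ
  have hτl : crossProd τ l ≠ 0 := crossProd_boundary_ne_zero hN hij (crossProd_side_gauge hN hl i).ne
  have a1 : crossProd τ (N.dir e) ≠ 0 :=
    crossProd_boundary_ne_zero hN hij (crossProd_side_dir_src hN he).ne
  have a2 : crossProd (N.dir f) τ ≠ 0 := by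
    rw [crossProd_comm τ]
    exact neg_ne_zero.mpr (crossProd_boundary_ne_zero hN hij (crossProd_side_dir_tgt hN hlast).ne')
  have b1 := localWind_eq hτl (crossProd_dir_ne_zero hN hl e) (signedAngle_ne_pi_of_crossProd a1)
  have b2 := localWind_eq (crossProd_dir_ne_zero hN hl f) hτl (signedAngle_ne_pi_of_crossProd a2)
  have b3 := two_pi_mul_wind hN hl Q e hch
  have b6 : (2 * Real.pi) * (N.topWind i j (e :: Q) : ℝ) = (2 * Real.pi) *
      ((localWind l τ (N.dir e) + N.wind l (e :: Q) + localWind l (N.dir f) τ : ℤ) : ℝ) := by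
    push_cast
    linarith
  have b7 := mul_left_cancel₀ (by positivity) b6
  exact_mod_cast b7

/-- The bends at the ends and the crossings of the ray from `b i` have the same parity and cancel.
Simplicity of the walk is not used, so the signs of the two formal sums can be compared walk by
walk. -/
theorem topWind_parity (hN : N.IsPBDTP) {l : ℂ} (hl : N.IsGaugeDirection l) {e : E} {i j : Fin n}
    (he : N.src e = Sum.inl i) (hj : j ∉ N.sources) {P : List E} (hP : N.IsWalk e j P) :
    ((N.topWind i j P : ℤ) : ZMod 2) = (N.wind l P : ℤ) + (N.intWalk l P : ℕ) +
      (N.sourcesBetween i j : ℕ) := by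
  have hij : i ≠ j := fun h => hj (h ▸ mem_sources_of_src he)
  have hne : P ≠ [] := by
    obtain ⟨Q, rfl⟩ := hP.exists_eq_cons
    simp
  have h1 := localWind_ends_parity hN hl hij he (hP.getLast_eq hne)
  rw [topWind_eq hN hl he hij hP hne, intWalk_parity hN hl he hj hP, ← h1]
  push_cast
  linear_combination -add_self_zmod_two (N.sourcesBetween i j : ZMod 2)

end Walks

end DiskNetwork

/-! ### Winding numbers of simple walks and simple cycles -/

theorem turning_eq_sum (L : List ℂ) (d : ℂ) :
    turning L = ∑ t ∈ Finset.range (L.length - 1), signedAngle (L.getD t d) (L.getD (t + 1) d) := by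
  match L with
  | [] => simp [turning]
  | [c] => simp [turning]
  | b :: c :: L =>
    have h1 : turning (b :: c :: L) = signedAngle b c + turning (c :: L) := rfl
    rw [h1, turning_eq_sum (c :: L) d]
    simp [Finset.sum_range_succ']
    ring

namespace DiskNetwork

section SimpleWalks

open scoped Classical

variable {n : ℕ} {V E : Type*} [Fintype E] {N : DiskNetwork n V E}

/-- Injectivity of initial and final vertices makes the walk a simple polygon; all its inner
vertices lie strictly on one side of the boundary line. The turning given by `sum_signedAngle_path`
is then undone by the two bends. -/
theorem topWind_eq_zero (hN : N.IsPBDTP) {e : E} {i j : Fin n}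
    (he : N.src e = Sum.inl i) (hij : i ≠ j) {P : List E} (hP : N.IsWalk e j P) (hnd : P.Nodup)
    (hsrc : ∀ f ∈ P, ∀ g ∈ P, N.src f = N.src g → f = g)
    (htgt : ∀ f ∈ P, ∀ g ∈ P, N.tgt f = N.tgt g → f = g) : N.topWind i j P = 0 := by
  have hlast := hP.getLast_eq (by obtain ⟨Q, rfl⟩ := hP.exists_eq_cons; simp)
  have hch := hP.2.1
  obtain ⟨Q, rfl⟩ := hP.exists_eq_cons
  have htw := two_pi_mul_topWind hN (e := e) hij Q
  set τ := N.pos (Sum.inl j) - N.pos (Sum.inl i) with hτ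
  set m := Q.length with hm
  -- The default value `e` only occurs at indices beyond `m`, which are never used.
  set f : ℕ → E := fun t => (e :: Q).getD t e with hf
  have hlen : (e :: Q).length = m + 1 := by simp [hm]
  have hget : ∀ t (ht : t ≤ m), f t = (e :: Q)[t]'(by omega) := fun t ht =>
    List.getD_eq_getElem _ _ (by omega)
  have hmem : ∀ t ≤ m, f t ∈ e :: Q := fun t ht => by
    rw [hget t ht]; exact List.getElem_mem _
  have hinj : ∀ s ≤ m, ∀ t ≤ m, f s = f t → s = t := fun s hs t ht h => by
    rw [hget s hs, hget t ht] at h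
    exact (hnd.getElem_inj_iff).mp h
  have hcons : ∀ t < m, N.tgt (f t) = N.src (f (t + 1)) := fun t ht => by
    rw [hget t ht.le, hget (t + 1) ht]
    exact List.isChain_iff_getElem.mp hch t (by omega)
  have hlast' : (e :: Q).getLast (List.cons_ne_nil e Q) = f m := by
    rw [hget m le_rfl, List.getLast_eq_getElem]
    congr 1
  have hf0 : f 0 = e := rfl
  -- The m + 2 vertices of the walk: the initial vertex of `e`, followed by the final vertices of
  -- the m + 1 edges.
  set x : ℕ → Fin n ⊕ V := fun t => Nat.casesOn t (N.src e) fun s => N.tgt (f s) with hx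
  have hx0 : x 0 = Sum.inl i := he
  have hxs : ∀ t, x (t + 1) = N.tgt (f t) := fun t => rfl
  have hxsrc : ∀ t ≤ m, x t = N.src (f t) := fun t ht => by
    rcases t with _ | t
    · rfl
    · exact hcons t ht
  set p : ℕ → ℂ := fun t => N.pos (x t) with hp
  have hdir : ∀ t ≤ m, p (t + 1) - p t = N.dir (f t) := fun t ht => by
    rw [hp, dir, ← hxsrc t ht]
  have hturn : turning ((e :: Q).map N.dir) =
      ∑ t ∈ Finset.range m, signedAngle (p (t + 1) - p t) (p (t + 2) - p (t + 1)) := by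
    rw [turning_eq_sum _ (N.dir e)]
    simp only [List.length_map, hlen, Nat.add_sub_cancel, List.getD_map]
    refine Finset.sum_congr rfl fun t ht => ?_
    have ht := Finset.mem_range.mp ht
    rw [hdir t ht.le, hdir (t + 1) ht]
  have hxm : x (m + 1) = Sum.inl j := by rw [hxs, ← hlast']; exact hlast
  have hinner : ∀ t, 0 < t → t ≤ m → ∃ v, x t = Sum.inr v := fun t ht htm => by
    obtain ⟨s, rfl⟩ : ∃ s, t = s + 1 := ⟨t - 1, by omega⟩
    obtain ⟨v, hv⟩ := hN.exists_inr_of_tgt_eq_src (hcons s htm)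
    exact ⟨v, by rw [hxsrc _ htm, hv]⟩
  have hτ0 : τ ≠ 0 := sub_ne_zero.mpr fun h => hij (by simpa using (hN.pos_injective h).symm)
  have hτ' : p (m + 1) - p 0 = τ := by simp only [hp, hxm, hx0, hτ]
  obtain ⟨t', ht', hpos⟩ := exists_boundary_sub hN
  have him : ∀ t, ((p t - p 0) / τ).im = (t' j - t' i) *
      crossProd (N.sideEnd - N.sideStart) (p t - p 0) / Complex.normSq τ := fun t => by
    rw [div_im_eq_crossProd, hτ, hpos, crossProd_mul_left]
  have hside : ∀ t, 0 < t → t ≤ m → crossProd (N.sideEnd - N.sideStart) (p t - p 0) < 0 := by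
    intro t ht htm
    obtain ⟨v, hv⟩ := hinner t ht htm
    simp only [hp, hx0, hv]
    exact hN.crossProd_inr_inl v i
  have hnq : 0 < Complex.normSq τ := Complex.normSq_pos.mpr hτ0
  have key := sum_signedAngle_path p m τ hτ' hτ0
    (fun t ht h => hN.dir_ne_zero (f t) (by rw [← hdir t ht, ← h, sub_self]))
    (fun t ht => by
      rw [hdir t ht.le, hdir (t + 1) ht]
      exact hN.signedAngle_ne_pi (hcons t ht))
    (fun s k hsk hk => by
      simp only [hp, hxs]
      rw [hxsrc s (by omega), hxsrc k hk]
      refine hN.disjoint_segment (fun h => ?_) (fun h => ?_) (fun h => ?_) (fun h => ?_)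
      · have := hinj _ (by omega) _ hk (hsrc _ (hmem s (by omega)) _ (hmem k hk) h)
        omega
      · rcases s with _ | s
        · rw [hf0, he] at h
          exact hN.tgt_ne_of_src_eq_inl he h.symm
        · rw [← hcons s (by omega)] at h
          have := hinj _ (by omega) _ hk (htgt _ (hmem s (by omega)) _ (hmem k hk) h)
          omega
      · rw [hcons s (by omega)] at h
        have := hinj _ (by omega) _ hk (hsrc _ (hmem (s + 1) (by omega)) _ (hmem k hk) h)
        omega
      · have := hinj _ (by omega) _ hk (htgt _ (hmem s (by omega)) _ (hmem k hk) h)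
        omega)
    (by
      rcases lt_or_gt_of_ne (ht'.injective.ne hij) with h | h
      · right
        intro t ht htm
        rw [him]
        exact div_neg_of_neg_of_pos (by nlinarith [hside t ht htm]) hnq
      · left
        intro t ht htm
        rw [him]
        exact div_pos (by nlinarith [hside t ht htm]) hnq)
  have a1 : signedAngle τ (N.dir e) ≠ Real.pi := signedAngle_ne_pi_of_crossProd
    (crossProd_boundary_ne_zero hN hij (crossProd_side_dir_src hN he).ne)
  have a2 : signedAngle τ (N.dir (f m)) ≠ Real.pi := signedAngle_ne_pi_of_crossProd
    (crossProd_boundary_ne_zero hN hij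
      (crossProd_side_dir_tgt hN (hlast' ▸ hlast)).ne')
  have c1 := signedAngle_comm hτ0 (hN.dir_ne_zero e) a1
  have c2 := signedAngle_comm hτ0 (hN.dir_ne_zero (f m)) a2
  rw [hturn, key, hdir m le_rfl, hlast'] at htw
  have h1 : p 1 - p 0 = N.dir e := hdir 0 (by omega)
  rw [h1, c1, c2] at htw
  have h2 : (N.topWind i j (e :: Q) : ℝ) = 0 := by
    have hpi := Real.pi_pos
    have : 2 * Real.pi * (N.topWind i j (e :: Q) : ℝ) = 0 := by rw [htw]; ring
    rcases mul_eq_zero.mp this with h | h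
    · exact absurd h (by positivity)
    · exact h
  exact_mod_cast h2

theorem wind_parity_simple (hN : N.IsPBDTP) {l : ℂ} (hl : N.IsGaugeDirection l) {e : E}
    {i j : Fin n} (he : N.src e = Sum.inl i) (hj : j ∉ N.sources) {P : List E}
    (hP : N.IsWalk e j P) (hnd : P.Nodup)
    (hsrc : ∀ f ∈ P, ∀ g ∈ P, N.src f = N.src g → f = g)
    (htgt : ∀ f ∈ P, ∀ g ∈ P, N.tgt f = N.tgt g → f = g) :
    N.wind l P + (N.intWalk l P : ℤ) ≡ (N.sourcesBetween i j : ℤ) [ZMOD 2] := by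
  have hij : i ≠ j := fun h => hj (h ▸ mem_sources_of_src he)
  have h := topWind_parity hN hl he hj hP
  rw [topWind_eq_zero hN he hij hP hnd hsrc htgt] at h
  refine (ZMod.intCast_eq_intCast_iff _ _ 2).mp ?_
  push_cast at h ⊢
  linear_combination -h - add_self_zmod_two (N.sourcesBetween i j : ZMod 2)

/-! #### Cycles -/

/-- The lexicographic minimum of the pairs (re, im) supplies the extreme vertex at which
`sum_signedAngle_cycle` starts. Ties in the real part are why π / 2 is attained. -/
theorem exists_re_im_min {ι : Type*} (s : Finset ι) (hs : s.Nonempty) (z : ι → ℂ) :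
    ∃ a ∈ s, ∀ b ∈ s, z b ≠ z a →
      -(Real.pi / 2) < Complex.arg (z b - z a) ∧ Complex.arg (z b - z a) ≤ Real.pi / 2 := by
  obtain ⟨a, ha, h⟩ := s.exists_min_image (fun b => toLex ((z b).re, (z b).im)) hs
  refine ⟨a, ha, fun b hb hne => ?_⟩
  have h1 := h b hb
  rw [Prod.Lex.toLex_le_toLex] at h1
  rw [Complex.neg_pi_div_two_lt_arg_iff, Complex.arg_le_pi_div_two_iff]
  simp only [Complex.sub_re, Complex.sub_im, sub_pos, sub_nonneg, sub_neg]
  rcases h1 with h1 | ⟨h1, h2⟩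
  · exact ⟨Or.inl h1, Or.inl h1.le⟩
  · exact ⟨Or.inr h2, Or.inl h1.le⟩

theorem sum_support_eq_sum_range {α M : Type*} [Fintype α] [DecidableEq α] [AddCommMonoid M]
    {c : Equiv.Perm α} (hc : c.IsCycle) {a : α} (ha : a ∈ c.support) (F : α → M) :
    ∑ b ∈ c.support, F b = ∑ t ∈ Finset.range c.support.card, F ((c ^ t) a) := by
  have hon : c.IsCycleOn (c.support : Set α) := by
    have := hc.isCycleOn
    rwa [← Equiv.Perm.coe_support_eq_set_support] at this
  symm
  refine Finset.sum_nbij (fun t => (c ^ t) a) (fun t _ => ?_) (fun s hs t ht h => ?_)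
    (fun b hb => ?_) (fun _ _ => rfl)
  · exact Equiv.Perm.pow_apply_mem_support.mpr ha
  · have h1 := (hon.pow_apply_eq_pow_apply ha).mp h
    exact Nat.ModEq.eq_of_lt_of_lt h1 (Finset.mem_range.mp hs) (Finset.mem_range.mp ht)
  · obtain ⟨t, ht, h⟩ := hon.exists_pow_eq ha hb
    exact ⟨t, Finset.mem_coe.mpr (Finset.mem_range.mpr ht), h⟩

/-- The orbit of an edge under `c`, started at an extreme vertex, is a simple closed polygon to
which `sum_signedAngle_cycle` applies. -/
theorem sum_signedAngle_perm_cycle (hN : N.IsPBDTP) {c : Equiv.Perm E} (hc : c.IsCycle)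
    (hcons : ∀ f ∈ c.support, N.tgt f = N.src (c f))
    (hsrc : ∀ f ∈ c.support, ∀ g ∈ c.support, N.src f = N.src g → f = g) :
    ∃ a : ℝ, (a = 1 ∨ a = -1) ∧
      ∑ f ∈ c.support, signedAngle (N.dir f) (N.dir (c f)) = a * (2 * Real.pi) := by
  obtain ⟨a, ha, hmin⟩ := exists_re_im_min c.support
    (Finset.card_pos.mp (by have := hc.two_le_card_support; omega)) fun f => N.pos (N.src f)
  have hon : c.IsCycleOn (c.support : Set E) := by
    have := hc.isCycleOn
    rwa [← Equiv.Perm.coe_support_eq_set_support] at this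
  set f : ℕ → E := fun t => (c ^ t) a with hf
  have hmem : ∀ t, f t ∈ c.support := fun t => Equiv.Perm.pow_apply_mem_support.mpr ha
  have hsucc : ∀ t, c (f t) = f (t + 1) := fun t => by
    simp only [hf, pow_succ', Equiv.Perm.mul_apply]
  have htgt : ∀ t, N.tgt (f t) = N.src (f (t + 1)) := fun t => by
    rw [hcons _ (hmem t), hsucc]
  -- A cycle of two edges would run back along the same segment, and consecutive edges are not
  -- antiparallel. Hence there are at least three.
  obtain ⟨k, hk⟩ : ∃ k, c.support.card = k + 3 := by
    have h2 := hc.two_le_card_support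
    rcases h2.eq_or_lt with h | h
    · exfalso
      have h3 : f 2 = a := by
        have := hon.pow_card_apply ha
        rwa [← h] at this
      have h4 := hN.not_antiparallel (htgt 0) 1 one_pos
      apply h4
      have h5 := htgt 1
      simp only [Nat.reduceAdd] at h5
      rw [h3] at h5
      rw [dir, dir, zero_add, h5, htgt 0]
      simp [hf]
    · exact ⟨c.support.card - 3, by omega⟩
  have hper : f (k + 3) = a := by
    rw [← hk]; exact hon.pow_card_apply ha
  have hinj : ∀ s < k + 3, ∀ t < k + 3, N.src (f s) = N.src (f t) → s = t := by
    intro s hs t ht h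
    have h1 := (hon.pow_apply_eq_pow_apply ha).mp (hsrc _ (hmem s) _ (hmem t) h)
    rw [hk] at h1
    exact Nat.ModEq.eq_of_lt_of_lt h1 hs ht
  have hf0 : f 0 = a := rfl
  set p : ℕ → ℂ := fun t => N.pos (N.src (f t)) with hp
  have hdir : ∀ t, p (t + 1) - p t = N.dir (f t) := fun t => by
    simp only [hp, dir, htgt]
  have hp3 : p (k + 3) = p 0 := by simp only [hp, hper, hf0]
  have hpne : ∀ t, 0 < t → t ≤ k + 2 → p t ≠ p 0 := fun t ht htk h => by
    have := hinj t (by omega) 0 (by omega) (hN.pos_injective h)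
    omega
  have key := sum_signedAngle_cycle p k hp3
    (fun t _ h => hN.dir_ne_zero (f t) (by rw [← hdir t, ← h, sub_self])) hpne
    (fun t _ => by
      rw [hdir t, hdir (t + 1)]
      exact hN.signedAngle_ne_pi (htgt t))
    (by
      rw [hdir (k + 2), ← hf0] at *
      have h1 : p 1 - p 0 = N.dir (f (k + 3)) := by rw [hper]; exact hdir 0
      rw [h1]
      exact hN.signedAngle_ne_pi (htgt (k + 2)))
    (fun s t hst htk h0 => by
      -- The index of the next edge wraps around: after edge k + 2 comes edge 0.
      have hlast : ∀ t ≤ k + 2, ∃ t' < k + 3, N.tgt (f t) = N.src (f t') ∧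
          (t' = t + 1 ∨ (t = k + 2 ∧ t' = 0)) := by
        intro t ht
        rcases ht.eq_or_lt with h | h
        · refine ⟨0, by omega, ?_, Or.inr ⟨h, rfl⟩⟩
          rw [htgt, h, hper, hf0]
        · exact ⟨t + 1, by omega, htgt t, Or.inl rfl⟩
      have e1 : p (s + 1) = N.pos (N.tgt (f s)) := by simp only [hp, htgt]
      have e2 : p (t + 1) = N.pos (N.tgt (f t)) := by simp only [hp, htgt]
      rw [e1, e2]
      obtain ⟨s', hs', es, hs⟩ := hlast s (by omega)
      obtain ⟨t', ht', et, ht⟩ := hlast t htk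
      refine hN.disjoint_segment (fun h => ?_) (fun h => ?_) (fun h => ?_) (fun h => ?_)
      · have := hinj _ (by omega) _ (by omega) h
        omega
      · rw [et] at h
        have := hinj _ (by omega) _ (by omega) h
        omega
      · rw [es] at h
        have := hinj _ (by omega) _ (by omega) h
        omega
      · rw [es, et] at h
        have := hinj _ (by omega) _ (by omega) h
        omega)
    (fun t ht htk => hmin (f t) (hmem t) (hpne t ht htk))
  obtain ⟨b, hb, hsum⟩ := key
  refine ⟨b, hb, ?_⟩
  rw [← hsum, sum_support_eq_sum_range hc ha, hk, Finset.sum_range_succ]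
  congr 1
  · refine Finset.sum_congr rfl fun t _ => ?_
    rw [hdir t, hdir (t + 1), ← hsucc]
  · have h1 : p 1 - p 0 = N.dir (f (k + 3)) := by rw [hper]; exact hdir 0
    rw [hdir (k + 2), h1, ← hsucc (k + 2)]

/-- The winding number of a simple cycle is odd and its intersection number is even. -/
theorem wind_add_int_perm_cycle (hN : N.IsPBDTP) {l : ℂ} (hl : N.IsGaugeDirection l)
    {c : Equiv.Perm E} (hc : c.IsCycle) (hcons : ∀ f ∈ c.support, N.tgt f = N.src (c f))
    (hsrc : ∀ f ∈ c.support, ∀ g ∈ c.support, N.src f = N.src g → f = g) :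
    ((∑ f ∈ c.support, (localWind l (N.dir f) (N.dir (c f)) + (N.intEdge l f : ℤ)) : ℤ) : ZMod 2)
      = 1 := by
  obtain ⟨a, ha, hsum⟩ := sum_signedAngle_perm_cycle hN hc hcons hsrc
  have hreindex : ∀ {M : Type} [AddCommMonoid M] (F : E → M),
      ∑ f ∈ c.support, F (c f) = ∑ f ∈ c.support, F f := by
    intro M _ F
    refine Finset.sum_nbij c (fun f hf => Equiv.Perm.apply_mem_support.mpr hf)
      (c.injective.injOn) (fun g hg => ⟨c⁻¹ g, ?_, by simp⟩) (fun _ _ => rfl)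
    rw [Finset.mem_coe] at hg ⊢
    rw [← Equiv.Perm.apply_mem_support]
    simpa using hg
  -- Around a closed cycle the arguments with respect to `l` cancel completely, so the winding
  -- number equals the rotation number.
  have hw : 2 * Real.pi * (∑ f ∈ c.support, localWind l (N.dir f) (N.dir (c f)) : ℤ) =
      2 * Real.pi * a := by
    push_cast
    rw [Finset.mul_sum]
    calc ∑ f ∈ c.support, 2 * Real.pi * (localWind l (N.dir f) (N.dir (c f)) : ℝ)
        = ∑ f ∈ c.support, (signedAngle (N.dir f) (N.dir (c f)) +
            Complex.arg (-l⁻¹ * N.dir f) - Complex.arg (-l⁻¹ * N.dir (c f))) :=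
          Finset.sum_congr rfl fun f hf => localWind_eq (crossProd_dir_ne_zero hN hl f)
            (crossProd_dir_ne_zero hN hl _) (hN.signedAngle_ne_pi (hcons f hf))
      _ = 2 * Real.pi * a := by
          rw [Finset.sum_sub_distrib, Finset.sum_add_distrib, hsum,
            hreindex fun f => Complex.arg (-l⁻¹ * N.dir f)]
          ring
  have hw2 := mul_left_cancel₀ (by positivity) hw
  have hw3 : ((∑ f ∈ c.support, localWind l (N.dir f) (N.dir (c f)) : ℤ) : ZMod 2) = 1 := by
    rcases ha with rfl | rfl
    · have : (∑ f ∈ c.support, localWind l (N.dir f) (N.dir (c f)) : ℤ) = 1 := by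
        exact_mod_cast hw2
      rw [this]; rfl
    · have : (∑ f ∈ c.support, localWind l (N.dir f) (N.dir (c f)) : ℤ) = -1 := by
        exact_mod_cast hw2
      rw [this]; rfl
  have hi : ((∑ f ∈ c.support, (N.intEdge l f : ℤ) : ℤ) : ZMod 2) = 0 := by
    push_cast
    simp only [intEdge_cast]
    rw [Finset.sum_comm]
    refine Finset.sum_eq_zero fun i hi => ?_
    -- An edge that leaves a boundary source has no predecessor and cannot belong to the cycle. All
    -- sides are thus defined, and their sum telescopes to zero modulo two.
    have hne : ∀ f ∈ c.support, N.src f ≠ Sum.inl i := fun f hf h => by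
      have h1 : N.tgt (c⁻¹ f) = N.src (c (c⁻¹ f)) := hcons _ (by
        rw [← Equiv.Perm.apply_mem_support]; simpa using hf)
      have h2 : c (c⁻¹ f) = f := by simp
      rw [h2, h] at h1
      exact hN.tgt_ne_of_src_eq_inl h h1
    calc ∑ f ∈ c.support, (if N.MeetsRay l i f then (1 : ZMod 2) else 0)
        = ∑ f ∈ c.support, (N.raySide l i (N.src f) + N.raySide l i (N.src (c f))) :=
          Finset.sum_congr rfl fun f hf => by
            rw [meetsRay_cast hN hl (hne f hf) (hN.tgt_ne_of_mem_sources hi f), hcons f hf]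
      _ = 0 := by
          rw [Finset.sum_add_distrib, hreindex fun f => N.raySide l i (N.src f),
            add_self_zmod_two]
  rw [Finset.sum_add_distrib, Int.cast_add, hw3, hi, add_zero]

end SimpleWalks

end DiskNetwork

/-! ### Flows and permutations of the edges -/

namespace DiskNetwork

section Flows

open scoped Classical

variable {n : ℕ} {V E : Type*} [Fintype E] {N : DiskNetwork n V E}

/-- The edges `f` and `g` are consecutive, where the edge `e'` is also followed by `e`. -/
def IsStep (N : DiskNetwork n V E) (e e' f g : E) : Prop := N.tgt f = N.src g ∨ (f = e' ∧ g = e)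

/-- Permutations that send each edge that they move to a following edge. -/
def IsStepPerm (N : DiskNetwork n V E) (e e' : E) (σ : Equiv.Perm E) : Prop :=
  ∀ f ∈ σ.support, N.IsStep e e' f (σ f)

variable {e e' : E} {i j : Fin n}

theorem IsStep.eq_of_tgt (hN : N.IsPBDTP) {f g : E} (h : N.IsStep e e' f g)
    {k : Fin n} (hf : N.tgt f = Sum.inl k) : f = e' ∧ g = e := by
  rcases h with h | h
  · exact absurd hf (hN.tgt_ne_of_src_eq_inl (h ▸ hf))
  · exact h

theorem IsStep.eq_of_src (hN : N.IsPBDTP) {f g : E} (h : N.IsStep e e' f g)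
    {k : Fin n} (hg : N.src g = Sum.inl k) : f = e' ∧ g = e := by
  rcases h with h | h
  · exact absurd (h.trans hg) (hN.tgt_ne_of_src_eq_inl hg)
  · exact h

theorem ne_of_src_of_tgt (hN : N.IsPBDTP) (he : N.src e = Sum.inl i) (he' : N.tgt e' = Sum.inl j) :
    e' ≠ e := by
  rintro rfl
  obtain ⟨v, hv⟩ := hN.tgt_eq_inr_of_src he
  rw [hv] at he'
  simp at he'

theorem IsStep.ne (hN : N.IsPBDTP) (he : N.src e = Sum.inl i) (he' : N.tgt e' = Sum.inl j) {f g : E}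
    (h : N.IsStep e e' f g) : f ≠ g := by
  rintro rfl
  rcases h with h | ⟨h1, h2⟩
  · exact hN.src_ne_tgt f h.symm
  · exact ne_of_src_of_tgt hN he he' (h1.symm.trans h2)

theorem IsStepPerm.inv_step {σ : Equiv.Perm E} (hσ : N.IsStepPerm e e' σ) {g : E}
    (hg : g ∈ σ.support) : N.IsStep e e' (σ⁻¹ g) g := by
  have h1 : σ (σ⁻¹ g) = g := by simp
  have h2 := hσ (σ⁻¹ g) (by rw [← Equiv.Perm.apply_mem_support, h1]; exact hg)
  rwa [h1] at h2

theorem IsStep.tgt_eq_src (he : N.src e = Sum.inl i) {f g : E}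
    (h : N.IsStep e e' f g) {v : V} (hg : N.src g = Sum.inr v) : N.tgt f = N.src g := by
  rcases h with h | ⟨-, rfl⟩
  · exact h
  · rw [he] at hg
    simp at hg

theorem IsStep.tgt_eq_src' (he' : N.tgt e' = Sum.inl j) {f g : E}
    (h : N.IsStep e e' f g) {v : V} (hf : N.tgt f = Sum.inr v) : N.tgt f = N.src g := by
  rcases h with h | ⟨rfl, -⟩
  · exact h
  · rw [he'] at hf
    simp at hf

/-- At an internal vertex either the incoming edge or the outgoing edge is unique. In the first case
the predecessors of `f` and `g` coincide, in the second `f` and `g` do. Cycles and walks inside a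
step permutation are therefore vertex-simple. -/
theorem IsStepPerm.src_injOn (hN : N.IsPBDTP) (he : N.src e = Sum.inl i) {σ : Equiv.Perm E}
    (hσ : N.IsStepPerm e e' σ) {f g : E} (hf : f ∈ σ.support) (hg : g ∈ σ.support)
    (h : N.src f = N.src g) : f = g := by
  rcases hs : N.src f with k | v
  · exact hN.eq_of_src_eq_inl hs (h ▸ hs)
  · rcases hN.eq_or_eq_of_consecutive ((hσ.inv_step hf).tgt_eq_src he hs)
      ((hσ.inv_step hg).tgt_eq_src he (h ▸ hs)) h with h3 | h3
    · exact σ⁻¹.injective h3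
    · exact h3

theorem IsStepPerm.tgt_injOn (hN : N.IsPBDTP) (he' : N.tgt e' = Sum.inl j) {σ : Equiv.Perm E}
    (hσ : N.IsStepPerm e e' σ) {f g : E} (hf : f ∈ σ.support) (hg : g ∈ σ.support)
    (h : N.tgt f = N.tgt g) : f = g := by
  rcases hs : N.tgt f with k | v
  · exact hN.eq_of_tgt_eq_inl hs (h ▸ hs)
  · have h1 := (hσ f hf).tgt_eq_src' he' hs
    have h2 := (hσ g hg).tgt_eq_src' he' (h ▸ hs)
    rcases hN.eq_or_eq_of_consecutive h1 h2 (by rw [← h1, ← h2, h]) with h3 | h3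
    · exact h3
    · exact σ.injective h3

theorem IsStepPerm.apply_eq (hN : N.IsPBDTP) (he' : N.tgt e' = Sum.inl j) {σ : Equiv.Perm E}
    (hσ : N.IsStepPerm e e' σ) (h : e' ∈ σ.support) : σ e' = e :=
  ((hσ e' h).eq_of_tgt hN he').2

/-- Nothing follows `e'` and nothing precedes `e` in the network, so both can only be moved through
the artificial step from `e'` to `e`. -/
theorem IsStepPerm.mem_support_iff (hN : N.IsPBDTP) (he : N.src e = Sum.inl i)
    (he' : N.tgt e' = Sum.inl j) {σ : Equiv.Perm E} (hσ : N.IsStepPerm e e' σ) :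
    e ∈ σ.support ↔ e' ∈ σ.support := by
  constructor
  · intro h
    have h1 := ((hσ.inv_step h).eq_of_src hN he).1
    rw [← h1, ← Equiv.Perm.apply_mem_support]
    simpa using h
  · intro h
    have h1 := hσ.apply_eq hN he' h
    rw [← h1]
    exact Equiv.Perm.apply_mem_support.mpr h

theorem IsStepPerm.tgt_eq_src {σ : Equiv.Perm E} (hσ : N.IsStepPerm e e' σ)
    {f : E} (hf : f ∈ σ.support) (hne : f ≠ e') : N.tgt f = N.src (σ f) := by
  rcases hσ f hf with h | h
  · exact h
  · exact absurd h.1 hne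

/-- Two step permutations that move the same edges coincide. -/
theorem IsStepPerm.eq_of_support_eq (hN : N.IsPBDTP) (he : N.src e = Sum.inl i)
    (he' : N.tgt e' = Sum.inl j) {σ τ : Equiv.Perm E} (hσ : N.IsStepPerm e e' σ)
    (hτ : N.IsStepPerm e e' τ) (h : σ.support = τ.support) : σ = τ := by
  ext f
  by_cases hf : f ∈ σ.support
  · have hf' : f ∈ τ.support := h ▸ hf
    by_cases hfe : f = e'
    · subst hfe
      rw [hσ.apply_eq hN he' hf, hτ.apply_eq hN he' hf']
    · refine hσ.src_injOn hN he (Equiv.Perm.apply_mem_support.mpr hf)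
        (h ▸ Equiv.Perm.apply_mem_support.mpr hf') ?_
      rw [← hσ.tgt_eq_src hf hfe, ← hτ.tgt_eq_src hf' hfe]
  · have hf' : f ∉ τ.support := h ▸ hf
    rw [Equiv.Perm.notMem_support.mp hf, Equiv.Perm.notMem_support.mp hf']

theorem IsStepPerm.arrive_eq_leave (he : N.src e = Sum.inl i)
    (he' : N.tgt e' = Sum.inl j) {σ : Equiv.Perm E} (hσ : N.IsStepPerm e e' σ) (v : V) :
    N.arrive σ.support (Sum.inr v) = N.leave σ.support (Sum.inr v) := by
  refine Finset.card_nbij σ (fun f hf => ?_) σ.injective.injOn (fun g hg => ?_)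
  · rw [Finset.mem_coe, Finset.mem_filter] at hf ⊢
    exact ⟨Equiv.Perm.apply_mem_support.mpr hf.1, by
      rw [← (hσ f hf.1).tgt_eq_src' he' hf.2, hf.2]⟩
  · rw [Finset.mem_coe, Finset.mem_filter] at hg
    refine ⟨σ⁻¹ g, ?_, by simp⟩
    rw [Finset.mem_coe, Finset.mem_filter]
    refine ⟨?_, by rw [(hσ.inv_step hg.1).tgt_eq_src he hg.2, hg.2]⟩
    rw [← Equiv.Perm.apply_mem_support]
    simpa using hg.1

theorem IsStepPerm.isConservativeFlow (hN : N.IsPBDTP) (he : N.src e = Sum.inl i)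
    (he' : N.tgt e' = Sum.inl j) {σ : Equiv.Perm E} (hσ : N.IsStepPerm e e' σ)
    (h : e' ∉ σ.support) : N.IsConservativeFlow σ.support := by
  refine ⟨hσ.arrive_eq_leave he he', fun f hf k => ⟨fun hs => ?_, fun ht => ?_⟩⟩
  · obtain ⟨-, rfl⟩ := (hσ.inv_step hf).eq_of_src hN hs
    exact h ((hσ.mem_support_iff hN he he').mp hf)
  · obtain ⟨rfl, -⟩ := (hσ f hf).eq_of_tgt hN ht
    exact h hf

/-- As `e` starts at a univalent boundary source, the imbalance at its initial vertex is automatic,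
and the boundary conditions say that `e` and `e'` are the only boundary edges of the flow. -/
theorem isEdgeFlow_iff (hN : N.IsPBDTP) (he : N.src e = Sum.inl i) (he' : N.tgt e' = Sum.inl j)
    {F : Finset E} : N.IsEdgeFlow e j F ↔ e ∈ F ∧ e' ∈ F ∧
      (∀ v, N.arrive F (Sum.inr v) = N.leave F (Sum.inr v)) ∧
      ∀ f ∈ F, ∀ k, (N.src f = Sum.inl k → f = e) ∧ (N.tgt f = Sum.inl k → f = e') := by
  constructor
  · rintro ⟨h1, h2, -, ⟨g, hg, hgj⟩, h5⟩
    obtain rfl := hN.eq_of_tgt_eq_inl hgj he'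
    refine ⟨h1, hg, fun v => h2 v (by simp [he]), fun f hf k => ⟨fun hs => ?_, fun ht => ?_⟩⟩
    · exact hN.eq_of_src_eq_inl hs ((h5 f hf k).1 hs)
    · obtain rfl := (h5 f hf k).2 ht
      exact hN.eq_of_tgt_eq_inl ht he'
  · rintro ⟨h1, h2, h3, h4⟩
    refine ⟨h1, fun v _ => h3 v, ?_, ⟨e', h2, he'⟩, fun f hf k => ⟨fun hs => ?_, fun ht => ?_⟩⟩
    · rw [he]
      have h5 : N.arrive F (Sum.inl i) = 0 := by
        rw [arrive, Finset.card_eq_zero, Finset.filter_eq_empty_iff]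
        exact fun g _ => hN.tgt_ne_of_src_eq_inl he
      have h6 : N.leave F (Sum.inl i) = 1 := by
        rw [leave, Finset.card_eq_one]
        refine ⟨e, Finset.eq_singleton_iff_unique_mem.mpr ⟨by simp [h1, he], fun g hg => ?_⟩⟩
        exact hN.eq_of_src_eq_inl (Finset.mem_filter.mp hg).2 he
      rw [h5, h6]
    · rw [← (h4 f hf k).1 hs, hs]
    · have h5 := (h4 f hf k).2 ht
      rw [h5, he'] at ht
      exact (Sum.inl.inj ht).symm

theorem IsStepPerm.isEdgeFlow (hN : N.IsPBDTP) (he : N.src e = Sum.inl i)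
    (he' : N.tgt e' = Sum.inl j) {σ : Equiv.Perm E} (hσ : N.IsStepPerm e e' σ)
    (h : e' ∈ σ.support) : N.IsEdgeFlow e j σ.support :=
  (isEdgeFlow_iff hN he he').mpr ⟨(hσ.mem_support_iff hN he he').mpr h, h,
    hσ.arrive_eq_leave he he', fun f hf _ => ⟨fun hs => ((hσ.inv_step hf).eq_of_src hN hs).2,
      fun ht => ((hσ f hf).eq_of_tgt hN ht).1⟩⟩

/-- A balanced set of edges is the set of edges moved by a step permutation. -/
theorem exists_isStepPerm (hN : N.IsPBDTP) (he : N.src e = Sum.inl i)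
    (he' : N.tgt e' = Sum.inl j) {F : Finset E}
    (hF : ∀ v, N.arrive F (Sum.inr v) = N.leave F (Sum.inr v))
    (hFt : ∀ f ∈ F, ∀ k, N.tgt f = Sum.inl k → f = e' ∧ e ∈ F) :
    ∃ σ : Equiv.Perm E, N.IsStepPerm e e' σ ∧ σ.support = F := by
  have hstep : ∀ f : F, ∃ g : F, N.IsStep e e' f g := by
    rintro ⟨f, hf⟩
    rcases ht : N.tgt f with k | v
    · obtain ⟨h1, h2⟩ := hFt f hf k ht
      exact ⟨⟨e, h2⟩, Or.inr ⟨h1, rfl⟩⟩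
    · have h1 : 0 < N.arrive F (Sum.inr v) := Finset.card_pos.mpr ⟨f, by simp [hf, ht]⟩
      rw [hF] at h1
      obtain ⟨g, hg⟩ := Finset.card_pos.mp h1
      rw [Finset.mem_filter] at hg
      exact ⟨⟨g, hg.1⟩, Or.inl (ht.trans hg.2.symm)⟩
  choose s hs using hstep
  -- If the vertex has one outgoing edge, the balance allows `F` at most one incoming edge there;
  -- otherwise its incoming edge is unique anyway.
  have hinj : Function.Injective s := by
    intro f f' h
    have h1 := hs f
    have h2 := hs f'
    rw [← h] at h2
    rcases hg : N.src (s f : E) with k | v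
    · exact Subtype.ext ((h1.eq_of_src hN hg).1.trans (h2.eq_of_src hN hg).1.symm)
    · have t1 := (h1.tgt_eq_src he hg).trans hg
      have t2 := (h2.tgt_eq_src he hg).trans hg
      apply Subtype.ext
      rcases hN.perfect v with h4 | h4
      · exact Finset.card_le_one.mp h4.le _ (by simp [t1]) _ (by simp [t2])
      · have h5 : N.arrive F (Sum.inr v) ≤ 1 := by
          rw [hF, ← h4]
          exact Finset.card_le_card (Finset.filter_subset_filter _ (Finset.subset_univ _))
        exact Finset.card_le_one.mp h5 _ (by simp [t1]) _ (by simp [t2])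
  set σ := Equiv.Perm.ofSubtype (Equiv.ofBijective s (Finite.injective_iff_bijective.mp hinj))
    with hσ
  have happly : ∀ f (hf : f ∈ F), σ f = s ⟨f, hf⟩ := fun f hf => by
    rw [hσ, Equiv.Perm.ofSubtype_apply_of_mem _ hf]
    rfl
  have hsupp : σ.support = F := by
    ext f
    rw [Equiv.Perm.mem_support]
    constructor
    · intro h
      by_contra hf
      exact h (Equiv.Perm.ofSubtype_apply_of_not_mem _ hf)
    · intro hf
      rw [happly f hf]
      exact ((hs ⟨f, hf⟩).ne hN he he').symm
  refine ⟨σ, fun f hf => ?_, hsupp⟩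
  rw [hsupp] at hf
  rw [happly f hf]
  exact hs ⟨f, hf⟩

theorem exists_isStepPerm_of_isConservativeFlow (hN : N.IsPBDTP) (he : N.src e = Sum.inl i)
    (he' : N.tgt e' = Sum.inl j) {C : Finset E} (hC : N.IsConservativeFlow C) :
    ∃ σ : Equiv.Perm E, N.IsStepPerm e e' σ ∧ σ.support = C :=
  exists_isStepPerm hN he he' hC.1 fun f hf k ht => absurd ht (hC.2 f hf k).2

theorem exists_isStepPerm_of_isEdgeFlow (hN : N.IsPBDTP) (he : N.src e = Sum.inl i)
    (he' : N.tgt e' = Sum.inl j) {F : Finset E} (hF : N.IsEdgeFlow e j F) :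
    ∃ σ : Equiv.Perm E, N.IsStepPerm e e' σ ∧ σ.support = F := by
  obtain ⟨h1, h2, h3, h4⟩ := (isEdgeFlow_iff hN he he').mp hF
  exact exists_isStepPerm hN he he' h3 fun f hf k ht => ⟨(h4 f hf k).2 ht, h1⟩

/-! #### The walk along a cycle -/

/-- The list of the first `m` edges of the orbit of `e` under `c`. -/
def orbitWalk (c : Equiv.Perm E) (e : E) (m : ℕ) : List E := (List.range m).map fun t => (c ^ t) e

theorem mem_orbitWalk {c : Equiv.Perm E} (hc : c.IsCycle) (he : e ∈ c.support) (f : E) :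
    f ∈ orbitWalk c e c.support.card ↔ f ∈ c.support := by
  have hon : c.IsCycleOn (c.support : Set E) := by
    have := hc.isCycleOn
    rwa [← Equiv.Perm.coe_support_eq_set_support] at this
  simp only [orbitWalk, List.mem_map, List.mem_range]
  constructor
  · rintro ⟨t, -, rfl⟩
    exact Equiv.Perm.pow_apply_mem_support.mpr he
  · intro hf
    exact hon.exists_pow_eq he hf

theorem nodup_orbitWalk {c : Equiv.Perm E} (hc : c.IsCycle) (he : e ∈ c.support) :
    (orbitWalk c e c.support.card).Nodup := by
  have hon : c.IsCycleOn (c.support : Set E) := by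
    have := hc.isCycleOn
    rwa [← Equiv.Perm.coe_support_eq_set_support] at this
  refine List.Nodup.map_on (fun s hs t ht h => ?_) List.nodup_range
  exact Nat.ModEq.eq_of_lt_of_lt ((hon.pow_apply_eq_pow_apply he).mp h) (List.mem_range.mp hs)
    (List.mem_range.mp ht)

theorem pow_card_pred_apply {c : Equiv.Perm E} (hc : c.IsCycle) (he' : e' ∈ c.support)
    (hce : c e' = e) {m : ℕ} (hm : c.support.card = m + 1) : (c ^ m) e = e' := by
  have hon : c.IsCycleOn (c.support : Set E) := by
    have := hc.isCycleOn
    rwa [← Equiv.Perm.coe_support_eq_set_support] at this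
  have h := hon.pow_card_apply he'
  rw [hm, pow_succ, Equiv.Perm.mul_apply, hce] at h
  exact h

/-- The only step of the cycle that is not a genuine one is the step from `e'` to `e`. Listing the
orbit from `e` places it after the last edge, so cutting there leaves a directed path. -/
theorem isWalk_orbitWalk (hN : N.IsPBDTP) (he : N.src e = Sum.inl i)
    (he' : N.tgt e' = Sum.inl j) {c : Equiv.Perm E} (hc : c.IsCycle) (hcs : N.IsStepPerm e e' c)
    (hmem : e' ∈ c.support) : N.IsWalk e j (orbitWalk c e c.support.card) := by
  have hmem' := (hcs.mem_support_iff hN he he').mpr hmem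
  have hce := hcs.apply_eq hN he' hmem
  obtain ⟨m, hm⟩ : ∃ m, c.support.card = m + 1 :=
    ⟨c.support.card - 1, by have := hc.two_le_card_support; omega⟩
  have hlast := pow_card_pred_apply hc hmem hce hm
  have hnd := nodup_orbitWalk hc hmem'
  rw [hm] at hnd ⊢
  refine ⟨?_, ?_, e', ?_, he'⟩
  · simp [orbitWalk, List.range_succ_eq_map]
  · rw [List.isChain_iff_getElem]
    intro t ht
    simp only [orbitWalk, List.length_map, List.length_range] at ht
    simp only [orbitWalk, List.getElem_map, List.getElem_range]
    rw [hcs.tgt_eq_src (Equiv.Perm.pow_apply_mem_support.mpr hmem'), pow_succ',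
      Equiv.Perm.mul_apply]
    intro h
    rw [← hlast] at h
    have h1 := List.inj_on_of_nodup_map hnd (List.mem_range.mpr (by omega : t < m + 1))
      (List.mem_range.mpr (by omega : m < m + 1)) h
    omega
  · simp [orbitWalk, List.range_succ, hlast]

theorem wind_map_range (l : ℂ) (f : ℕ → E) (m : ℕ) :
    N.wind l ((List.range (m + 1)).map f) =
      ∑ t ∈ Finset.range m, localWind l (N.dir (f t)) (N.dir (f (t + 1))) := by
  induction m generalizing f with
  | zero => simp [wind]
  | succ m ih =>
    have h1 : (List.range (m + 2)).map f =
        f 0 :: f 1 :: (List.range m).map fun t => f (t + 2) := by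
      simp [List.range_succ_eq_map, Function.comp_def]
    have h2 : (List.range (m + 1)).map (fun t => f (t + 1)) =
        f 1 :: (List.range m).map fun t => f (t + 2) := by
      simp [List.range_succ_eq_map, Function.comp_def]
    have h3 := ih fun t => f (t + 1)
    rw [h2] at h3
    rw [h1, Finset.sum_range_succ', add_comm, ← h3]
    rfl

/-- The summand at `e'` loses its winding because the walk ends there and does not turn back to `e`.
-/
theorem wind_add_int_orbitWalk (l : ℂ) {c : Equiv.Perm E} (hc : c.IsCycle)
    (hmem : e' ∈ c.support) (hmem' : e ∈ c.support) (hce : c e' = e) :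
    N.wind l (orbitWalk c e c.support.card) + (N.intWalk l (orbitWalk c e c.support.card) : ℤ) =
      ∑ f ∈ c.support, ((if f = e' then 0 else localWind l (N.dir f) (N.dir (c f))) +
        (N.intEdge l f : ℤ)) := by
  obtain ⟨m, hm⟩ : ∃ m, c.support.card = m + 1 :=
    ⟨c.support.card - 1, by have := hc.two_le_card_support; omega⟩
  have hlast := pow_card_pred_apply hc hmem hce hm
  have hnd := nodup_orbitWalk hc hmem'
  rw [hm] at hnd
  rw [Finset.sum_add_distrib, sum_support_eq_sum_range hc hmem',
    sum_support_eq_sum_range hc hmem', hm, orbitWalk, wind_map_range, Finset.sum_range_succ,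
    if_pos hlast, add_zero]
  congr 1
  · refine Finset.sum_congr rfl fun t ht => ?_
    rw [if_neg, pow_succ', Equiv.Perm.mul_apply]
    intro h
    rw [← hlast] at h
    have ht := Finset.mem_range.mp ht
    have h1 := List.inj_on_of_nodup_map hnd (List.mem_range.mpr (by omega : t < m + 1))
      (List.mem_range.mpr (by omega : m < m + 1)) h
    omega
  · rw [intWalk, List.map_map, ← Nat.cast_sum]
    congr 1

/-! #### Edge flows contain a unique walk -/

/-- Inside `F` the next edge is forced at every vertex, and a walk cannot continue beyond a boundary
sink. -/
theorem IsWalk.eq_of_subset (hN : N.IsPBDTP) {F : Finset E}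
    (hF : ∀ f ∈ F, ∀ g ∈ F, N.src f = N.src g → f = g) (P : List E) :
    ∀ (P' : List E) (e : E), N.IsWalk e j P → N.IsWalk e j P' → (∀ f ∈ P, f ∈ F) →
      (∀ f ∈ P', f ∈ F) → P = P' := by
  induction P with
  | nil => intro P' e h; simp [IsWalk] at h
  | cons f P ih =>
    intro P' e h h' hP hP'
    obtain ⟨Q, hQ⟩ := h.exists_eq_cons
    obtain ⟨rfl, rfl⟩ := List.cons_eq_cons.mp hQ
    obtain ⟨Q', rfl⟩ := h'.exists_eq_cons
    rcases P with _ | ⟨g, P⟩ <;> rcases Q' with _ | ⟨g', Q'⟩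
    · rfl
    · have h1 := h.getLast_eq (by simp)
      have h2 := (isWalk_cons_cons.mp h').1
      exact absurd h1 (hN.tgt_ne_of_src_eq_inl (h2.symm.trans h1))
    · have h1 := h'.getLast_eq (by simp)
      have h2 := (isWalk_cons_cons.mp h).1
      exact absurd h1 (hN.tgt_ne_of_src_eq_inl (h2.symm.trans h1))
    · obtain ⟨h1, h2⟩ := isWalk_cons_cons.mp h
      obtain ⟨h1', h2'⟩ := isWalk_cons_cons.mp h'
      obtain rfl : g = g' := hF g (hP g (by simp)) g' (hP' g' (by simp)) (h1.symm.trans h1')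
      rw [ih (g :: Q') g h2 h2' (fun x hx => hP x (List.mem_cons_of_mem _ hx))
        (fun x hx => hP' x (List.mem_cons_of_mem _ hx))]

theorem arrive_sdiff {F G : Finset E} (h : G ⊆ F) (x : Fin n ⊕ V) :
    N.arrive (F \ G) x = N.arrive F x - N.arrive G x := by
  rw [arrive, Finset.sdiff_eq_filter, Finset.filter_filter, arrive, arrive,
    ← Finset.card_sdiff_of_subset (Finset.filter_subset_filter _ h)]
  congr 1
  ext f
  simp only [Finset.mem_filter, Finset.mem_sdiff]
  tauto

theorem leave_sdiff {F G : Finset E} (h : G ⊆ F) (x : Fin n ⊕ V) :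
    N.leave (F \ G) x = N.leave F x - N.leave G x := by
  rw [leave, Finset.sdiff_eq_filter, Finset.filter_filter, leave, leave,
    ← Finset.card_sdiff_of_subset (Finset.filter_subset_filter _ h)]
  congr 1
  ext f
  simp only [Finset.mem_filter, Finset.mem_sdiff]
  tauto

theorem IsStepPerm.cycleOf {σ : Equiv.Perm E} (hσ : N.IsStepPerm e e' σ) (f : E) :
    N.IsStepPerm e e' (σ.cycleOf f) := by
  intro g hg
  have h1 := (Equiv.Perm.mem_support_cycleOf_iff.mp hg).1
  rw [h1.cycleOf_apply]
  exact hσ g (Equiv.Perm.support_cycleOf_le σ f hg)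

/-- The flow is the support of a step permutation. Its cycle through `e`, cut at the artificial
step, is the walk; the other cycles form the conservative flow. -/
theorem existsUnique_isFlowWalk (hN : N.IsPBDTP) (he : N.src e = Sum.inl i)
    (he' : N.tgt e' = Sum.inl j) {F : Finset E} (hF : N.IsEdgeFlow e j F) :
    ∃! P, N.IsFlowWalk e j F P := by
  obtain ⟨σ, hσ, rfl⟩ := exists_isStepPerm_of_isEdgeFlow hN he he' hF
  obtain ⟨hmem, hmem', hbal, hbd⟩ := (isEdgeFlow_iff hN he he').mp hF
  set c := σ.cycleOf e with hc
  have hcyc : c.IsCycle := Equiv.Perm.isCycle_cycleOf σ (Equiv.Perm.mem_support.mp hmem)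
  have hcs : N.IsStepPerm e e' c := hσ.cycleOf e
  have hle : c.support ⊆ σ.support := Equiv.Perm.support_cycleOf_le σ e
  have hec : e ∈ c.support := Equiv.Perm.mem_support_cycleOf_iff.mpr ⟨Equiv.Perm.SameCycle.rfl, hmem⟩
  have hec' : e' ∈ c.support := (hcs.mem_support_iff hN he he').mp hec
  have hP : (orbitWalk c e c.support.card).toFinset = c.support := by
    ext f
    rw [List.mem_toFinset, mem_orbitWalk hcyc hec]
  refine ⟨orbitWalk c e c.support.card, ⟨isWalk_orbitWalk hN he he' hcyc hcs hec',
    nodup_orbitWalk hcyc hec, σ.support \ c.support, ⟨fun v => ?_, fun f hf k => ?_⟩, ?_, ?_⟩, ?_⟩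
  · rw [arrive_sdiff hle, leave_sdiff hle, hbal, hcs.arrive_eq_leave he he']
  · obtain ⟨h1, h2⟩ := Finset.mem_sdiff.mp hf
    exact ⟨fun hs => h2 ((hbd f h1 k).1 hs ▸ hec), fun ht => h2 ((hbd f h1 k).2 ht ▸ hec')⟩
  · rw [hP]; exact Finset.disjoint_sdiff
  · rw [hP, Finset.union_sdiff_of_subset hle]
  · rintro P ⟨hPw, -, C, -, -, hPC⟩
    refine IsWalk.eq_of_subset hN (fun f hf g hg => hσ.src_injOn hN he hf hg) P _ e hPw
      (isWalk_orbitWalk hN he he' hcyc hcs hec') (fun f hf => ?_) (fun f hf => ?_)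
    · rw [hPC]
      exact Finset.mem_union_left _ (List.mem_toFinset.mpr hf)
    · exact hle ((mem_orbitWalk hcyc hec f).mp hf)

/-- Initial and final vertices are injective on the whole support, hence on the walk, which is
therefore simple. -/
theorem windFlow_add_intFlow (hN : N.IsPBDTP) {l : ℂ} (hl : N.IsGaugeDirection l)
    (he : N.src e = Sum.inl i) (hj : j ∉ N.sources) (he' : N.tgt e' = Sum.inl j) {F : Finset E}
    (hF : N.IsEdgeFlow e j F) :
    N.windFlow l e j F + (N.intFlow l e j F : ℤ) ≡ (N.sourcesBetween i j : ℤ) [ZMOD 2] := by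
  have hex := (existsUnique_isFlowWalk hN he he' hF).exists
  obtain ⟨σ, hσ, hσF⟩ := exists_isStepPerm_of_isEdgeFlow hN he he' hF
  have hP : N.IsFlowWalk e j F (N.flowWalk e j F) := by
    rw [flowWalk, dif_pos hex]
    exact hex.choose_spec
  obtain ⟨hw, hnd, C, -, -, hPC⟩ := hP
  have hsub : ∀ f ∈ N.flowWalk e j F, f ∈ σ.support := fun f hf => by
    rw [hσF, hPC]
    exact Finset.mem_union_left _ (List.mem_toFinset.mpr hf)
  exact wind_parity_simple hN hl he hj hw hnd
    (fun f hf g hg => hσ.src_injOn hN he (hsub f hf) (hsub g hg))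
    (fun f hf g hg => hσ.tgt_injOn hN he' (hsub f hf) (hsub g hg))

end Flows

end DiskNetwork

/-! ### Series over walks -/

section WalkSeries

open scoped Classical

variable {E : Type*}

theorem walkSeries_congr {W W' : List E → Prop} {s s' : List E → ℝ} (hW : ∀ P, W P ↔ W' P)
    (hs : ∀ P, W P → s P = s' P) : walkSeries W s = walkSeries W' s' := by
  obtain rfl : W = W' := funext fun P => propext (hW P)
  funext m
  exact finsum_mem_congr rfl fun P hP => hs P hP.1

theorem walkSeries_const_mul (W : List E → Prop) (s : List E → ℝ) (a : ℝ) :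
    walkSeries W (fun P => a * s P) = MvPowerSeries.C a * walkSeries W s := by
  ext m
  rw [MvPowerSeries.coeff_C_mul]
  exact (mul_finsum_mem _ _).symm

theorem walkSeries_or {W W' : List E → Prop} (s : List E → ℝ) (h : ∀ P, W P → ¬ W' P) :
    walkSeries (fun P => W P ∨ W' P) s = walkSeries W s + walkSeries W' s := by
  funext m
  have h1 : {P : List E | (W P ∨ W' P) ∧ Multiset.toFinsupp (P : Multiset E) = m} =
      {P : List E | W P ∧ Multiset.toFinsupp (P : Multiset E) = m} ∪
      {P : List E | W' P ∧ Multiset.toFinsupp (P : Multiset E) = m} := by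
    ext P
    simp only [Set.mem_ofPred_eq, Set.mem_union]
    tauto
  have h2 : Disjoint {P : List E | W P ∧ Multiset.toFinsupp (P : Multiset E) = m}
      {P : List E | W' P ∧ Multiset.toFinsupp (P : Multiset E) = m} :=
    Set.disjoint_left.mpr fun P hP hP' => h P hP.1 hP'.1
  rw [walkSeries, h1, finsum_mem_union h2 (walkSeries_finite W m) (walkSeries_finite W' m)]
  rfl

theorem walkSeries_exists {ι : Type*} (t : Finset ι) {W : ι → List E → Prop} (s : List E → ℝ)
    (h : ∀ a b P, W a P → W b P → a = b) :
    walkSeries (fun P => ∃ a ∈ t, W a P) s = ∑ a ∈ t, walkSeries (W a) s := by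
  induction t using Finset.induction_on with
  | empty =>
    funext m
    simp [walkSeries]
    rfl
  | insert a t ha ih =>
    rw [Finset.sum_insert ha, ← ih, ← walkSeries_or]
    · exact walkSeries_congr (fun P => by simp) fun _ _ => rfl
    · rintro P h1 ⟨b, hb, h2⟩
      exact ha (h a b P h1 h2 ▸ hb)

theorem walkSeries_nil (s : List E → ℝ) :
    walkSeries (fun P => P = []) s = MvPowerSeries.C (s []) := by
  ext m
  rw [MvPowerSeries.coeff_C]
  split_ifs with h
  · have h1 : {P : List E | P = [] ∧ Multiset.toFinsupp (P : Multiset E) = m} = {[]} := by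
      ext P
      simp only [Set.mem_ofPred_eq, Set.mem_singleton_iff, and_iff_left_iff_imp]
      rintro rfl
      simp [h]
    change ∑ᶠ P ∈ {P : List E | P = [] ∧ Multiset.toFinsupp (P : Multiset E) = m}, s P = _
    rw [h1, finsum_mem_singleton]
  · have h1 : {P : List E | P = [] ∧ Multiset.toFinsupp (P : Multiset E) = m} = ∅ := by
      rw [Set.eq_empty_iff_forall_notMem]
      rintro P ⟨rfl, h2⟩
      exact h (by simpa using h2.symm)
    change ∑ᶠ P ∈ {P : List E | P = [] ∧ Multiset.toFinsupp (P : Multiset E) = m}, s P = _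
    rw [h1, finsum_mem_empty]

/-- Prefixing `f` shifts the exponent by one in the variable of `f`, which is a bijection onto the
lists counted on the left. -/
theorem walkSeries_cons (f : E) (W : List E → Prop) (s : List E → ℝ) :
    walkSeries (fun P => ∃ Q, P = f :: Q ∧ W Q) s =
      MvPowerSeries.X f * walkSeries W (fun Q => s (f :: Q)) := by
  ext m
  have hX : (MvPowerSeries.X f : MvPowerSeries E ℝ) =
    MvPowerSeries.monomial (Finsupp.single f 1) 1 := rfl
  have hcons : ∀ Q : List E, Multiset.toFinsupp ((f :: Q : List E) : Multiset E) =
      Finsupp.single f 1 + Multiset.toFinsupp (Q : Multiset E) := fun Q => by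
    rw [← Multiset.cons_coe, ← Multiset.singleton_add, map_add, Multiset.toFinsupp_singleton]
  rw [hX, MvPowerSeries.coeff_monomial_mul]
  change ∑ᶠ P ∈ {P : List E | (∃ Q, P = f :: Q ∧ W Q) ∧
    Multiset.toFinsupp (P : Multiset E) = m}, s P = _
  split_ifs with h
  · have h1 : {P : List E | (∃ Q, P = f :: Q ∧ W Q) ∧ Multiset.toFinsupp (P : Multiset E) = m} =
        (List.cons f) '' {Q : List E | W Q ∧
          Multiset.toFinsupp (Q : Multiset E) = m - Finsupp.single f 1} := by
      ext P
      simp only [Set.mem_ofPred_eq, Set.mem_image]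
      constructor
      · rintro ⟨⟨Q, rfl, hQ⟩, h2⟩
        rw [hcons] at h2
        exact ⟨Q, ⟨hQ, by rw [← h2, add_tsub_cancel_left]⟩, rfl⟩
      · rintro ⟨Q, ⟨hQ, h2⟩, rfl⟩
        exact ⟨⟨Q, rfl, hQ⟩, by rw [hcons, h2, add_tsub_cancel_of_le h]⟩
    rw [h1, finsum_mem_image (List.cons_injective.injOn), one_mul]
    rfl
  · have h1 : {P : List E | (∃ Q, P = f :: Q ∧ W Q) ∧
        Multiset.toFinsupp (P : Multiset E) = m} = ∅ := by
      rw [Set.eq_empty_iff_forall_notMem]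
      rintro P ⟨⟨Q, rfl, -⟩, h2⟩
      rw [hcons] at h2
      exact h (h2 ▸ le_self_add)
    rw [h1, finsum_mem_empty]

end WalkSeries

/-! ### Linear relations between the edge series -/

namespace DiskNetwork

section EdgeSeries

open scoped Classical

variable {n : ℕ} {V E : Type*} [Fintype E] {N : DiskNetwork n V E}

theorem isWalk_iff {f : E} {j : Fin n} (P : List E) : N.IsWalk f j P ↔
    (∃ Q, P = f :: Q ∧ (Q = [] ∧ N.tgt f = Sum.inl j ∨
      ∃ g ∈ Finset.univ.filter (fun g => N.tgt f = N.src g), N.IsWalk g j Q)) := by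
  constructor
  · intro h
    obtain ⟨Q, rfl⟩ := h.exists_eq_cons
    refine ⟨Q, rfl, ?_⟩
    rcases Q with _ | ⟨g, Q⟩
    · exact Or.inl ⟨rfl, h.getLast_eq (by simp)⟩
    · obtain ⟨h1, h2⟩ := isWalk_cons_cons.mp h
      exact Or.inr ⟨g, by simp [h1], h2⟩
  · rintro ⟨Q, rfl, ⟨rfl, h⟩ | ⟨g, hg, h⟩⟩
    · simp [IsWalk, h]
    · obtain ⟨Q, rfl⟩ := h.exists_eq_cons
      exact isWalk_cons_cons.mpr ⟨(Finset.mem_filter.mp hg).2, h⟩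

/-- The sign of a walk. -/
noncomputable def walkSign (N : DiskNetwork n V E) (l : ℂ) (P : List E) : ℝ :=
  (-1 : ℝ) ^ (N.wind l P + (N.intWalk l P : ℤ))

theorem walkSign_cons_cons (l : ℂ) (f g : E) (P : List E) : N.walkSign l (f :: g :: P) =
    (-1 : ℝ) ^ (localWind l (N.dir f) (N.dir g) + (N.intEdge l f : ℤ)) *
      N.walkSign l (g :: P) := by
  have h1 : N.wind l (f :: g :: P) =
    localWind l (N.dir f) (N.dir g) + N.wind l (g :: P) := rfl
  have h2 : N.intWalk l (f :: g :: P) = N.intEdge l f + N.intWalk l (g :: P) := by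
    simp [intWalk]
  rw [walkSign, walkSign, h1, h2, ← zpow_add₀ (by norm_num)]
  congr 1
  push_cast
  ring

/-- The linear relations at the vertices. -/
theorem edgeSeries_eq (l : ℂ) (f : E) (j : Fin n) : N.edgeSeries l f j =
    (∑ g, if N.tgt f = N.src g then MvPowerSeries.C ((-1 : ℝ) ^
        (localWind l (N.dir f) (N.dir g) + (N.intEdge l f : ℤ))) * MvPowerSeries.X f *
        N.edgeSeries l g j else 0) +
      if N.tgt f = Sum.inl j then
        MvPowerSeries.C ((-1 : ℝ) ^ (N.intEdge l f : ℤ)) * MvPowerSeries.X f else 0 := by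
  -- A walk from `f` either ends with `f` or continues as a walk from a following edge.
  have h1 : N.edgeSeries l f j = MvPowerSeries.X f * walkSeries (fun Q =>
      (Q = [] ∧ N.tgt f = Sum.inl j ∨
      ∃ g ∈ Finset.univ.filter (fun g => N.tgt f = N.src g), N.IsWalk g j Q))
      (fun Q => N.walkSign l (f :: Q)) := by
    rw [← walkSeries_cons]
    exact walkSeries_congr isWalk_iff fun _ _ => rfl
  rw [h1, walkSeries_or, walkSeries_exists, mul_add, add_comm, Finset.mul_sum,
    Finset.sum_filter]
  · congr 1
    · refine Finset.sum_congr rfl fun g _ => ?_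
      split_ifs with h
      · have h2 : walkSeries (N.IsWalk g j) (fun Q => N.walkSign l (f :: Q)) =
            MvPowerSeries.C ((-1 : ℝ) ^ (localWind l (N.dir f) (N.dir g) + (N.intEdge l f : ℤ))) *
            N.edgeSeries l g j := by
          rw [edgeSeries, ← walkSeries_const_mul]
          refine walkSeries_congr (fun _ => Iff.rfl) fun Q hQ => ?_
          obtain ⟨Q, rfl⟩ := hQ.exists_eq_cons
          exact walkSign_cons_cons l f g Q
        rw [h2]
        ring
      · rfl
    · split_ifs with h
      · have h2 : walkSeries (fun Q => Q = [] ∧ N.tgt f = Sum.inl j)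
            (fun Q => N.walkSign l (f :: Q)) = MvPowerSeries.C (N.walkSign l [f]) := by
          rw [← walkSeries_nil (fun Q => N.walkSign l (f :: Q))]
          exact walkSeries_congr (fun Q => by simp [h]) fun _ _ => rfl
        rw [h2, mul_comm]
        simp [walkSign, wind, intWalk]
      · have h2 : walkSeries (fun Q => Q = [] ∧ N.tgt f = Sum.inl j)
            (fun Q => N.walkSign l (f :: Q)) = 0 := by
          funext m
          simp [walkSeries, h]
          rfl
        rw [h2, mul_zero]
  · intro a b P ha hb
    have h2 := ha.1
    rw [hb.1] at h2
    exact (Option.some.inj h2).symm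
  · rintro Q ⟨rfl, -⟩ ⟨g, -, hg⟩
    simp [IsWalk] at hg

end EdgeSeries

end DiskNetwork

/-! ### The determinant of the linear relations -/

theorem prod_neg_one_zpow {α : Type*} (s : Finset α) (k : α → ℤ) :
    ∏ a ∈ s, (-1 : ℤˣ) ^ k a = (-1 : ℤˣ) ^ ∑ a ∈ s, k a := by
  classical
  induction s using Finset.induction_on with
  | empty => simp
  | insert a s ha ih => rw [Finset.prod_insert ha, Finset.sum_insert ha, zpow_add, ih]

theorem neg_one_zpow_congr_of_zmod {G : Type*} [DivisionRing G] {a b : ℤ}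
    (h : (a : ZMod 2) = (b : ZMod 2)) : (-1 : G) ^ a = (-1 : G) ^ b := by
  have h1 : Even (b - a) :=
    (even_iff_two_dvd.mpr (Int.modEq_iff_dvd.mp ((ZMod.intCast_eq_intCast_iff a b 2).mp h)))
  have h2 : b = a + (b - a) := by ring
  rw [h2, zpow_add₀ (by simp), h1.neg_one_zpow, mul_one]

theorem C_neg_one_zpow {E : Type*} (k : ℤ) : (MvPowerSeries.C ((-1 : ℝ) ^ k) : MvPowerSeries E ℝ) =
    (((-1 : ℤˣ) ^ k : ℤˣ) : ℤ) := by
  rcases Int.even_or_odd k with h | h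
  · simp [h.neg_one_zpow]
  · simp [h.neg_one_zpow]

namespace DiskNetwork

section Determinant

open scoped Classical

variable {n : ℕ} {V E : Type*} [Fintype E] {N : DiskNetwork n V E} {e e' : E} {i j : Fin n}

/-- The exponent of the sign of a pair of consecutive edges. -/
noncomputable def stepExponent (N : DiskNetwork n V E) (l : ℂ) (i j : Fin n) (e' f g : E) : ℤ :=
  if f = e' then (N.sourcesBetween i j : ℤ) + N.intEdge l f
  else 1 + localWind l (N.dir f) (N.dir g) + N.intEdge l f

/-- For a genuine cycle, wind + int is odd and every edge adds 1 for the minus sign in the matrix.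
For a cycle through `e'`, wind + int of the cut walk is congruent to N_rj; the artificial step adds
another N_rj, and the remaining edges add one less than the length. -/
theorem sum_stepExponent_cycle (hN : N.IsPBDTP) {l : ℂ} (hl : N.IsGaugeDirection l)
    (he : N.src e = Sum.inl i) (hj : j ∉ N.sources) (he' : N.tgt e' = Sum.inl j)
    {c : Equiv.Perm E} (hc : c.IsCycle) (hcs : N.IsStepPerm e e' c) :
    ((∑ f ∈ c.support, N.stepExponent l i j e' f (c f) : ℤ) : ZMod 2) = c.support.card + 1 := by
  by_cases hmem : e' ∈ c.support
  · have hmem' := (hcs.mem_support_iff hN he he').mpr hmem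
    have hw := wind_parity_simple hN hl he hj (isWalk_orbitWalk hN he he' hc hcs hmem)
      (nodup_orbitWalk hc hmem')
      (fun f hf g hg => hcs.src_injOn hN he ((mem_orbitWalk hc hmem' f).mp hf)
        ((mem_orbitWalk hc hmem' g).mp hg))
      (fun f hf g hg => hcs.tgt_injOn hN he' ((mem_orbitWalk hc hmem' f).mp hf)
        ((mem_orbitWalk hc hmem' g).mp hg))
    rw [wind_add_int_orbitWalk l hc hmem hmem' (hcs.apply_eq hN he' hmem)] at hw
    have hw2 := (ZMod.intCast_eq_intCast_iff _ _ 2).mpr hw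
    have hs : ∑ f ∈ c.support, N.stepExponent l i j e' f (c f) =
        (∑ f ∈ c.support, ((if f = e' then 0 else localWind l (N.dir f) (N.dir (c f))) +
        (N.intEdge l f : ℤ))) + ((N.sourcesBetween i j : ℤ) - 1 + c.support.card) := by
      have h1 : ((N.sourcesBetween i j : ℤ) - 1 + c.support.card) =
          ∑ f ∈ c.support, ((if f = e' then (N.sourcesBetween i j : ℤ) - 1 else 0) + 1) := by
        rw [Finset.sum_add_distrib, Finset.sum_ite_eq' c.support e', if_pos hmem]
        simp
      rw [h1, ← Finset.sum_add_distrib]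
      refine Finset.sum_congr rfl fun f _ => ?_
      rw [stepExponent]
      split_ifs <;> ring
    rw [hs, Int.cast_add, hw2]
    push_cast
    linear_combination add_self_zmod_two (N.sourcesBetween i j : ZMod 2) - add_self_zmod_two 1
  · have h1 := wind_add_int_perm_cycle hN hl hc
      (fun f hf => hcs.tgt_eq_src hf (by rintro rfl; exact hmem hf))
      (fun f hf g hg => hcs.src_injOn hN he hf hg)
    have hs : ∑ f ∈ c.support, N.stepExponent l i j e' f (c f) =
        (∑ f ∈ c.support, (localWind l (N.dir f) (N.dir (c f)) + (N.intEdge l f : ℤ))) +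
          c.support.card := by
      rw [Finset.card_eq_sum_ones, Nat.cast_sum, ← Finset.sum_add_distrib]
      refine Finset.sum_congr rfl fun f hf => ?_
      rw [stepExponent, if_neg (by rintro rfl; exact hmem hf)]
      push_cast
      ring
    rw [hs, Int.cast_add, h1]
    push_cast
    ring

/-- Both factors are multiplicative over disjoint cycles. On a cycle of m edges the sign is
(-1)^(m-1) and the product is (-1)^(m+1). -/
theorem sign_mul_prod_stepExponent (hN : N.IsPBDTP) {l : ℂ} (hl : N.IsGaugeDirection l)
    (he : N.src e = Sum.inl i) (hj : j ∉ N.sources) (he' : N.tgt e' = Sum.inl j)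
    (σ : Equiv.Perm E) : N.IsStepPerm e e' σ → Equiv.Perm.sign σ *
      ∏ f ∈ σ.support, (-1 : ℤˣ) ^ N.stepExponent l i j e' f (σ f) = 1 := by
  induction σ using Equiv.Perm.cycle_induction_on with
  | base_one => simp
  | base_cycles c hc =>
    intro hcs
    have h := sum_stepExponent_cycle hN hl he hj he' hc hcs
    rw [hc.sign, prod_neg_one_zpow, neg_mul, ← zpow_natCast, ← zpow_add]
    have hodd : Odd ((c.support.card : ℤ) +
        ∑ f ∈ c.support, N.stepExponent l i j e' f (c f)) := by
      rw [← Int.not_even_iff_odd, even_iff_two_dvd]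
      intro h2
      have h3 := (ZMod.intCast_zmod_eq_zero_iff_dvd _ 2).mpr h2
      rw [Int.cast_add, h] at h3
      push_cast at h3
      have h4 : (1 : ZMod 2) = 0 := by
        linear_combination h3 - add_self_zmod_two (c.support.card : ZMod 2)
      exact absurd h4 (by decide)
    rw [hodd.neg_one_zpow, neg_neg]
  | induction_disjoint σ τ hd _ ihσ ihτ =>
    intro h
    have hsupp := hd.support_mul
    have hdisj : Disjoint σ.support τ.support := Equiv.Perm.disjoint_iff_disjoint_support.mp hd
    have h1 : ∀ f ∈ σ.support, (σ * τ) f = σ f := fun f hf => by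
      have : τ f = f := Equiv.Perm.notMem_support.mp (Finset.disjoint_left.mp hdisj hf)
      rw [Equiv.Perm.mul_apply, this]
    have h2 : ∀ f ∈ τ.support, (σ * τ) f = τ f := fun f hf => by
      have : σ (τ f) = τ f := Equiv.Perm.notMem_support.mp
        (Finset.disjoint_right.mp hdisj (Equiv.Perm.apply_mem_support.mpr hf))
      rw [Equiv.Perm.mul_apply, this]
    have hσ : N.IsStepPerm e e' σ := fun f hf => by
      rw [← h1 f hf]
      exact h f (hsupp ▸ Finset.mem_union_left _ hf)
    have hτ : N.IsStepPerm e e' τ := fun f hf => by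
      rw [← h2 f hf]
      exact h f (hsupp ▸ Finset.mem_union_right _ hf)
    rw [map_mul, hsupp, Finset.prod_union hdisj,
      Finset.prod_congr rfl fun f hf => by rw [h1 f hf],
      Finset.prod_congr (s₁ := τ.support) rfl fun f hf => by rw [h2 f hf]]
    rw [mul_mul_mul_comm, ihσ hσ, ihτ hτ, one_mul]

open MvPowerSeries in
/-- The factor of the edge `f` in the expansion of the determinant. -/
noncomputable def stepFactor (N : DiskNetwork n V E) (l : ℂ) (i j : Fin n) (e' f g : E) : MvPowerSeries E ℝ :=
  if f = g then 1 else
    ((((-1 : ℤˣ) ^ N.stepExponent l i j e' f g : ℤˣ) : ℤ) : MvPowerSeries E ℝ) * X f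

/-- Each surviving term of the determinant is a squarefree monomial with coefficient 1; this is
where all cancellation of signs is ruled out. -/
theorem sign_mul_prod_stepFactor (hN : N.IsPBDTP) {l : ℂ} (hl : N.IsGaugeDirection l)
    (he : N.src e = Sum.inl i) (hj : j ∉ N.sources) (he' : N.tgt e' = Sum.inl j)
    {σ : Equiv.Perm E} (hσ : N.IsStepPerm e e' σ) :
    (((Equiv.Perm.sign σ : ℤˣ) : ℤ) : MvPowerSeries E ℝ) *
      ∏ f, N.stepFactor l i j e' f (σ f) = ∏ f ∈ σ.support, MvPowerSeries.X f := by
  have h1 : ∏ f, N.stepFactor l i j e' f (σ f) = ∏ f ∈ σ.support,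
      (((((-1 : ℤˣ) ^ N.stepExponent l i j e' f (σ f) : ℤˣ) : ℤ) : MvPowerSeries E ℝ) *
        MvPowerSeries.X f) := by
    rw [← Finset.prod_subset (Finset.subset_univ σ.support)]
    · refine Finset.prod_congr rfl fun f hf => ?_
      rw [stepFactor, if_neg (Equiv.Perm.mem_support.mp hf).symm]
    · intro f _ hf
      rw [stepFactor, if_pos (Equiv.Perm.notMem_support.mp hf).symm]
  have h2 := congrArg (fun u : ℤˣ => ((u : ℤ) : MvPowerSeries E ℝ))
    (sign_mul_prod_stepExponent hN hl he hj he' σ hσ)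
  simp only [Units.val_mul, Int.cast_mul, Units.coe_prod, Int.cast_prod, Units.val_one,
    Int.cast_one] at h2
  rw [h1, Finset.prod_mul_distrib, ← mul_assoc, h2, one_mul]

/-- The matrix of the linear relations between the edge series. -/
noncomputable def relationMatrix (N : DiskNetwork n V E) (l : ℂ) : Matrix E E (MvPowerSeries E ℝ) :=
  Matrix.of fun f g => (if f = g then 1 else 0) - if N.tgt f = N.src g then
    MvPowerSeries.C ((-1 : ℝ) ^ (localWind l (N.dir f) (N.dir g) + (N.intEdge l f : ℤ))) *
      MvPowerSeries.X f else 0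

/-- The inhomogeneous term of the linear relations survives only at the edge that ends at `b j`,
which is unique because boundary vertices are univalent. -/
theorem relationMatrix_mulVec (hN : N.IsPBDTP) (l : ℂ) (he' : N.tgt e' = Sum.inl j) :
    (N.relationMatrix l).mulVec (fun f => N.edgeSeries l f j) =
      Pi.single e' (MvPowerSeries.C ((-1 : ℝ) ^ (N.intEdge l e' : ℤ)) * MvPowerSeries.X e') := by
  funext f
  have h := edgeSeries_eq (N := N) l f j
  have h1 : (N.relationMatrix l).mulVec (fun f => N.edgeSeries l f j) f =
      N.edgeSeries l f j - ∑ g, if N.tgt f = N.src g then MvPowerSeries.C ((-1 : ℝ) ^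
        (localWind l (N.dir f) (N.dir g) + (N.intEdge l f : ℤ))) * MvPowerSeries.X f *
        N.edgeSeries l g j else 0 := by
    simp only [Matrix.mulVec, dotProduct, relationMatrix, Matrix.of_apply, sub_mul, ite_mul,
      one_mul, zero_mul, Finset.sum_sub_distrib, Finset.sum_ite_eq, Finset.mem_univ, if_true]
  rw [h1, sub_eq_iff_eq_add', h]
  congr 1
  by_cases hf : f = e'
  · subst hf
    rw [if_pos he', Pi.single_eq_same]
  · rw [if_neg fun ht => hf (hN.eq_of_tgt_eq_inl ht he'), Pi.single_eq_of_ne hf]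

theorem relationMatrix_eq_stepFactor (hN : N.IsPBDTP) (l : ℂ) {f g : E} (hf : f ≠ e')
    (h : f = g ∨ N.tgt f = N.src g) : N.relationMatrix l f g = N.stepFactor l i j e' f g := by
  rw [relationMatrix, Matrix.of_apply, stepFactor]
  by_cases hfg : f = g
  · subst hfg
    rw [if_pos rfl, if_pos rfl, if_neg (hN.src_ne_tgt f).symm, sub_zero]
  · have h1 : N.tgt f = N.src g := h.resolve_left hfg
    rw [if_neg hfg, if_neg hfg, if_pos h1, zero_sub, stepExponent, if_neg hf, C_neg_one_zpow,
      add_assoc, zpow_add (-1 : ℤˣ) 1, zpow_one, neg_one_mul, Units.val_neg, Int.cast_neg, neg_mul]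

theorem relationMatrix_eq_zero (l : ℂ) {f g : E} (h : f ≠ g) (h' : N.tgt f ≠ N.src g) :
    N.relationMatrix l f g = 0 := by
  rw [relationMatrix, Matrix.of_apply, if_neg h, if_neg h', sub_zero]

/-- The unit row forces σ e' = x, and every other factor vanishes unless its edge is fixed or sent
to a following edge. The choice x = e' will give the determinant itself and x = e the cofactor
needed for Cramer's rule. -/
theorem det_updateRow_eq (l : ℂ) (x : E) (hx : x = e ∨ x = e') :
    ((N.relationMatrix l).updateRow e' (Pi.single x 1)).det =
      ∑ σ ∈ Finset.univ.filter (fun σ : Equiv.Perm E => N.IsStepPerm e e' σ ∧ σ e' = x),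
        (((Equiv.Perm.sign σ : ℤˣ) : ℤ) : MvPowerSeries E ℝ) *
          ∏ f ∈ Finset.univ.erase e', N.relationMatrix l f (σ f) := by
  -- The Leibniz formula has the permutation on the row index; transposition moves it to the column
  -- index.
  rw [← Matrix.det_transpose, Matrix.det_apply', Finset.sum_filter]
  refine Finset.sum_congr rfl fun σ _ => ?_
  simp only [Matrix.transpose_apply]
  rw [← Finset.mul_prod_erase Finset.univ _ (Finset.mem_univ e'), Matrix.updateRow_self]
  have h1 : ∏ f ∈ Finset.univ.erase e',
      (N.relationMatrix l).updateRow e' (Pi.single x 1) f (σ f) =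
      ∏ f ∈ Finset.univ.erase e', N.relationMatrix l f (σ f) :=
    Finset.prod_congr rfl fun f hf => by rw [Matrix.updateRow_ne (Finset.ne_of_mem_erase hf)]
  rw [h1]
  split_ifs with h
  · rw [h.2, Pi.single_eq_same, one_mul]
  · by_cases hσ : σ e' = x
    · have h2 : ¬ N.IsStepPerm e e' σ := fun h3 => h ⟨h3, hσ⟩
      simp only [IsStepPerm, not_forall] at h2
      obtain ⟨f, hf, hfs⟩ := h2
      have hfe : f ≠ e' := by
        rintro rfl
        rcases hx with rfl | rfl
        · exact hfs (Or.inr ⟨rfl, hσ⟩)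
        · exact Equiv.Perm.mem_support.mp hf hσ
      have h0 : ∏ f ∈ Finset.univ.erase e', N.relationMatrix l f (σ f) = 0 :=
        Finset.prod_eq_zero (Finset.mem_erase.mpr ⟨hfe, Finset.mem_univ f⟩)
          (relationMatrix_eq_zero l (Equiv.Perm.mem_support.mp hf).symm fun h3 => hfs (Or.inl h3))
      rw [h0, mul_zero, mul_zero]
    · rw [Pi.single_eq_of_ne hσ, zero_mul, mul_zero]

theorem prod_relationMatrix (hN : N.IsPBDTP) (l : ℂ) {σ : Equiv.Perm E}
    (hσ : N.IsStepPerm e e' σ) : ∏ f ∈ Finset.univ.erase e', N.relationMatrix l f (σ f) =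
      ∏ f ∈ Finset.univ.erase e', N.stepFactor l i j e' f (σ f) := by
  refine Finset.prod_congr rfl fun f hf => ?_
  have hfe := Finset.ne_of_mem_erase hf
  refine relationMatrix_eq_stepFactor hN l hfe ?_
  by_cases h : f ∈ σ.support
  · exact Or.inr (hσ.tgt_eq_src h hfe)
  · exact Or.inl (Equiv.Perm.notMem_support.mp h).symm

/-- The determinant is the generating function of the conservative flows. -/
theorem det_relationMatrix (hN : N.IsPBDTP) {l : ℂ} (hl : N.IsGaugeDirection l)
    (he : N.src e = Sum.inl i) (hj : j ∉ N.sources) (he' : N.tgt e' = Sum.inl j) :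
    (N.relationMatrix l).det = ∑ C ∈ N.conservativeFlows, ∏ f ∈ C, MvPowerSeries.X f := by
  -- No edge follows `e'`, so row `e'` is already a unit vector.
  have h1 : N.relationMatrix l = (N.relationMatrix l).updateRow e' (Pi.single e' 1) := by
    have h2 : (Pi.single e' 1 : E → MvPowerSeries E ℝ) = N.relationMatrix l e' := by
      funext g
      by_cases hg : g = e'
      · subst hg
        rw [Pi.single_eq_same, relationMatrix, Matrix.of_apply, if_pos rfl,
          if_neg (hN.src_ne_tgt g).symm, sub_zero]
      · rw [Pi.single_eq_of_ne hg, relationMatrix_eq_zero l (Ne.symm hg)]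
        exact fun h => hN.tgt_ne_of_src_eq_inl (h.symm.trans he') he'
    rw [h2, Matrix.updateRow_eq_self]
  rw [h1, det_updateRow_eq (e := e) l e' (Or.inr rfl)]
  refine Finset.sum_nbij (fun σ => σ.support) (fun σ hσ => ?_) (fun σ hσ τ hτ h => ?_)
    (fun C hC => ?_) (fun σ hσ => ?_)
  · obtain ⟨-, h2, h3⟩ := Finset.mem_filter.mp hσ
    exact Finset.mem_filter.mpr ⟨Finset.mem_univ _,
      h2.isConservativeFlow hN he he' (Equiv.Perm.notMem_support.mpr h3)⟩
  · exact (Finset.mem_filter.mp hσ).2.1.eq_of_support_eq hN he he' (Finset.mem_filter.mp hτ).2.1 h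
  · have hC := (Finset.mem_filter.mp hC).2
    obtain ⟨σ, h2, rfl⟩ := exists_isStepPerm_of_isConservativeFlow hN he he' hC
    refine ⟨σ, Finset.mem_coe.mpr (Finset.mem_filter.mpr ⟨Finset.mem_univ _, h2, ?_⟩), rfl⟩
    exact Equiv.Perm.notMem_support.mp fun h3 => (hC.2 e' h3 j).2 he'
  · obtain ⟨-, h2, h3⟩ := Finset.mem_filter.mp hσ
    rw [prod_relationMatrix (i := i) (j := j) hN l h2,
      ← sign_mul_prod_stepFactor hN hl he hj he' h2,
      ← Finset.mul_prod_erase Finset.univ _ (Finset.mem_univ e')]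
    congr 1
    rw [stepFactor, if_pos h3.symm, one_mul]

/-- The cofactor is the generating function of the edge flows. -/
theorem det_updateRow_mul (hN : N.IsPBDTP) {l : ℂ} (hl : N.IsGaugeDirection l)
    (he : N.src e = Sum.inl i) (hj : j ∉ N.sources) (he' : N.tgt e' = Sum.inl j) :
    ((N.relationMatrix l).updateRow e' (Pi.single e 1)).det *
      (MvPowerSeries.C ((-1 : ℝ) ^ (N.intEdge l e' : ℤ)) * MvPowerSeries.X e') =
    MvPowerSeries.C ((-1 : ℝ) ^ N.sourcesBetween i j) *
      ∑ F ∈ N.edgeFlows e j, ∏ f ∈ F, MvPowerSeries.X f := by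
  have hne := ne_of_src_of_tgt hN he he'
  rw [det_updateRow_eq (e := e) l e (Or.inl rfl), Finset.sum_mul, Finset.mul_sum]
  refine Finset.sum_nbij (fun σ => σ.support) (fun σ hσ => ?_) (fun σ hσ τ hτ h => ?_)
    (fun F hF => ?_) (fun σ hσ => ?_)
  · obtain ⟨-, h2, h3⟩ := Finset.mem_filter.mp hσ
    exact Finset.mem_filter.mpr ⟨Finset.mem_univ _,
      h2.isEdgeFlow hN he he' (Equiv.Perm.mem_support.mpr (h3 ▸ hne.symm))⟩
  · exact (Finset.mem_filter.mp hσ).2.1.eq_of_support_eq hN he he' (Finset.mem_filter.mp hτ).2.1 h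
  · have hF := (Finset.mem_filter.mp hF).2
    obtain ⟨σ, h2, rfl⟩ := exists_isStepPerm_of_isEdgeFlow hN he he' hF
    refine ⟨σ, Finset.mem_coe.mpr (Finset.mem_filter.mpr ⟨Finset.mem_univ _, h2, ?_⟩), rfl⟩
    exact h2.apply_eq hN he' ((isEdgeFlow_iff hN he he').mp hF).2.1
  · obtain ⟨-, h2, h3⟩ := Finset.mem_filter.mp hσ
    rw [prod_relationMatrix (i := i) (j := j) hN l h2,
      ← sign_mul_prod_stepFactor hN hl he hj he' h2,
      ← Finset.mul_prod_erase Finset.univ (fun f => N.stepFactor l i j e' f (σ f))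
        (Finset.mem_univ e'), h3]
    -- The factor of the artificial step is the right-hand side of the linear system at `e'` times
    -- (-1)^N_rj. This produces the sign in the formula.
    have h4 : N.stepFactor l i j e' e' e = MvPowerSeries.C ((-1 : ℝ) ^ N.sourcesBetween i j) *
        (MvPowerSeries.C ((-1 : ℝ) ^ (N.intEdge l e' : ℤ)) * MvPowerSeries.X e') := by
      rw [stepFactor, if_neg hne, stepExponent, if_pos rfl, ← C_neg_one_zpow,
        zpow_add₀ (by norm_num), map_mul, zpow_natCast, mul_assoc]
    have h5 : (MvPowerSeries.C ((-1 : ℝ) ^ N.sourcesBetween i j) : MvPowerSeries E ℝ) *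
        MvPowerSeries.C ((-1 : ℝ) ^ N.sourcesBetween i j) = 1 := by
      rw [← map_mul, ← mul_pow]
      simp
    rw [h4]
    linear_combination (-1 : MvPowerSeries E ℝ) * (((Equiv.Perm.sign σ : ℤˣ) : ℤ) *
      (∏ f ∈ Finset.univ.erase e', N.stepFactor l i j e' f (σ f)) *
      (MvPowerSeries.C ((-1 : ℝ) ^ (N.intEdge l e' : ℤ)) * MvPowerSeries.X e')) * h5

/-- Cramer's rule: the adjugate is applied to the linear system, and the entry of the adjugate at
`e` and `e'` is the determinant with row `e'` replaced by the unit vector at `e`. -/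
theorem conservativeFlows_mul_edgeSeries (hN : N.IsPBDTP) {l : ℂ} (hl : N.IsGaugeDirection l)
    (he : N.src e = Sum.inl i) (hj : j ∉ N.sources) (he' : N.tgt e' = Sum.inl j) :
    (∑ C ∈ N.conservativeFlows, ∏ f ∈ C, MvPowerSeries.X f) * N.edgeSeries l e j =
      MvPowerSeries.C ((-1 : ℝ) ^ N.sourcesBetween i j) *
        ∑ F ∈ N.edgeFlows e j, ∏ f ∈ F, MvPowerSeries.X f := by
  rw [← det_updateRow_mul hN hl he hj he', ← det_relationMatrix hN hl he hj he',
    ← Matrix.adjugate_apply]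
  have h := congrArg ((N.relationMatrix l).adjugate.mulVec) (relationMatrix_mulVec hN l he')
  rw [Matrix.mulVec_mulVec, Matrix.adjugate_mul, Matrix.smul_mulVec, Matrix.one_mulVec,
    Matrix.mulVec_single] at h
  have h1 := congrFun h e
  simpa [mul_comm] using h1

end Determinant

end DiskNetwork

/-! ### The boundary measurement formula -/

namespace DiskNetwork

section Main

open scoped Classical

variable {n : ℕ} {V E : Type*} [Fintype E] {N : DiskNetwork n V E} {e e' : E} {i j : Fin n}

/-- The generating polynomial of a family of sets of edges. -/
noncomputable def flowPolynomial (S : Finset (Finset E)) : MvPolynomial E ℝ :=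
  ∑ F ∈ S, ∏ f ∈ F, MvPolynomial.X f

theorem coe_flowPolynomial (S : Finset (Finset E)) :
    (flowPolynomial S : MvPowerSeries E ℝ) = ∑ F ∈ S, ∏ f ∈ F, MvPowerSeries.X f := by
  have h : ∀ p : MvPolynomial E ℝ, (p : MvPowerSeries E ℝ) =
    MvPolynomial.coeToMvPowerSeries.ringHom p := fun _ => rfl
  rw [h, flowPolynomial, map_sum]
  refine Finset.sum_congr rfl fun F _ => ?_
  rw [map_prod]
  refine Finset.prod_congr rfl fun f _ => ?_
  rw [← h, MvPolynomial.coe_X]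

theorem eval_flowPolynomial (N : DiskNetwork n V E) (S : Finset (Finset E)) :
    MvPolynomial.eval N.weight (flowPolynomial S) = ∑ F ∈ S, N.flowWeight F := by
  simp [flowPolynomial, flowWeight, map_sum, map_prod]

theorem coeff_flowPolynomial_nonneg (S : Finset (Finset E)) (m : E →₀ ℕ) :
    0 ≤ (flowPolynomial S).coeff m := by
  rw [flowPolynomial, MvPolynomial.coeff_sum]
  refine Finset.sum_nonneg fun F _ => ?_
  have h : (∏ f ∈ F, MvPolynomial.X f : MvPolynomial E ℝ) =
      MvPolynomial.monomial (∑ f ∈ F, Finsupp.single f 1) 1 := by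
    rw [MvPolynomial.monomial_sum_one]
    rfl
  rw [h, MvPolynomial.coeff_monomial]
  split_ifs <;> simp

theorem empty_mem_conservativeFlows (N : DiskNetwork n V E) : ∅ ∈ N.conservativeFlows := by
  refine Finset.mem_filter.mpr ⟨Finset.mem_univ _, fun v => ?_, fun f hf => ?_⟩
  · simp [arrive, leave]
  · simp at hf

/-- Evaluation at 1 counts the conservative flows, among which is the empty one. -/
theorem flowPolynomial_conservativeFlows_ne_zero (N : DiskNetwork n V E) :
    flowPolynomial N.conservativeFlows ≠ 0 := by
  intro h
  have h1 := congrArg (MvPolynomial.eval fun _ => (1 : ℝ)) h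
  simp only [flowPolynomial, map_sum, map_prod, MvPolynomial.eval_X, Finset.prod_const_one,
    Finset.sum_const, nsmul_eq_mul, mul_one, map_zero, Nat.cast_eq_zero, Finset.card_eq_zero] at h1
  exact Finset.notMem_empty _ (h1 ▸ empty_mem_conservativeFlows N)

theorem sumsToRational_edgeSeries (hN : N.IsPBDTP) {l : ℂ} (hl : N.IsGaugeDirection l)
    (he : N.src e = Sum.inl i) (hj : j ∉ N.sources) (he' : N.tgt e' = Sum.inl j) :
    SumsToRational (N.edgeSeries l e j)
      (MvPolynomial.C ((-1 : ℝ) ^ N.sourcesBetween i j) * flowPolynomial (N.edgeFlows e j))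
      (flowPolynomial N.conservativeFlows) := by
  refine ⟨coeff_flowPolynomial_nonneg _, flowPolynomial_conservativeFlows_ne_zero N, ?_⟩
  rw [coe_flowPolynomial, conservativeFlows_mul_edgeSeries hN hl he hj he', MvPolynomial.coe_mul,
    coe_flowPolynomial, MvPolynomial.coe_C]

/-- By `topWind_parity` the signs of each walk in the two series differ by the same factor
(-1)^N_rj. -/
theorem measurementSeries_eq (hN : N.IsPBDTP) {l : ℂ} (hl : N.IsGaugeDirection l)
    (he : N.src e = Sum.inl i) (hj : j ∉ N.sources) : N.measurementSeries i j =
      MvPowerSeries.C ((-1 : ℝ) ^ N.sourcesBetween i j) * N.edgeSeries l e j := by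
  rw [measurementSeries, edgeSeries, ← walkSeries_const_mul]
  have hW : ∀ P, (∃ f, N.src f = Sum.inl i ∧ N.IsWalk f j P) ↔ N.IsWalk e j P := fun P => by
    constructor
    · rintro ⟨f, hf, h⟩
      rwa [← hN.eq_of_src_eq_inl hf he]
    · exact fun h => ⟨e, he, h⟩
  refine walkSeries_congr hW fun P hP => ?_
  have h := topWind_parity hN hl he hj ((hW P).mp hP)
  rw [← zpow_natCast, ← zpow_add₀ (by norm_num)]
  refine neg_one_zpow_congr_of_zmod ?_
  rw [h]
  push_cast
  ring

/-- The sign between the two series cancels the sign in the numerator of the edge series; the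
prefactor in the definition of the matrix later restores it. -/
theorem sumsToRational_measurementSeries (hN : N.IsPBDTP) {l : ℂ} (hl : N.IsGaugeDirection l)
    (he : N.src e = Sum.inl i) (hj : j ∉ N.sources) (he' : N.tgt e' = Sum.inl j) :
    SumsToRational (N.measurementSeries i j) (flowPolynomial (N.edgeFlows e j))
      (flowPolynomial N.conservativeFlows) := by
  obtain ⟨h1, h2, h3⟩ := sumsToRational_edgeSeries hN hl he hj he'
  refine ⟨h1, h2, ?_⟩
  rw [measurementSeries_eq hN hl he hj, mul_left_comm, h3, MvPolynomial.coe_mul, ← mul_assoc,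
    MvPolynomial.coe_C, ← map_mul, ← mul_pow]
  simp

theorem exists_edge_of_notMem_sources (hN : N.IsPBDTP) (hj : j ∉ N.sources) :
    ∃ f, N.tgt f = Sum.inl j := by
  have h := hN.boundary_degree j
  have h1 : N.outDeg (Sum.inl j) = 0 := by
    rw [outDeg, Finset.card_eq_zero, Finset.filter_eq_empty_iff]
    exact fun f _ hf => hj (mem_sources_of_src hf)
  rw [degree, h1, add_zero] at h
  obtain ⟨f, hf⟩ := Finset.card_pos.mp (h ▸ one_pos : 0 < N.inDeg (Sum.inl j))
  exact ⟨f, (Finset.mem_filter.mp hf).2⟩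

theorem mem_edgeFlows {F : Finset E} : F ∈ N.edgeFlows e j ↔ N.IsEdgeFlow e j F := by
  simp [edgeFlows]

end Main

end DiskNetwork

theorem mainTheorem8 {n k : ℕ} {V E : Type*} [Fintype V] [Fintype E]
    (N : DiskNetwork n V E) (hN : N.IsPBDTP) (l : ℂ) (hl : N.IsGaugeDirection l)
    (hk : N.sources.card = k) (r : Fin k) (e : E) (he : N.src e = Sum.inl (N.sourceIdx hk r))
    (j : Fin n) (hj : j ∉ N.sources) :
    (∀ F ∈ N.edgeFlows e j, (∃! P, N.IsFlowWalk e j F P) ∧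
      N.windFlow l e j F + (N.intFlow l e j F : ℤ) ≡
        (N.sourcesBetween (N.sourceIdx hk r) j : ℤ) [ZMOD 2]) ∧
    IsRationalSeries (N.edgeSeries l e j) ∧
    IsRationalSeries (N.measurementSeries (N.sourceIdx hk r) j) ∧
    N.edgeVector l e j = (-1 : ℝ) ^ N.sourcesBetween (N.sourceIdx hk r) j *
      ((∑ F ∈ N.edgeFlows e j, N.flowWeight F) / ∑ C ∈ N.conservativeFlows, N.flowWeight C) ∧
    N.edgeVector l e j = N.measurementMatrix hk r j := by
  obtain ⟨e', he'⟩ := DiskNetwork.exists_edge_of_notMem_sources hN hj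
  have h1 := DiskNetwork.sumsToRational_edgeSeries hN hl he hj he'
  have h2 := DiskNetwork.sumsToRational_measurementSeries hN hl he hj he'
  have h3 : N.edgeVector l e j = (-1 : ℝ) ^ N.sourcesBetween (N.sourceIdx hk r) j *
      ((∑ F ∈ N.edgeFlows e j, N.flowWeight F) /
        ∑ C ∈ N.conservativeFlows, N.flowWeight C) := by
    rw [DiskNetwork.edgeVector, rationalValue_eq h1 hN.weight_pos, map_mul, MvPolynomial.eval_C,
      DiskNetwork.eval_flowPolynomial, DiskNetwork.eval_flowPolynomial, mul_div_assoc]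
  refine ⟨fun F hF => ?_, ⟨_, _, h1⟩, ⟨_, _, h2⟩, h3, ?_⟩
  · have hF' := DiskNetwork.mem_edgeFlows.mp hF
    exact ⟨DiskNetwork.existsUnique_isFlowWalk hN he he' hF',
      DiskNetwork.windFlow_add_intFlow hN hl he hj he' hF'⟩
  · rw [h3, DiskNetwork.measurementMatrix, Matrix.of_apply, if_neg hj,
      rationalValue_eq h2 hN.weight_pos, DiskNetwork.eval_flowPolynomial,
      DiskNetwork.eval_flowPolynomial]
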